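/- Let $p$ be a prime, $q$ a power of $p$, and $A$ the ring of functions on a nonsingular projective curve over $\mathbb F_q$ that are regular away from a fixed closed point $\infty$. Let $K\supseteq\mathbb F_q$ be a field that is finitely generated over $\mathbb F_p$, let $\tau(x)=x^q$, let $i:A\to K$ be a morphism of $\mathbb F_q$-algebras, and let $\phi:A\to K\{\tau\}$, $a\mapsto\phi_a$, be a Drinfeld module: a ring homomorphism such that the coefficient of $\tau^0$ in $\phi_a$ is $i(a)$ for all $a$, and $\phi_a\neq i(a)\tau^0$ for some $a$. A point $x\in K^{\mathrm{alg}}$ is torsion if $\phi_a(x)=0$ for some nonzero $a\in A$. The modular transcendence degree of $\phi$ is the minimum, over $\gamma\in K^{\mathrm{alg}}\setminus\{0\}$, of the transcendence degree over $\mathbb F_p$ of the field generated by all coefficients of all $\gamma^{-1}\phi_a\gamma$, $a\in A$. Let $F$ be the algebraic closure of $\mathbb F_p$ in $K$ and fix a transcendence basis $x_1,\dots,x_n$ of $K/F$; it is part of the data with which $K$ is equipped. On $F(x_1,\dots,x_n)$ take the valuations $v_P$, of degree $d(v_P)=\deg P$, for the irreducible polynomials $P\in F[x_1,\dots,x_n]$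 (up to constants), and $v_\infty=-(\text{total degree})$, of degree $d(v_\infty)=1$. For a finite extension $L$ of $K$ let $U_L$ be the set of all discrete valuations $w$ of $L$, normalized to have range $\mathbb Z$, that lie above one of these valuations $v$, and put $d(w)=f(w|v)\,d(v)/[L:F(x_1,\dots,x_n)]$, where $f(w|v)$ is the residue degree. For $x\in L$ and $w\in U_L$ put $$V_w(x)=\lim_{m\to\infty}\frac{\min\{0,w(\phi_{a^m}(x))\}}{\deg\phi_{a^m}},\qquad \hat h(x)=-\sum_{w\in U_L}d(w)\,V_w(x),$$ where $a\in A$ is any non-constant element and $\deg\phi_b=q^r$ if $\tau^r$ is the highest power of $\tau$ occurring in $\phi_b$. The value $\hat h(x)$ depends neither on $a$ nor on the finite extension $L$ of $K$ containing $x$. If $\phi$ has positive modular transcendence degree, then there is a constant $C>0$, depending only on $\phi$ and on $K$ (with its transcendence basis), such that $\hat h(x)\ge C$ for every non-torsion $x$ in the perfect closure $K^{\mathrm{per}}\subseteq K^{\mathrm{alg}}$ of $K$. -/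

import Mathlib

open Filter Topology
open scoped WithZero

noncomputable section

namespace Drinfeld

/-! ### The coordinate ring of the affine curve -/

section CoordinateRing

variable (Fq : Type*) [Field Fq] {E : Type*} [Field E] [Algebra Fq E]

/-- Let `E` be the function field of a nonsingular projective curve over `Fq`. The closed points of
the curve are the places of `E` over `Fq`, that is, the valuation subrings `V ≠ ⊤` of `E` that
contain `Fq`, and the local ring at a closed point is the corresponding `V`.

`regularAway Fq Vinf` is the ring of functions that are regular at all closed points except possibly
at the point `Vinf`. (The trivial valuation ring `⊤` imposes no condition.) -/
def regularAway (Vinf : ValuationSubring E) : Subalgebra Fq E where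
  carrier := {f | ∀ V : ValuationSubring E,
    (∀ c : Fq, algebraMap Fq E c ∈ V) → V ≠ Vinf → f ∈ V}
  mul_mem' hx hy V hV h := V.mul_mem _ _ (hx V hV h) (hy V hV h)
  add_mem' hx hy V hV h := V.add_mem _ _ (hx V hV h) (hy V hV h)
  algebraMap_mem' c _ hV _ := hV c

end CoordinateRing

/-! ### Twisted polynomials -/

section Twisted

variable (Fq : Type*) [Field Fq] [Fintype Fq]

/-- The action of `ℕ` on a field extension of `Fq` by iterates of `τ : x ↦ x ^ q`, `q = #Fq`. -/
@[reducible]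
def frobeniusAction (K : Type*) [Field K] [Algebra Fq K] :
    MulSemiringAction (Multiplicative ℕ) K :=
  MulSemiringAction.compHom K
    (powersHom (K →+* K) (FiniteField.frobeniusAlgHom Fq K : K →+* K))

/-- The ring `K{τ}` of twisted polynomials `∑ aᵢ τ ^ i`, where `τ * a = a ^ q * τ`. -/
def TwistedPolynomial (K : Type*) [Field K] [Algebra Fq K] : Type _ := SkewPolynomial K

variable {K : Type*} [Field K] [Algebra Fq K]

instance : Ring (TwistedPolynomial Fq K) :=
  letI := frobeniusAction Fq K
  inferInstanceAs (Ring (SkewPolynomial K))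

variable {Fq}

namespace TwistedPolynomial

/-- The coefficient of `τ ^ i`. -/
def coeff (f : TwistedPolynomial Fq K) (i : ℕ) : K :=
  SkewPolynomial.coeff (R := K) f i

/-- The finite set of those `i` for which the coefficient of `τ ^ i` is nonzero. -/
def support (f : TwistedPolynomial Fq K) : Finset ℕ :=
  SkewPolynomial.support (R := K) f

/-- The largest `i` for which the coefficient of `τ ^ i` is nonzero (`0` for `f = 0`). -/
def tauDegree (f : TwistedPolynomial Fq K) : ℕ := f.support.sup id

/-- The degree of `f = ∑ aᵢ τ ^ i`, seen as the polynomial `∑ aᵢ X ^ (q ^ i)`: it is `q ^ r` if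
`r` is the largest index of a nonzero coefficient. -/
def degree (f : TwistedPolynomial Fq K) : ℕ := Fintype.card Fq ^ f.tauDegree

/-- The value `∑ aᵢ x ^ (q ^ i)` of the operator `f = ∑ aᵢ τ ^ i` at an element `x` of an
extension `L` of `K`. -/
def eval {L : Type*} [Field L] [Algebra K L] (f : TwistedPolynomial Fq K) (x : L) : L :=
  ∑ i ∈ f.support, algebraMap K L (f.coeff i) * x ^ (Fintype.card Fq ^ i)

end TwistedPolynomial

variable (Fq) in
/-- The constant twisted polynomial `c τ ^ 0`. -/
def constant (c : K) : TwistedPolynomial Fq K :=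
  (SkewPolynomial.C c : SkewPolynomial K)

end Twisted

/-! ### Drinfeld modules -/

/-- A Drinfeld module `φ : A → K{τ}`. As `φ` lifts the `Fq`-algebra morphism `i`, it
automatically maps `c ∈ Fq` to `c τ ^ 0`. -/
structure DrinfeldModule (Fq : Type*) [Field Fq] [Fintype Fq] (A : Type*) [CommRing A]
    [Algebra Fq A] (K : Type*) [Field K] [Algebra Fq K] where
  /-- the morphism `i : A → K` -/
  structureMap : A →ₐ[Fq] K
  /-- the morphism `a ↦ φ_a` -/
  toRingHom : A →+* TwistedPolynomial Fq K
  coeff_zero : ∀ a, (toRingHom a).coeff 0 = structureMap a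
  exists_ne_constant : ∃ a, toRingHom a ≠ constant Fq (structureMap a)

namespace DrinfeldModule

variable {Fq : Type*} [Field Fq] [Fintype Fq] {A : Type*} [CommRing A] [Algebra Fq A]
  {K : Type*} [Field K] [Algebra Fq K] (φ : DrinfeldModule Fq A K)

/-- The action `φ_a(x)` of `a ∈ A` on an element `x` of an extension `L` of `K`. -/
def act {L : Type*} [Field L] [Algebra K L] (a : A) (x : L) : L := (φ.toRingHom a).eval x

/-- `x` is a torsion point: it is killed by a nonzero element of `A`. -/
def IsTorsion {L : Type*} [Field L] [Algebra K L] (x : L) : Prop :=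
  ∃ a : A, a ≠ 0 ∧ φ.act a x = 0

/-- The field of definition of the conjugate `φ^(γ) = γ⁻¹ φ γ`, where `γ ∈ Ω ⊇ K`: the smallest
subfield of `Ω` that contains all coefficients of `γ⁻¹ φ_a γ` for all `a ∈ A`. If
`φ_a = ∑ aᵢ τ ^ i` then `γ⁻¹ φ_a γ = ∑ γ⁻¹ aᵢ γ ^ (q ^ i) τ ^ i`. Every subfield contains the
prime field `ZMod p`. -/
def fieldOfDefinitionConj (p : ℕ) [Fact p.Prime] {Ω : Type*} [Field Ω] [Algebra K Ω]
    [Algebra (ZMod p) Ω] (γ : Ω) : IntermediateField (ZMod p) Ω :=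
  IntermediateField.adjoin (ZMod p)
    {c | ∃ (a : A) (i : ℕ),
      c = γ⁻¹ * algebraMap K Ω ((φ.toRingHom a).coeff i) * γ ^ (Fintype.card Fq ^ i)}

/-- The modular transcendence degree of `φ`: the minimum over `γ ∈ K^alg \ {0}` of the
transcendence degree over `𝔽_p` of the field of definition of `φ^(γ)`. -/
def modularTrdeg (p : ℕ) [Fact p.Prime] [Algebra (ZMod p) K] : Cardinal :=
  ⨅ γ : {γ : AlgebraicClosure K // γ ≠ 0},
    Algebra.trdeg (ZMod p) (φ.fieldOfDefinitionConj p γ.1)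

end DrinfeldModule

/-! ### Discrete valuations -/

section Valuations

variable {L : Type*} [Field L]

/-- The additive value `w(y) ∈ ℤ` for `y ≠ 0`, where `w` is a discrete valuation. Junk value `0` at
`y = 0`, so that `min 0 (ord w 0) = 0`, in accordance with `w(0) = +∞`. -/
def ord (w : Valuation L ℤᵐ⁰) (y : L) : ℤ := -WithZero.log (w y)

/-- The image in the residue field of `w` of those elements of a subfield `k` that are integral
at `w`. This is the residue field of the restriction of `w` to `k`. -/
def residueSubfield (k : Subfield L) (w : Valuation L ℤᵐ⁰) :
    Subfield (IsLocalRing.ResidueField w.valuationSubring) where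
  __ := (k.toSubring.comap w.valuationSubring.subtype).map
    (IsLocalRing.residue w.valuationSubring)
  inv_mem' := by
    rintro _ ⟨x, hx, rfl⟩
    by_cases h : IsLocalRing.residue w.valuationSubring x = 0
    · exact ⟨0, by simp, by simp [h]⟩
    · obtain ⟨u, rfl⟩ := IsLocalRing.residue_ne_zero_iff_isUnit x |>.1 h
      refine ⟨((u⁻¹ : (w.valuationSubring)ˣ) : w.valuationSubring), ?_, ?_⟩
      · have hu : (((u⁻¹ : (w.valuationSubring)ˣ) : w.valuationSubring) : L)
            = (((u : w.valuationSubring) : L))⁻¹ := by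
          refine eq_inv_of_mul_eq_one_left ?_
          exact_mod_cast congrArg (fun z : w.valuationSubring => (z : L)) u.inv_mul
        have hx' : ((u : w.valuationSubring) : L) ∈ k := hx
        change (((u⁻¹ : (w.valuationSubring)ˣ) : w.valuationSubring) : L) ∈ k
        rw [hu]
        exact k.inv_mem hx'
      · refine eq_inv_of_mul_eq_one_left ?_
        change IsLocalRing.residue _ _ * IsLocalRing.residue _ _ = 1
        rw [← map_mul, u.inv_mul, map_one]

/-- The relative degree `f(w|w₀)` of the residue fields, where `w₀` is the restriction of `w` to
the subfield `k`. -/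
def residueDegree (k : Subfield L) (w : Valuation L ℤᵐ⁰) : ℕ :=
  Module.finrank (residueSubfield k w) (IsLocalRing.ResidueField w.valuationSubring)

end Valuations

/-! ### The coherent good set of valuations

`F` is a field, `K` a finitely generated extension of `F` and `b = (x₁, …, xₙ)` a transcendence
basis of `K` over `F`. The base set of valuations lives on `F(x₁, …, xₙ)`; it consists of the
valuations `v_P` and `v_∞`. -/

section GoodSet

variable {F K : Type*} [Field F] [Field K] [Algebra F K] {n : ℕ}

/-- `v_P` on nonzero polynomials: the order of `Q` at `P`. -/
def ordPrime (P Q : MvPolynomial (Fin n) F) : ℤ := multiplicity P Q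

/-- `v_∞` on nonzero polynomials: minus the total degree. -/
def ordInfty (Q : MvPolynomial (Fin n) F) : ℤ := -(Q.totalDegree : ℤ)

variable (b : Fin n → K) {L : Type*} [Field L] [Algebra K L]

/-- The valuation `w` of `L` lies over the valuation `Q₁ / Q₂ ↦ v Q₁ - v Q₂` of `F(x₁, …, xₙ)`:
restricted to `F(x₁, …, xₙ)`, it is a positive multiple (by the ramification index `e`) of it. -/
def LiesOver (w : Valuation L ℤᵐ⁰) (v : MvPolynomial (Fin n) F → ℤ) : Prop :=
  ∃ e : ℕ, 0 < e ∧ ∀ Q₁ Q₂ : MvPolynomial (Fin n) F, Q₁ ≠ 0 → Q₂ ≠ 0 →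
    ord w (algebraMap K L (MvPolynomial.aeval b Q₁ / MvPolynomial.aeval b Q₂)) =
      e * (v Q₁ - v Q₂)

variable (F) in
/-- The valuation of `F(x₁, …, xₙ)` below `w` belongs to the base set and has degree `d`, where
`v_P` has degree `deg P` and `v_∞` has degree `1`. -/
def HasBaseDegree (w : Valuation L ℤᵐ⁰) (d : ℕ) : Prop :=
  (∃ P : MvPolynomial (Fin n) F, Irreducible P ∧ LiesOver b w (ordPrime P) ∧ d = P.totalDegree) ∨
    (LiesOver b w (ordInfty (F := F) (n := n)) ∧ d = 1)

variable (F L) in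
/-- The set `U_L` of all normalized discrete valuations (with range `ℤ`) of the finite extension
`L` of `K` that lie over a valuation `v_P` or over `v_∞`. -/
def goodSet : Set (Valuation L ℤᵐ⁰) :=
  {w | Function.Surjective w ∧ ∃ d, HasBaseDegree F b w d}

variable (F) in
/-- The degree `d(v)` of the base valuation `v` below `w ∈ U_L`; it is the only `d` with
`HasBaseDegree F b w d`. -/
def baseDegree (w : Valuation L ℤᵐ⁰) : ℕ := sInf {d | HasBaseDegree F b w d}

variable (F L) in
/-- The subfield `F(x₁, …, xₙ)` of `L`. -/
def baseField : Subfield L :=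
  (IntermediateField.adjoin F (Set.range b)).toSubfield.map (algebraMap K L)

variable (F) in
/-- The degree `d(w) = f(w|v) d(v) / [L : F(x₁, …, xₙ)]` of `w ∈ U_L`, with `v` the base valuation
below `w`. -/
def placeDegree (w : Valuation L ℤᵐ⁰) : ℝ :=
  (residueDegree (baseField F b L) w : ℝ) * baseDegree F b w /
    Module.finrank (baseField F b L) L

end GoodSet

/-! ### Heights -/

namespace DrinfeldModule

variable {Fq : Type*} [Field Fq] [Fintype Fq] {A : Type*} [CommRing A] [Algebra Fq A]
  {K : Type*} [Field K] [Algebra Fq K] (φ : DrinfeldModule Fq A K)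

/-- `V_w(x) = lim_m min(0, w(φ_{a^m}(x))) / deg φ_{a^m}`, for a non-constant `a ∈ A`. -/
def localV (a : A) {L : Type*} [Field L] [Algebra K L] (w : Valuation L ℤᵐ⁰) (x : L) : ℝ :=
  limUnder atTop fun m : ℕ =>
    ((min 0 (ord w (φ.act (a ^ m) x)) : ℤ) : ℝ) / ((φ.toRingHom (a ^ m)).degree : ℝ)

variable (F : Type*) [Field F] [Algebra F K] {n : ℕ} (b : Fin n → K)

/-- The local height `ĥ_w(x) = -d(w) V_w(x)`. -/
def localHeight (a : A) {L : Type*} [Field L] [Algebra K L] (w : Valuation L ℤᵐ⁰) (x : L) : ℝ :=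
  -placeDegree F b w * φ.localV a w x

/-- The global height of an element `x` of the finite extension `L` of `K`, as the (finite) sum of
its local heights over all `w ∈ U_L`. -/
def heightOn (a : A) {L : Type*} [Field L] [Algebra K L] (x : L) : ℝ :=
  ∑ᶠ w ∈ goodSet F b L, φ.localHeight F b a w x

/-- The global height `ĥ(x)` of `x ∈ K^alg`, computed in the finite extension `K(x)` of `K`. -/
def height (a : A) (x : AlgebraicClosure K) : ℝ :=
  φ.heightOn F b a (IntermediateField.AdjoinSimple.gen K x)

end DrinfeldModule

end Drinfeld

end

/-! Fix `t` with `φ_t` non-constant, of degree `N = q ^ r` and leading coefficient `a_r`.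
Conjugation by `γ` with `γ ^ (N - 1) = a_r⁻¹` makes `φ_t` monic. At a place `w` let `s` be the value
of `γ⁻¹` (`shift`) and `m` the largest pole order of the coefficients of the monic conjugate
(`defect`); both are real numbers defined without extending the field by `γ`. As soon as `w(x) + s <
-m`, the top term of `φ_t` dominates in all iterates and `V_w(x) = w(x) + s`.

Consider the places with `m > 0`. Either some iterate `φ_{t^i}(x)`, `i ≤ D + 4`, satisfies `w + s <
-m`, and then `-V_w(x)` is at least a fixed multiple of `m`; or all these iterates lie in one disc.
In the second case Lagrange interpolation shows that too many well separated iterates would force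
the coefficients of `φ_t` to be more integral than they are, so by pigeonhole two iterates are very
close. With `D = N ^ (7 S)`, where `S` bounds the number of places with `m > 0`, one pair `j < i`
serves all places of the second kind at once. The difference `y = φ_{t^i - t^j}(x)` is nonzero
because `x` is not torsion, and it satisfies `-(w(y) + s) + m / (4 N) ≤ M · (-V_w(x))` at every
place (`exists_ne_zero_forall_localV_le`). In the weighted sum over all places, the product formula
removes `w(y)` and `s`, so the height of `x` is at least `(4 N M)⁻¹ ∑ d(w) m_w`.

It remains to see that `M` does not depend on the field `L = K(x)` and that the sum of the defects
is bounded below. The extension `L / K` is purely inseparable, so `L` has no more places than `K`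
above each base valuation (`ncard_placesOver_le`), which bounds `S`, `D` and `M`. Positive modular
transcendence degree provides an invariant `a_j ^ (N - 1) / a_r ^ (q ^ j - 1)` that is
transcendental over `𝔽_p` (`exists_invariant_transcendental`), hence not integral over some base
valuation ring. Its pole orders are at most `(N - 1) m_w`, and the degree of its polar divisor in
`L` is at least `[L : K]` (`finrank_le_sum_placesOver`), which cancels the same factor in the
denominator of `d(w)`.

The product formula on inseparable extensions needs finite integral closures. They are available
because the field of constants `F` is perfect, so that the base valuation rings are finite over
their subrings of `p`-th powers. -/

noncomputable section

namespace Drinfeld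

/-! ### Twisted polynomials: product, degree and evaluation -/

namespace TwistedPolynomial

variable {Fq : Type*} [Field Fq] [Fintype Fq] {K : Type*} [Field K] [Algebra Fq K]

theorem smul_eq_pow (i : ℕ) (a : K) :
    letI := frobeniusAction Fq K
    (Multiplicative.ofAdd i • a : K) = a ^ (Fintype.card Fq ^ i) := by
  let _ := frobeniusAction Fq K
  induction i generalizing a with
  | zero => simp
  | succ i ih =>
    rw [ofAdd_add, mul_smul, ih, pow_succ', pow_mul]
    rfl

theorem mem_support {f : TwistedPolynomial Fq K} {i : ℕ} : i ∈ f.support ↔ f.coeff i ≠ 0 :=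
  SkewPolynomial.mem_support_iff

theorem ext' {f g : TwistedPolynomial Fq K} (h : ∀ i, f.coeff i = g.coeff i) : f = g :=
  SkewMonoidAlgebra.ext fun a => h (Multiplicative.toAdd a)

theorem coeff_zero' (i : ℕ) : (0 : TwistedPolynomial Fq K).coeff i = 0 := rfl

theorem coeff_add (f g : TwistedPolynomial Fq K) (i : ℕ) :
    (f + g).coeff i = f.coeff i + g.coeff i :=
  congrArg (· (Multiplicative.ofAdd i)) (SkewMonoidAlgebra.coeff_add (k := K) f g)

theorem coeff_one (i : ℕ) : (1 : TwistedPolynomial Fq K).coeff i = if i = 0 then 1 else 0 := by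
  let _ := frobeniusAction Fq K
  have := SkewPolynomial.coeff_one (R := K) i
  simp only [eq_comm] at this ⊢
  exact this

theorem coeff_constant (c : K) (i : ℕ) : (constant Fq c).coeff i = if i = 0 then c else 0 :=
  SkewPolynomial.coeff_C

theorem coeff_mul (f g : TwistedPolynomial Fq K) (n : ℕ) :
    (f * g).coeff n =
      ∑ ij ∈ Finset.HasAntidiagonal.antidiagonal n, f.coeff ij.1 * g.coeff ij.2 ^ (Fintype.card Fq ^ ij.1) := by
  let _ := frobeniusAction Fq K
  have := SkewMonoidAlgebra.coeff_mul_antidiagonal_of_finset (k := K) (G := Multiplicative ℕ) f g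
    (Multiplicative.ofAdd n)
    ((Finset.HasAntidiagonal.antidiagonal n).map ⟨fun ij => (Multiplicative.ofAdd ij.1, Multiplicative.ofAdd ij.2),
      fun a b h => by simpa [Prod.ext_iff] using h⟩) (by
      rintro ⟨a, b⟩
      simp only [Finset.mem_map, Finset.HasAntidiagonal.mem_antidiagonal]
      constructor
      · rintro ⟨ij, rfl, h⟩
        exact (congrArg (fun c => c.1 * c.2) h).symm
      · intro h
        exact ⟨(Multiplicative.toAdd a, Multiplicative.toAdd b), h, rfl⟩)
  rw [Finset.sum_map] at this
  refine Eq.trans this (Finset.sum_congr rfl fun ij _ => ?_)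
  exact congrArg (_ * ·) (smul_eq_pow _ _)

theorem coeff_eq_zero_of_lt {f : TwistedPolynomial Fq K} {i : ℕ} (h : f.tauDegree < i) :
    f.coeff i = 0 := by
  by_contra hi
  exact absurd (Finset.le_sup (f := id) (mem_support.2 hi)) (not_le.2 h)

theorem coeff_tauDegree_ne_zero {f : TwistedPolynomial Fq K} (h : f ≠ 0) :
    f.coeff f.tauDegree ≠ 0 := by
  have hne : f.support.Nonempty := by
    by_contra hf
    refine h (ext' fun i => ?_)
    by_contra hi
    exact hf ⟨i, mem_support.2 hi⟩
  obtain ⟨i, hi, he⟩ := Finset.exists_mem_eq_sup f.support hne id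
  rw [tauDegree, he]
  exact mem_support.1 hi

theorem tauDegree_eq_of {f : TwistedPolynomial Fq K} {r : ℕ} (h : f.coeff r ≠ 0)
    (h' : ∀ i, r < i → f.coeff i = 0) : f.tauDegree = r :=
  le_antisymm (Finset.sup_le fun i hi => by
    by_contra hr
    exact mem_support.1 hi (h' i (not_le.1 hr))) (Finset.le_sup (f := id) (mem_support.2 h))

theorem coeff_mul_top (f g : TwistedPolynomial Fq K) :
    (f * g).coeff (f.tauDegree + g.tauDegree) =
      f.coeff f.tauDegree * g.coeff g.tauDegree ^ (Fintype.card Fq ^ f.tauDegree) := by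
  rw [coeff_mul, Finset.sum_eq_single (f.tauDegree, g.tauDegree)]
  · rintro ⟨i, j⟩ hij hne
    rw [Finset.HasAntidiagonal.mem_antidiagonal] at hij
    simp only at hij ⊢
    rcases lt_trichotomy i f.tauDegree with h | h | h
    · rw [coeff_eq_zero_of_lt (i := j) (by omega), zero_pow (by positivity), mul_zero]
    · exact absurd (by simp only [Prod.mk.injEq]; omega) hne
    · rw [coeff_eq_zero_of_lt h, zero_mul]
  · intro h
    simp at h

theorem mul_ne_zero' {f g : TwistedPolynomial Fq K} (hf : f ≠ 0) (hg : g ≠ 0) : f * g ≠ 0 := by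
  intro h
  have := coeff_mul_top f g
  rw [h, coeff_zero'] at this
  exact mul_ne_zero (coeff_tauDegree_ne_zero hf) (pow_ne_zero _ (coeff_tauDegree_ne_zero hg))
    this.symm

theorem tauDegree_mul {f g : TwistedPolynomial Fq K} (hf : f ≠ 0) (hg : g ≠ 0) :
    (f * g).tauDegree = f.tauDegree + g.tauDegree := by
  refine tauDegree_eq_of ?_ fun i hi => ?_
  · rw [coeff_mul_top]
    exact mul_ne_zero (coeff_tauDegree_ne_zero hf) (pow_ne_zero _ (coeff_tauDegree_ne_zero hg))
  · rw [coeff_mul]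
    refine Finset.sum_eq_zero ?_
    rintro ⟨a, b⟩ hab
    rw [Finset.HasAntidiagonal.mem_antidiagonal] at hab
    simp only at hab ⊢
    rcases lt_or_ge f.tauDegree a with h | h
    · rw [coeff_eq_zero_of_lt h, zero_mul]
    · rw [coeff_eq_zero_of_lt (i := b) (by omega), zero_pow (by positivity), mul_zero]

section Eval

variable {L : Type*} [Field L] [Algebra K L]

variable (Fq) in
theorem add_pow_card_pow (K : Type*) [Field K] [Algebra Fq K] [Algebra K L] (i : ℕ) (x y : L) :
    (x + y) ^ (Fintype.card Fq ^ i) = x ^ (Fintype.card Fq ^ i) + y ^ (Fintype.card Fq ^ i) := by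
  -- Through `K` the field `L` becomes an extension of `Fq`, so that `z ↦ z ^ q` is its Frobenius
  -- homomorphism over `Fq`.
  let _ : Algebra Fq L := ((algebraMap K L).comp (algebraMap Fq K)).toAlgebra
  induction i generalizing x y with
  | zero => simp
  | succ i ih =>
    have h : ∀ z : L, z ^ Fintype.card Fq = FiniteField.frobeniusAlgHom Fq L z := fun _ => rfl
    rw [pow_succ', pow_mul, pow_mul, pow_mul, h, h x, h y, map_add, ih]

theorem eval_eq_sum_of_subset (f : TwistedPolynomial Fq K) (x : L) {s : Finset ℕ}
    (hs : f.support ⊆ s) :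
    f.eval x = ∑ i ∈ s, algebraMap K L (f.coeff i) * x ^ (Fintype.card Fq ^ i) := by
  refine Finset.sum_subset hs fun i _ hi => ?_
  rw [mem_support, not_not] at hi
  rw [hi, map_zero, zero_mul]

theorem eval_add_left (f g : TwistedPolynomial Fq K) (x : L) :
    (f + g).eval x = f.eval x + g.eval x := by
  classical
  have h : (f + g).support ⊆ f.support ∪ g.support := fun i hi => by
    rw [mem_support, coeff_add] at hi
    simp only [Finset.mem_union, mem_support]
    by_contra! hh
    rw [hh.1, hh.2, add_zero] at hi
    exact hi rfl
  rw [eval_eq_sum_of_subset _ _ h, eval_eq_sum_of_subset f x Finset.subset_union_left,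
    eval_eq_sum_of_subset g x Finset.subset_union_right, ← Finset.sum_add_distrib]
  simp only [coeff_add, map_add, add_mul]

theorem eval_zero_left (x : L) : (0 : TwistedPolynomial Fq K).eval x = 0 := by
  simpa using eval_add_left (0 : TwistedPolynomial Fq K) 0 x

theorem eval_add (f : TwistedPolynomial Fq K) (x y : L) :
    f.eval (x + y) = f.eval x + f.eval y := by
  simp only [eval, ← Finset.sum_add_distrib, add_pow_card_pow Fq K, mul_add]

theorem eval_zero (f : TwistedPolynomial Fq K) : f.eval (0 : L) = 0 := by
  simpa using eval_add f (0 : L) 0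

theorem eval_neg (f : TwistedPolynomial Fq K) (x : L) : f.eval (-x) = -f.eval x :=
  eq_neg_of_add_eq_zero_left (by rw [← eval_add, neg_add_cancel, eval_zero])

theorem eval_sub (f : TwistedPolynomial Fq K) (x y : L) :
    f.eval (x - y) = f.eval x - f.eval y := by
  rw [sub_eq_add_neg, eval_add, eval_neg, sub_eq_add_neg]

variable (Fq) in
/-- The twisted monomial `c τ ^ i`. -/
def mono (i : ℕ) (c : K) : TwistedPolynomial Fq K := SkewPolynomial.monomial (R := K) i c

theorem coeff_mono (i j : ℕ) (c : K) : (mono Fq i c).coeff j = if i = j then c else 0 :=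
  SkewPolynomial.coeff_monomial

theorem eval_mono (i : ℕ) (c : K) (x : L) :
    (mono Fq i c).eval x = algebraMap K L c * x ^ (Fintype.card Fq ^ i) := by
  rw [eval_eq_sum_of_subset (s := {i}), Finset.sum_singleton, coeff_mono, if_pos rfl]
  intro j hj
  rw [mem_support, coeff_mono] at hj
  simp only [Finset.mem_singleton]
  by_contra h
  exact hj (if_neg (Ne.symm h))

theorem mono_mul_mono (i j : ℕ) (c d : K) :
    mono Fq i c * mono Fq j d = mono Fq (i + j) (c * d ^ (Fintype.card Fq ^ i)) := by
  let _ := frobeniusAction Fq K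
  have := SkewPolynomial.monomial_mul_monomial (R := K) i j c d
  rw [SkewPolynomial.φ_iterate_apply, smul_eq_pow] at this
  exact this

theorem induction_mono {motive : TwistedPolynomial Fq K → Prop} (f : TwistedPolynomial Fq K)
    (h0 : motive 0) (ha : ∀ i c g, motive g → motive (mono Fq i c + g)) : motive f :=
  SkewPolynomial.induction (motive := motive) f h0 fun i c g _ _ hg => ha i c g hg

/-- Both sides are additive in `f` and, since evaluation of `f` is additive, also in `g`; this
leaves the case of two monomials. -/
theorem eval_mul (f g : TwistedPolynomial Fq K) (x : L) :
    (f * g).eval x = f.eval (g.eval x) := by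
  induction f using induction_mono with
  | h0 => rw [zero_mul, eval_zero_left, eval_zero_left]
  | ha i c f hf =>
    rw [add_mul, eval_add_left, eval_add_left, hf]
    congr 1
    clear hf
    induction g using induction_mono with
    | h0 => rw [mul_zero, eval_zero_left, eval_zero]
    | ha j d g hg =>
      rw [mul_add, eval_add_left, eval_add_left, hg, eval_add, mono_mul_mono, eval_mono, eval_mono,
        eval_mono, eval_mono, map_mul, map_pow, mul_pow, ← pow_mul, ← pow_add, add_comm j i, mul_assoc]

theorem eval_one (x : L) : (1 : TwistedPolynomial Fq K).eval x = x := by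
  have h : (1 : TwistedPolynomial Fq K) = mono Fq 0 1 :=
    ext' fun i => by simp only [coeff_one, coeff_mono, eq_comm]
  rw [h, eval_mono]
  simp

end Eval

end TwistedPolynomial

end Drinfeld

end

noncomputable section

universe u v

namespace Drinfeld

/-! ### The `A`-action and the rank of `φ_a` -/

namespace DrinfeldModule

open TwistedPolynomial

variable {Fq : Type*} [Field Fq] [Fintype Fq] {A : Type*} [CommRing A] [Algebra Fq A]
  {K : Type*} [Field K] [Algebra Fq K] (φ : DrinfeldModule Fq A K)
  {L : Type*} [Field L] [Algebra K L]

theorem act_mul (a b : A) (x : L) : φ.act (a * b) x = φ.act a (φ.act b x) := by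
  rw [act, map_mul, eval_mul, act, act]

theorem act_comm (a b : A) (x : L) : φ.act a (φ.act b x) = φ.act b (φ.act a x) := by
  rw [← act_mul, mul_comm, act_mul]

theorem act_add_left (a b : A) (x : L) : φ.act (a + b) x = φ.act a x + φ.act b x := by
  rw [act, map_add, eval_add_left, act, act]

theorem act_sub_left (a b : A) (x : L) : φ.act (a - b) x = φ.act a x - φ.act b x := by
  rw [eq_sub_iff_add_eq, ← act_add_left, sub_add_cancel]

theorem act_one (x : L) : φ.act (1 : A) x = x := by
  rw [act, map_one, eval_one]

/-- The degree of `φ_a` in `τ`. -/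
def rk (a : A) : ℕ := (φ.toRingHom a).tauDegree

theorem exists_rk_pos : ∃ t, 0 < φ.rk t := by
  obtain ⟨t, ht⟩ := φ.exists_ne_constant
  refine ⟨t, Nat.pos_of_ne_zero fun h => ht (ext' fun i => ?_)⟩
  rw [coeff_constant]
  split_ifs with hi
  · rw [hi, φ.coeff_zero]
  · exact coeff_eq_zero_of_lt (by rw [rk] at h; omega)

theorem toRingHom_ne_zero_of_rk_pos {a : A} (h : 0 < φ.rk a) : φ.toRingHom a ≠ 0 := by
  intro h0
  rw [rk, h0] at h
  exact absurd h (by simp [tauDegree, show (0 : TwistedPolynomial Fq K).support = ∅ from rfl])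

theorem toRingHom_pow_ne_zero {a : A} (h : φ.toRingHom a ≠ 0) (m : ℕ) :
    φ.toRingHom (a ^ m) ≠ 0 := by
  induction m with
  | zero =>
    rw [pow_zero, map_one]
    intro h1
    have := congrArg (fun f => f.coeff 0) h1
    simp [TwistedPolynomial.coeff_one, coeff_zero'] at this
  | succ m ih =>
    rw [pow_succ, map_mul]
    exact mul_ne_zero' ih h

theorem rk_one : φ.rk 1 = 0 := by
  rw [rk, map_one]
  refine tauDegree_eq_of ?_ fun i hi => ?_
  · simp [TwistedPolynomial.coeff_one]
  · rw [TwistedPolynomial.coeff_one, if_neg (by omega)]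

theorem rk_pow {a : A} (h : φ.toRingHom a ≠ 0) (m : ℕ) : φ.rk (a ^ m) = m * φ.rk a := by
  induction m with
  | zero => rw [pow_zero, rk_one, zero_mul]
  | succ m ih =>
    rw [rk, pow_succ, map_mul, tauDegree_mul (φ.toRingHom_pow_ne_zero h m) h, Nat.succ_mul]
    exact congrArg (· + _) ih

theorem degree_pow {a : A} (h : φ.toRingHom a ≠ 0) (m : ℕ) :
    (φ.toRingHom (a ^ m)).degree = (φ.toRingHom a).degree ^ m := by
  have := φ.rk_pow h m
  rw [rk, rk] at this
  rw [degree, degree, this, mul_comm, pow_mul]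

/-- The leading coefficient of `φ_{a^m}` is that of `φ_a` to the power `1 + N + ⋯ + N ^ (m - 1)`.
The exponent `N - 1` turns this geometric sum into `N ^ m - 1`. -/
theorem leadingCoeff_pow {a : A} (h : φ.toRingHom a ≠ 0) (m : ℕ) :
    (φ.toRingHom (a ^ m)).coeff (φ.rk (a ^ m)) ^ ((φ.toRingHom a).degree - 1) =
      (φ.toRingHom a).coeff (φ.rk a) ^ ((φ.toRingHom a).degree ^ m - 1) := by
  have hd : 0 < (φ.toRingHom a).degree := pow_pos Fintype.card_pos _
  induction m with
  | zero => simp [rk_one, TwistedPolynomial.coeff_one]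
  | succ m ih =>
    have h1 : (φ.toRingHom (a ^ (m + 1))).coeff (φ.rk (a ^ (m + 1))) =
        (φ.toRingHom a).coeff (φ.rk a) *
          (φ.toRingHom (a ^ m)).coeff (φ.rk (a ^ m)) ^ (φ.toRingHom a).degree := by
      have h2 : φ.rk (a ^ (m + 1)) = φ.rk a + φ.rk (a ^ m) := by
        rw [φ.rk_pow h, φ.rk_pow h, Nat.succ_mul, add_comm]
      rw [h2, pow_succ', map_mul]
      exact coeff_mul_top _ _
    rw [h1, mul_pow, ← pow_mul, mul_comm (φ.toRingHom a).degree, pow_mul, ih, ← pow_mul, ← pow_add]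
    congr 1
    have : 0 < (φ.toRingHom a).degree ^ m := pow_pos hd m
    rw [pow_succ, Nat.sub_mul]
    have h3 : (φ.toRingHom a).degree ≤ (φ.toRingHom a).degree ^ m * (φ.toRingHom a).degree :=
      Nat.le_mul_of_pos_left _ this
    omega

/-- A nonzero `u` satisfies `u ^ (q - 1) = 1`, and the rank of a power is a multiple of the rank, so
the rank of `u` vanishes. -/
theorem coeff_algebraMap (u : Fq) {i : ℕ} (hi : 0 < i) :
    (φ.toRingHom (algebraMap Fq A u)).coeff i = 0 := by
  by_cases hu : u = 0
  · rw [hu, map_zero, map_zero, coeff_zero']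
  have hc : Fintype.card Fq - 1 ≠ 0 := by
    have := Fintype.one_lt_card (α := Fq)
    omega
  have h1 : (algebraMap Fq A u) ^ (Fintype.card Fq - 1) = 1 := by
    rw [← map_pow, FiniteField.pow_card_sub_one_eq_one u hu, map_one]
  have hne : φ.toRingHom (algebraMap Fq A u) ≠ 0 := by
    intro h0
    have := congrArg φ.toRingHom h1
    rw [map_pow, h0, zero_pow hc, map_one] at this
    have := congrArg (fun f => f.coeff 0) this
    simp [TwistedPolynomial.coeff_one, coeff_zero'] at this
  have h2 := φ.rk_pow hne (Fintype.card Fq - 1)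
  rw [h1, rk_one, eq_comm, mul_eq_zero] at h2
  refine coeff_eq_zero_of_lt (lt_of_eq_of_lt ?_ hi)
  exact h2.resolve_left hc

theorem coeff_constant_mul (c : K) (f : TwistedPolynomial Fq K) (n : ℕ) :
    (constant Fq c * f).coeff n = c * f.coeff n := by
  rw [TwistedPolynomial.coeff_mul, Finset.sum_eq_single (0, n)]
  · simp [coeff_constant]
  · rintro ⟨i, j⟩ hij hne
    rw [Finset.HasAntidiagonal.mem_antidiagonal] at hij
    simp only at hij ⊢
    have : i ≠ 0 := by
      rintro rfl
      exact hne (by simp_all)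
    rw [coeff_constant, if_neg this, zero_mul]
  · simp

theorem eq_constant_aeval {a : A} (ha : φ.rk a = 0) (r : Polynomial Fq) :
    φ.toRingHom (Polynomial.aeval a r) = constant Fq (Polynomial.aeval (φ.structureMap a) r) := by
  have hz : ∀ i, 0 < i → (φ.toRingHom (Polynomial.aeval a r)).coeff i = 0 := by
    induction r using Polynomial.induction_on' with
    | add f g hf hg =>
      intro i hi
      rw [map_add, map_add, coeff_add, hf i hi, hg i hi, add_zero]
    | monomial n u =>
      have h1 : ∀ m i, 0 < i → (φ.toRingHom (a ^ m)).coeff i = 0 := by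
        intro m
        by_cases h0 : φ.toRingHom a = 0
        · rcases Nat.eq_zero_or_pos m with rfl | hm
          · intro i hi
            rw [pow_zero, map_one, TwistedPolynomial.coeff_one, if_neg hi.ne']
          · intro i _
            rw [map_pow, h0, zero_pow hm.ne', coeff_zero']
        · intro i hi
          have := φ.rk_pow h0 m
          rw [ha, mul_zero] at this
          exact coeff_eq_zero_of_lt (lt_of_eq_of_lt this hi)
      intro i hi
      rw [Polynomial.aeval_monomial, map_mul, TwistedPolynomial.coeff_mul]
      refine Finset.sum_eq_zero ?_
      rintro ⟨k, l⟩ hkl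
      rw [Finset.HasAntidiagonal.mem_antidiagonal] at hkl
      simp only at hkl ⊢
      rcases Nat.eq_zero_or_pos k with hk | hk
      · rw [h1 n l (by omega), zero_pow (pow_pos Fintype.card_pos _).ne', mul_zero]
      · rw [φ.coeff_algebraMap u hk, zero_mul]
  refine ext' fun i => ?_
  rw [coeff_constant]
  split_ifs with hi
  · rw [hi, φ.coeff_zero, Polynomial.aeval_algHom_apply]
  · exact hz i (Nat.pos_of_ne_zero hi)

/-- If `φ_a` were a constant `c`, the relation would read `∑ P_j(c) φ_t ^ j = 0`. By primitivity not
all `P_j(c)` vanish, and the last nonzero one belongs to a power of `φ_t` whose top degree in `τ` no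
other term reaches. -/
theorem rk_pos_of_relation {a t : A} (ht : 0 < φ.rk t) {P : Polynomial (Polynomial Fq)}
    (hP : P.IsPrimitive)
    (h : P.eval₂ (Polynomial.aeval a : Polynomial Fq →ₐ[Fq] A).toRingHom t = 0) :
    0 < φ.rk a := by
  refine Nat.pos_of_ne_zero fun ha => ?_
  set c := φ.structureMap a
  have hne : ∃ j, Polynomial.aeval c (P.coeff j) ≠ 0 := by
    by_contra! hall
    -- For transcendental `c` the minimal polynomial is `0` by default; it is not a unit in this
    -- case either.
    have hdvd : Polynomial.C (minpoly Fq c) ∣ P :=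
      Polynomial.C_dvd_iff_dvd_coeff _ _ |>.2 fun j => minpoly.dvd _ _ (hall j)
    exact minpoly.not_isUnit Fq c (hP _ hdvd)
  have hbound : ∀ j, Polynomial.aeval c (P.coeff j) ≠ 0 → j ≤ P.natDegree := fun j hj => by
    by_contra hlt
    rw [Polynomial.coeff_eq_zero_of_natDegree_lt (not_le.1 hlt), map_zero] at hj
    exact hj rfl
  classical
  let J := Nat.findGreatest (fun j => Polynomial.aeval c (P.coeff j) ≠ 0) P.natDegree
  obtain ⟨j0, hj0⟩ := hne
  have hJ : Polynomial.aeval c (P.coeff J) ≠ 0 :=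
    Nat.findGreatest_spec (P := fun j => Polynomial.aeval c (P.coeff j) ≠ 0) (hbound j0 hj0) hj0
  have hJ' : ∀ j, J < j → Polynomial.aeval c (P.coeff j) = 0 := fun j hj => by
    by_contra hc
    exact absurd (Nat.le_findGreatest (hbound j hc) hc) (not_le.2 hj)
  have hne := φ.toRingHom_ne_zero_of_rk_pos ht
  have h2 := congrArg (fun b => (φ.toRingHom b).coeff (J * φ.rk t)) h
  simp only [Polynomial.eval₂_eq_sum_range, map_sum, map_zero, coeff_zero'] at h2
  have hsum : ∀ (s : Finset ℕ) (f : ℕ → TwistedPolynomial Fq K) (n : ℕ),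
      (∑ j ∈ s, f j).coeff n = ∑ j ∈ s, (f j).coeff n := fun s f n =>
    map_sum (⟨⟨fun f => f.coeff n, coeff_zero' n⟩, fun f g => coeff_add f g n⟩ :
      TwistedPolynomial Fq K →+ K) f s
  have hterm : ∀ j, (φ.toRingHom ((Polynomial.aeval a : Polynomial Fq →ₐ[Fq] A).toRingHom
      (P.coeff j) * t ^ j)).coeff (J * φ.rk t) =
      Polynomial.aeval c (P.coeff j) * (φ.toRingHom (t ^ j)).coeff (J * φ.rk t) := fun j => by
    rw [map_mul, ← coeff_constant_mul]
    congr 2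
    exact φ.eq_constant_aeval ha _
  rw [hsum, Finset.sum_congr rfl fun j _ => hterm j, Finset.sum_eq_single J] at h2
  · refine mul_ne_zero hJ ?_ h2
    rw [← φ.rk_pow hne]
    exact coeff_tauDegree_ne_zero (φ.toRingHom_pow_ne_zero hne J)
  · intro j _ hj
    rcases lt_or_gt_of_ne hj with h | h
    · rw [coeff_eq_zero_of_lt, mul_zero]
      change φ.rk _ < _
      rw [φ.rk_pow hne]
      exact Nat.mul_lt_mul_of_pos_right h ht
    · rw [hJ' j h, zero_mul]
  · intro hJn
    exact absurd (Finset.mem_range.2 (Nat.lt_succ_of_le (hbound J hJ))) hJn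

open Polynomial in
-- By additivity of transcendence degrees, `t` is algebraic over `Fq[a]`. The content of an
-- algebraic relation does not vanish at the transcendental `a` and can be divided out.
theorem exists_isPrimitive_relation {Fq : Type u} [Field Fq] {E : Type v} [Field E] [Algebra Fq E]
    (hE : Algebra.trdeg Fq E = 1) {a : E} (ha : Transcendental Fq a) (t : E) :
    ∃ P : Polynomial (Polynomial Fq), P.IsPrimitive ∧
      P.eval₂ (Polynomial.aeval a : Polynomial Fq →ₐ[Fq] E).toRingHom t = 0 := by
  classical
  let f : Polynomial Fq →ₐ[Fq] E := Polynomial.aeval a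
  have hf : Function.Injective f := transcendental_iff_injective.1 ha
  let _ : Algebra (Polynomial Fq) E := f.toRingHom.toAlgebra
  have _ : IsScalarTower Fq (Polynomial Fq) E := IsScalarTower.of_algHom f
  have _ : FaithfulSMul (Polynomial Fq) E := (faithfulSMul_iff_algebraMap_injective _ _).2 hf
  have h1 := _root_.lift_trdeg_add_eq (R := Fq) (S := Polynomial Fq) (A := E)
  rw [hE, Polynomial.trdeg_of_isDomain, Cardinal.lift_one, Cardinal.lift_one] at h1
  have h0 : Algebra.trdeg (Polynomial Fq) E = 0 := by
    have h2 : Cardinal.lift.{u} (Algebra.trdeg (Polynomial Fq) E) = 0 := by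
      refine Cardinal.eq_of_add_eq_add_left (h1.trans (add_zero _).symm) Cardinal.one_lt_aleph0
    exact Cardinal.lift_eq_zero.1 h2
  have halg := trdeg_eq_zero_iff.1 h0
  obtain ⟨P, hP0, hP⟩ := halg.isAlgebraic t
  refine ⟨P.primPart, P.isPrimitive_primPart, ?_⟩
  rw [P.eq_C_content_mul_primPart, map_mul, aeval_C, mul_eq_zero] at hP
  refine hP.resolve_left fun h => hP0 ?_
  rw [← Polynomial.content_eq_zero_iff]
  exact hf (h.trans (map_zero f).symm)

/-! ### Invariants of `φ_t` and the modular transcendence degree -/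

theorem mem_algebraicClosure_of_sub_pow_mem {k Ω : Type*} [Field k] [Field Ω] [Algebra k Ω]
    {z : Ω} {N : ℕ} (hN : 1 < N) (h : z - z ^ N ∈ algebraicClosure k Ω) :
    z ∈ algebraicClosure k Ω := by
  rw [mem_algebraicClosure_iff]
  have : IsAlgebraic (algebraicClosure k Ω) z := by
    let β : algebraicClosure k Ω := ⟨_, h⟩
    refine ⟨Polynomial.X ^ N - Polynomial.X + Polynomial.C β, ?_, ?_⟩
    · intro h0
      have h1 := congrArg (fun P => P.coeff N) h0
      have hN1 : N ≠ 1 := by omega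
      have hN0 : N ≠ 0 := by omega
      simp [Polynomial.coeff_X, Polynomial.coeff_C, hN1.symm, hN0] at h1
    · have : algebraMap (algebraicClosure k Ω) Ω β = z - z ^ N := rfl
      simp [this]
  exact IsAlgebraic.restrictScalars k this

/-- If all these quotients were algebraic over `𝔽_p`, so would be the coefficients of the monic
conjugate of `φ_t`. As every `φ_c` commutes with `φ_t`, the coefficients of its conjugate would then
be algebraic too, and the modular transcendence degree would be zero. -/
theorem exists_invariant_transcendental (p : ℕ) [Fact p.Prime] [Algebra (ZMod p) K]
    (hφ : 0 < φ.modularTrdeg p) {t : A} (ht : 0 < φ.rk t) :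
    ∃ i, (φ.toRingHom t).coeff i ≠ 0 ∧
      (φ.toRingHom t).coeff i ^ (Fintype.card Fq ^ φ.rk t - 1) /
        (φ.toRingHom t).coeff (φ.rk t) ^ (Fintype.card Fq ^ i - 1) ∉
          algebraicClosure (ZMod p) K := by
  by_contra! hall
  set r := φ.rk t with hr
  set qq := Fintype.card Fq with hqq
  have hq1 : 1 < qq := Fintype.one_lt_card
  have hN : 1 < qq ^ r := Nat.one_lt_pow ht.ne' hq1
  set a : ℕ → K := (φ.toRingHom t).coeff with ha
  have hlead : a r ≠ 0 := coeff_tauDegree_ne_zero (φ.toRingHom_ne_zero_of_rk_pos ht)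
  set ι := algebraMap K (AlgebraicClosure K) with hι
  have hlead' : ι (a r) ≠ 0 := by rwa [Ne, map_eq_zero]
  -- The coefficient of `τ ^ r` in the conjugate is `a_r γ ^ (q ^ r - 1)`, so this `γ` makes it
  -- monic.
  obtain ⟨γ, hγ⟩ := IsAlgClosed.exists_pow_nat_eq (ι (a r))⁻¹ (n := qq ^ r - 1) (by omega)
  have hγ0 : γ ≠ 0 := by
    rintro rfl
    rw [zero_pow (by omega)] at hγ
    exact inv_ne_zero hlead' hγ.symm
  let B := algebraicClosure (ZMod p) (AlgebraicClosure K)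
  let conj : A → ℕ → AlgebraicClosure K := fun c i =>
    γ⁻¹ * ι ((φ.toRingHom c).coeff i) * γ ^ (qq ^ i)
  have hpow : ∀ i : ℕ, γ ^ (qq ^ i) = γ * γ ^ (qq ^ i - 1) := fun i => by
    rw [← pow_succ']
    congr 1
    have : 0 < qq ^ i := by positivity
    omega
  have hconj : ∀ c i, conj c i = ι ((φ.toRingHom c).coeff i) * γ ^ (qq ^ i - 1) := fun c i => by
    simp only [conj]
    rw [hpow]
    field_simp
  have htop : conj t r = 1 := by
    rw [hconj, hγ]
    exact mul_inv_cancel₀ hlead'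
  have hB : ∀ i, conj t i ∈ B := fun i => by
    by_cases hi : a i = 0
    · rw [hconj, show (φ.toRingHom t).coeff i = 0 from hi, map_zero, zero_mul]
      exact B.zero_mem
    have h1 := hall i hi
    rw [mem_algebraicClosure_iff] at h1
    have h2 := h1.algebraMap (A := AlgebraicClosure K)
    have h3 : conj t i ^ (qq ^ r - 1) =
        ι (a i ^ (qq ^ r - 1) / a r ^ (qq ^ i - 1)) := by
      rw [hconj, mul_pow, ← pow_mul, mul_comm (qq ^ i - 1), pow_mul, hγ, map_div₀, map_pow, map_pow,
        inv_pow, div_eq_mul_inv]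
    rw [← h3] at h2
    rw [mem_algebraicClosure_iff]
    exact (isAlgebraic_iff_isIntegral.1 h2).of_pow (by omega) |>.isAlgebraic
  have hmul : ∀ c d l, γ⁻¹ * ι ((φ.toRingHom (c * d)).coeff l) * γ ^ (qq ^ l) =
      ∑ ij ∈ Finset.HasAntidiagonal.antidiagonal l, conj c ij.1 * conj d ij.2 ^ (qq ^ ij.1) := by
    intro c d l
    rw [map_mul, TwistedPolynomial.coeff_mul, map_sum, Finset.mul_sum, Finset.sum_mul]
    refine Finset.sum_congr rfl ?_
    rintro ⟨i, j⟩ hij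
    rw [Finset.HasAntidiagonal.mem_antidiagonal] at hij
    simp only at hij ⊢
    have hg : γ ^ (qq ^ i) * (γ⁻¹) ^ (qq ^ i) = 1 := by
      rw [← mul_pow, mul_inv_cancel₀ hγ0, one_pow]
    have hg' : γ ^ (qq ^ l) = (γ ^ (qq ^ j)) ^ (qq ^ i) := by
      rw [← pow_mul, ← pow_add, ← hij, add_comm]
    simp only [conj, map_mul, map_pow, mul_pow, hg']
    linear_combination -(γ⁻¹ * ι ((φ.toRingHom c).coeff i) * ι ((φ.toRingHom d).coeff j) ^ (qq ^ i) *
      (γ ^ (qq ^ j)) ^ (qq ^ i)) * hg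
  -- Descending induction on the index `i`, in the form of an ascending induction on a bound for its
  -- distance from the degree of `φ_c`.
  have hall' : ∀ c m i, (φ.toRingHom c).tauDegree < i + m → conj c i ∈ B := by
    intro c m
    induction m with
    | zero =>
      intro i hi
      rw [hconj, coeff_eq_zero_of_lt (by simpa using hi), map_zero, zero_mul]
      exact B.zero_mem
    | succ m ih =>
      intro i hi
      refine mem_algebraicClosure_of_sub_pow_mem hN ?_
      -- Compare the coefficients of `τ ^ (i + r)` in `φ_c φ_t = φ_t φ_c`. As the conjugate of `φ_t`
      -- is monic, the unknown coefficient `z` of index `i` enters as `z` on one side and as `z ^ (q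
      -- ^ r)` on the other. All other nonzero terms involve coefficients of `φ_c` of index greater
      -- than `i`.
      have h1 := hmul c t (i + r)
      rw [mul_comm c t, hmul t c (i + r)] at h1
      have m1 : (i, r) ∈ Finset.HasAntidiagonal.antidiagonal (i + r) := by simp
      have m2 : (r, i) ∈ Finset.HasAntidiagonal.antidiagonal (i + r) := by simp [add_comm]
      rw [eq_comm, ← Finset.add_sum_erase _ _ m1, ← Finset.add_sum_erase _ _ m2] at h1
      simp only [htop, one_pow, mul_one, one_mul] at h1
      rw [sub_eq_sub_iff_add_eq_add.2 (h1.trans (add_comm _ _))]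
      refine B.sub_mem (B.sum_mem ?_) (B.sum_mem ?_)
      · rintro ⟨k, l⟩ hkl
        rw [Finset.mem_erase, Finset.HasAntidiagonal.mem_antidiagonal] at hkl
        simp only [Ne, Prod.mk.injEq] at hkl ⊢
        rcases lt_or_ge r k with h | h
        · rw [hconj t k, coeff_eq_zero_of_lt h, map_zero, zero_mul, zero_mul]
          exact B.zero_mem
        · exact B.mul_mem (hB k) (pow_mem (ih l (by omega)) _)
      · rintro ⟨k, l⟩ hkl
        rw [Finset.mem_erase, Finset.HasAntidiagonal.mem_antidiagonal] at hkl
        simp only [Ne, Prod.mk.injEq] at hkl ⊢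
        rcases lt_or_ge r l with h | h
        · rw [hconj t l, coeff_eq_zero_of_lt h, map_zero, zero_mul, zero_pow (by positivity),
            mul_zero]
          exact B.zero_mem
        · exact B.mul_mem (ih k (by omega)) (pow_mem (hB l) _)
  have hle : φ.fieldOfDefinitionConj p γ ≤ B := by
    refine IntermediateField.adjoin_le_iff.2 ?_
    rintro _ ⟨c, i, rfl⟩
    exact hall' c ((φ.toRingHom c).tauDegree + 1) i (by omega)
  have halg : Algebra.IsAlgebraic (ZMod p) (φ.fieldOfDefinitionConj p γ) := ⟨fun z =>
    (isAlgebraic_algebraMap_iff (algebraMap (φ.fieldOfDefinitionConj p γ)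
      (AlgebraicClosure K)).injective).1 (mem_algebraicClosure_iff.1 (hle z.2))⟩
  have h0 := trdeg_eq_zero (R := ZMod p) (A := φ.fieldOfDefinitionConj p γ)
  refine absurd hφ (not_lt.2 ?_)
  rw [← h0]
  exact ciInf_le' (fun γ : {γ : AlgebraicClosure K // γ ≠ 0} =>
    Algebra.trdeg (ZMod p) (φ.fieldOfDefinitionConj p γ.1)) ⟨γ, hγ0⟩

end DrinfeldModule

/-! ### Additive valuations and interpolation -/

section Ord

variable {L : Type*} [Field L] (w : Valuation L ℤᵐ⁰)

theorem ord_zero : ord w 0 = 0 := by simp [ord]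

theorem ord_one : ord w 1 = 0 := by simp [ord]

theorem ord_mul {x y : L} (hx : x ≠ 0) (hy : y ≠ 0) : ord w (x * y) = ord w x + ord w y := by
  rw [ord, map_mul, WithZero.log_mul (by simpa using hx) (by simpa using hy), ord, ord, neg_add]

theorem ord_pow (x : L) (n : ℕ) : ord w (x ^ n) = n * ord w x := by
  rw [ord, map_pow, WithZero.log_pow, ord, nsmul_eq_mul, mul_neg]

theorem ord_inv (x : L) : ord w x⁻¹ = -ord w x := by
  rw [ord, map_inv₀, WithZero.log_inv, ord]

theorem ord_div {x y : L} (hx : x ≠ 0) (hy : y ≠ 0) : ord w (x / y) = ord w x - ord w y := by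
  rw [div_eq_mul_inv, ord_mul w hx (inv_ne_zero hy), ord_inv, sub_eq_add_neg]

theorem ord_neg (x : L) : ord w (-x) = ord w x := by rw [ord, Valuation.map_neg, ord]

theorem ord_le_ord_iff {x y : L} (hx : x ≠ 0) (hy : y ≠ 0) :
    ord w x ≤ ord w y ↔ w y ≤ w x := by
  rw [ord, ord, neg_le_neg_iff, WithZero.log_le_log (by simpa using hy) (by simpa using hx)]

theorem ord_lt_ord_iff {x y : L} (hx : x ≠ 0) (hy : y ≠ 0) :
    ord w x < ord w y ↔ w y < w x := by
  rw [ord, ord, neg_lt_neg_iff, WithZero.log_lt_log (by simpa using hy) (by simpa using hx)]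

theorem ord_nonneg_iff {x : L} : 0 ≤ ord w x ↔ w x ≤ 1 := by
  by_cases hx : x = 0
  · simp [hx, ord_zero]
  · rw [← ord_one w, ord_le_ord_iff w one_ne_zero hx, map_one]

theorem ord_pos_iff {x : L} (hx : x ≠ 0) : 0 < ord w x ↔ w x < 1 := by
  rw [← ord_one w, ord_lt_ord_iff w one_ne_zero hx, map_one]

theorem ord_eq_zero_iff {x : L} (hx : x ≠ 0) : ord w x = 0 ↔ w x = 1 := by
  rw [ord, neg_eq_zero, ← WithZero.log_one, ← WithZero.exp_inj,
    WithZero.exp_log (by simpa using hx), WithZero.exp_log one_ne_zero]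

/-- `w y ≥ ρ` for the additive valuation, with `w 0 = ∞`. -/
def OrdGE (ρ : ℝ) (y : L) : Prop := y = 0 ∨ ρ ≤ ord w y

variable {w}

namespace OrdGE

theorem of_ne {ρ : ℝ} {y : L} (h : OrdGE w ρ y) (hy : y ≠ 0) : ρ ≤ ord w y := h.resolve_left hy

protected theorem zero (ρ : ℝ) : OrdGE w ρ 0 := Or.inl rfl

protected theorem one : OrdGE w 0 1 := Or.inr (by simp [ord_one])

theorem mono {ρ σ : ℝ} {y : L} (h : OrdGE w ρ y) (hs : σ ≤ ρ) : OrdGE w σ y :=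
  h.imp id hs.trans

theorem neg {ρ : ℝ} {y : L} (h : OrdGE w ρ y) : OrdGE w ρ (-y) :=
  h.imp (fun h => by rw [h, neg_zero]) fun h => by rwa [ord_neg]

theorem add {ρ : ℝ} {x y : L} (hx : OrdGE w ρ x) (hy : OrdGE w ρ y) : OrdGE w ρ (x + y) := by
  by_cases hx0 : x = 0
  · rwa [hx0, zero_add]
  by_cases hy0 : y = 0
  · rwa [hy0, add_zero]
  by_cases hxy : x + y = 0
  · exact Or.inl hxy
  refine Or.inr ?_
  rcases le_total (w x) (w y) with h | h
  · refine (hy.of_ne hy0).trans (Int.cast_le.2 ((ord_le_ord_iff w hy0 hxy).2 ?_))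
    exact (w.map_add x y).trans (max_le h le_rfl)
  · refine (hx.of_ne hx0).trans (Int.cast_le.2 ((ord_le_ord_iff w hx0 hxy).2 ?_))
    exact (w.map_add x y).trans (max_le le_rfl h)

theorem sub {ρ : ℝ} {x y : L} (hx : OrdGE w ρ x) (hy : OrdGE w ρ y) : OrdGE w ρ (x - y) :=
  sub_eq_add_neg x y ▸ hx.add hy.neg

theorem sum {ρ : ℝ} {ι : Type*} {s : Finset ι} {f : ι → L} (h : ∀ i ∈ s, OrdGE w ρ (f i)) :
    OrdGE w ρ (∑ i ∈ s, f i) :=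
  Finset.sum_induction f (OrdGE w ρ) (fun _ _ => add) (OrdGE.zero ρ) h

theorem mul {ρ σ : ℝ} {x y : L} (hx : OrdGE w ρ x) (hy : OrdGE w σ y) :
    OrdGE w (ρ + σ) (x * y) := by
  by_cases hx0 : x = 0
  · exact Or.inl (by rw [hx0, zero_mul])
  by_cases hy0 : y = 0
  · exact Or.inl (by rw [hy0, mul_zero])
  refine Or.inr ?_
  rw [ord_mul w hx0 hy0, Int.cast_add]
  exact add_le_add (hx.of_ne hx0) (hy.of_ne hy0)

end OrdGE

/-- The valuation of a sum with a dominant term. -/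
theorem ord_sum_eq_of_dominant {ι : Type*} {s : Finset ι} {f : ι → L} {i : ι} (hi : i ∈ s)
    (h0 : f i ≠ 0) (h : ∀ j ∈ s, j ≠ i → f j ≠ 0 → ord w (f i) < ord w (f j)) :
    ∑ j ∈ s, f j ≠ 0 ∧ ord w (∑ j ∈ s, f j) = ord w (f i) := by
  classical
  have hlt : w (∑ j ∈ s.erase i, f j) < w (f i) := by
    refine w.map_sum_lt (by simpa using h0) fun j hj => ?_
    rw [Finset.mem_erase] at hj
    by_cases hj0 : f j = 0
    · rw [hj0, map_zero]
      exact zero_lt_iff.2 (by simpa using h0)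
    · exact (ord_lt_ord_iff w h0 hj0).1 (h j hj.2 hj.1 hj0)
  have heq : w (∑ j ∈ s, f j) = w (f i) := by
    rw [← Finset.add_sum_erase s f hi, w.map_add_eq_of_lt_left hlt]
  refine ⟨fun hz => ?_, by rw [ord, heq, ord]⟩
  rw [hz, map_zero] at heq
  exact h0 ((map_eq_zero w).1 heq.symm)

open Polynomial in
-- In the expansion of the product, every factor contributes its constant `c i`, of value at least
-- `-ρ`, and a term of degree `k` uses `card - k` of the roots, each of value at least `ε`.
theorem ordGE_coeff_prod {ι : Type*} (s : Finset ι) {c y : ι → L} {ε ρ : ℝ}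
    (hc : ∀ i ∈ s, OrdGE w (-ρ) (c i)) (hy : ∀ i ∈ s, OrdGE w ε (y i)) (k : ℕ) :
    OrdGE w ((s.card - k) * ε - s.card * ρ) ((∏ i ∈ s, (C (c i) * (X - C (y i)))).coeff k) := by
  classical
  induction s using Finset.induction_on generalizing k with
  | empty =>
    rw [Finset.prod_empty, coeff_one]
    split_ifs with h
    · subst h
      simpa using OrdGE.one
    · exact OrdGE.zero _
  | insert a s ha ih =>
    have ih' := ih (fun i hi => hc i (by simp [hi])) (fun i hi => hy i (by simp [hi]))
    set P := ∏ i ∈ s, (C (c i) * (X - C (y i)))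
    have hca := hc a (by simp)
    have hya := hy a (by simp)
    rw [Finset.prod_insert ha, mul_assoc, coeff_C_mul, sub_mul X, coeff_sub, coeff_C_mul,
      Finset.card_insert_of_notMem ha, mul_sub (c a), Nat.cast_add, Nat.cast_one]
    have h2 := hca.mul (hya.mul (ih' k))
    refine OrdGE.sub ?_ (h2.mono (le_of_eq (by ring)))
    rcases Nat.eq_zero_or_pos k with rfl | hk
    · rw [mul_coeff_zero, coeff_X_zero, zero_mul, mul_zero]
      exact OrdGE.zero _
    · obtain ⟨k, rfl⟩ := Nat.exists_eq_succ_of_ne_zero hk.ne'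
      rw [Nat.succ_eq_add_one, coeff_X_mul]
      refine (hca.mul (ih' k)).mono (le_of_eq ?_)
      push_cast
      ring

open Polynomial in
/-- Lower bounds for the values of a polynomial at points that are not close to each other give
lower bounds for its coefficients. -/
theorem ordGE_coeff_of_separated {ι : Type*} {s : Finset ι} {y : ι → L} {f : L[X]} {N : ℕ}
    (hs : s.card = N + 1) (hf : f.natDegree ≤ N) {c ε ρ : ℝ} (hinj : Set.InjOn y s)
    (hρ : ∀ i ∈ s, ∀ j ∈ s, i ≠ j → ord w (y i - y j) ≤ ρ) (hc : ∀ i ∈ s, OrdGE w c (f.eval (y i)))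
    (hε : ∀ i ∈ s, OrdGE w ε (y i)) (k : ℕ) :
    OrdGE w (c + (N - k) * ε - N * ρ) (f.coeff k) := by
  classical
  have hdeg : f.degree < s.card := by
    rw [hs]
    exact (Polynomial.degree_le_of_natDegree_le hf).trans_lt (by exact_mod_cast Nat.lt_succ_self N)
  -- Each Lagrange basis polynomial is a product of `N` factors `(y i - y j)⁻¹ (X - y j)`, whose
  -- constants have value at least `-ρ` by separation.
  have := Lagrange.eq_interpolate hinj hdeg
  rw [this, Lagrange.interpolate_apply, finsetSum_coeff]
  refine OrdGE.sum fun i hi => ?_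
  rw [coeff_C_mul]
  have h2 := ordGE_coeff_prod (w := w) (s.erase i) (c := fun j => (y i - y j)⁻¹) (y := y)
    (ε := ε) (ρ := ρ) (fun j hj => by
      rw [Finset.mem_erase] at hj
      refine Or.inr ?_
      rw [ord_inv, Int.cast_neg]
      exact neg_le_neg (hρ i hi j hj.2 (Ne.symm hj.1)))
    (fun j hj => hε j (Finset.mem_of_mem_erase hj)) k
  rw [Finset.card_erase_of_mem hi, hs, Nat.add_sub_cancel] at h2
  exact ((hc i hi).mul h2).mono (le_of_eq (by ring))

end Ord

open TwistedPolynomial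

/-! ### Growth under `φ_t` and the local height functions -/

section Growth

variable {Fq : Type*} [Field Fq] [Fintype Fq] {K : Type*} [Field K] [Algebra Fq K]
  {L : Type*} [Field L] [Algebra K L] (w : Valuation L ℤᵐ⁰)

/-- `min(0, w(x))` as a real number. -/
def ordMinZero (x : L) : ℝ := ((min 0 (ord w x) : ℤ) : ℝ)

theorem ordMinZero_nonpos (x : L) : ordMinZero w x ≤ 0 := by
  rw [ordMinZero, Int.cast_nonpos]
  exact min_le_left _ _

theorem ordMinZero_le (x : L) : ordMinZero w x ≤ ord w x := by
  rw [ordMinZero, Int.cast_le]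
  exact min_le_right _ _

theorem le_ordMinZero {x : L} {ρ : ℝ} (h0 : ρ ≤ 0) (h : OrdGE w ρ x) : ρ ≤ ordMinZero w x := by
  rw [ordMinZero, Int.cast_min, Int.cast_zero]
  refine le_min h0 ?_
  rcases h with rfl | h
  · simpa [ord_zero] using h0
  · exact h

theorem ordMinZero_eq (x : L) : ordMinZero w x = min 0 (ord w x : ℝ) := by
  rw [ordMinZero, Int.cast_min, Int.cast_zero]

theorem ord_monomial_term {f : TwistedPolynomial Fq K} {i : ℕ} (hi : i ∈ f.support) {z : L}
    (hz : z ≠ 0) : (ord w (algebraMap K L (f.coeff i) * z ^ (Fintype.card Fq ^ i)) : ℝ) =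
      ord w (algebraMap K L (f.coeff i)) + (Fintype.card Fq : ℝ) ^ i * ord w z := by
  rw [ord_mul w ((map_ne_zero _).2 (mem_support.1 hi)) (pow_ne_zero _ hz), ord_pow]
  push_cast
  rfl

theorem tauDegree_mem_support {f : TwistedPolynomial Fq K} (hf : f ≠ 0) :
    f.tauDegree ∈ f.support :=
  mem_support.2 (coeff_tauDegree_ne_zero hf)

theorem le_tauDegree {f : TwistedPolynomial Fq K} {i : ℕ} (hi : i ∈ f.support) :
    i ≤ f.tauDegree :=
  Finset.le_sup (f := id) hi

theorem card_pow_sub_ge {r i : ℕ} (h : i < r) :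
    (1 : ℝ) ≤ (Fintype.card Fq : ℝ) ^ r - (Fintype.card Fq : ℝ) ^ i := by
  have h1 : Fintype.card Fq ^ i + 1 ≤ Fintype.card Fq ^ r :=
    Nat.pow_lt_pow_right Fintype.one_lt_card h
  have h2 : ((Fintype.card Fq : ℝ) ^ i + 1) ≤ (Fintype.card Fq : ℝ) ^ r := by exact_mod_cast h1
  linarith

/-- With `R` a bound for the values of all coefficients, the lower estimate holds term by term. For
the upper one, the leading term dominates when `w(z) < -2 R`; otherwise `min(0, w(z))` is bounded
below and `min(0, ·) ≤ 0` suffices. -/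
theorem exists_abs_ordMinZero_eval_sub_le {f : TwistedPolynomial Fq K} (hf : f ≠ 0) :
    ∃ C : ℝ, 0 ≤ C ∧ ∀ z : L,
      |ordMinZero w (f.eval z) - f.degree * ordMinZero w z| ≤ C := by
  set a : ℕ → ℝ := fun i => ord w (algebraMap K L (f.coeff i)) with ha
  set R : ℝ := ∑ i ∈ f.support, |a i| with hR
  have hR0 : 0 ≤ R := Finset.sum_nonneg fun _ _ => abs_nonneg _
  have haR : ∀ i ∈ f.support, |a i| ≤ R := fun i hi =>
    Finset.single_le_sum (f := fun i => |a i|) (fun _ _ => abs_nonneg _) hi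
  set N : ℝ := (f.degree : ℝ) with hN
  have hNq : N = (Fintype.card Fq : ℝ) ^ f.tauDegree := by rw [hN, degree]; push_cast; rfl
  have hq : (1 : ℝ) ≤ Fintype.card Fq := by exact_mod_cast Fintype.card_pos
  have hN0 : 0 ≤ N := by positivity
  refine ⟨R + 2 * R * N, by positivity, fun z => ?_⟩
  by_cases hz : z = 0
  · subst hz
    rw [eval_zero, ordMinZero, ord_zero]
    simp only [min_self, Int.cast_zero, mul_zero, sub_zero, abs_zero]
    positivity
  have hz0 := ordMinZero_nonpos w z
  have hzo := ordMinZero_le w z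
  have hlow : -R + N * ordMinZero w z ≤ ordMinZero w (f.eval z) := by
    refine le_ordMinZero w (by nlinarith) (OrdGE.sum fun i hi => Or.inr ?_)
    rw [ord_monomial_term w hi hz]
    have h1 := (abs_le.1 (haR i hi)).1
    have h2 : (Fintype.card Fq : ℝ) ^ i ≤ N :=
      hNq ▸ pow_le_pow_right₀ hq (le_tauDegree hi)
    have h3 : (0 : ℝ) ≤ (Fintype.card Fq : ℝ) ^ i := by positivity
    have h4 : N * ordMinZero w z ≤ (Fintype.card Fq : ℝ) ^ i * ord w z := by nlinarith
    exact add_le_add h1 h4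
  have hup : ordMinZero w (f.eval z) ≤ N * ordMinZero w z + (R + 2 * R * N) := by
    rcases lt_or_ge (ord w z : ℝ) (-(2 * R)) with h | h
    · have hdom := ord_sum_eq_of_dominant (w := w) (s := f.support)
        (f := fun i => algebraMap K L (f.coeff i) * z ^ (Fintype.card Fq ^ i))
        (tauDegree_mem_support hf)
        (mul_ne_zero ((map_ne_zero _).2 (coeff_tauDegree_ne_zero hf)) (pow_ne_zero _ hz))
        (fun j hj hjne _ => by
          rw [← Int.cast_lt (R := ℝ), ord_monomial_term w (tauDegree_mem_support hf) hz,
            ord_monomial_term w hj hz]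
          have h1 := (abs_le.1 (haR j hj)).1
          have h2 := (abs_le.1 (haR _ (tauDegree_mem_support hf))).2
          have h3 := card_pow_sub_ge (Fq := Fq) (lt_of_le_of_ne (le_tauDegree hj) hjne)
          simp only [ha] at h1 h2
          nlinarith)
      have h1 := ordMinZero_le w (f.eval z)
      have h2 : (ord w (f.eval z) : ℝ) = a f.tauDegree + N * ord w z := by
        rw [hNq, ← ord_monomial_term w (tauDegree_mem_support hf) hz]
        exact congrArg _ hdom.2
      have h3 := (abs_le.1 (haR _ (tauDegree_mem_support hf))).2
      have h4 : ordMinZero w z = ord w z := by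
        rw [ordMinZero_eq, min_eq_right]
        linarith
      rw [h4]
      nlinarith [mul_nonneg hR0 hN0]
    · have h1 := ordMinZero_nonpos w (f.eval z)
      have h2 : -(2 * R) ≤ ordMinZero w z := le_ordMinZero w (by linarith) (Or.inr h)
      nlinarith
  rw [abs_le]
  constructor <;> nlinarith [mul_nonneg hR0 hN0]

end Growth

namespace DrinfeldModule

variable {Fq : Type*} [Field Fq] [Fintype Fq] {A : Type*} [CommRing A] [Algebra Fq A]
  {K : Type*} [Field K] [Algebra Fq K] (φ : DrinfeldModule Fq A K)
  {L : Type*} [Field L] [Algebra K L] (w : Valuation L ℤᵐ⁰) {t : A}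

theorem two_le_degree (ht : 0 < φ.rk t) : (2 : ℝ) ≤ (φ.toRingHom t).degree := by
  have : 1 < (φ.toRingHom t).degree := Nat.one_lt_pow ht.ne' Fintype.one_lt_card
  exact_mod_cast this

theorem degree_pow_cast (ht : 0 < φ.rk t) (m : ℕ) :
    ((φ.toRingHom (t ^ m)).degree : ℝ) = ((φ.toRingHom t).degree : ℝ) ^ m := by
  rw [φ.degree_pow (φ.toRingHom_ne_zero_of_rk_pos ht)]
  push_cast
  rfl

theorem tendsto_degree_pow (ht : 0 < φ.rk t) :
    Tendsto (fun m : ℕ => ((φ.toRingHom (t ^ m)).degree : ℝ)) atTop atTop := by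
  simp only [φ.degree_pow_cast ht]
  exact tendsto_pow_atTop_atTop_of_one_lt (by linarith [φ.two_le_degree ht])

/-- Tate's telescoping argument: consecutive quotients differ by at most `C / N ^ (m + 1) ≤ C / 2 ^
(m + 1)`. The geometric series gives convergence, and its sum bounds the distance from the first
term to the limit. -/
theorem exists_tendsto (ht : 0 < φ.rk t) : ∃ C : ℝ, ∀ x : L,
    ∃ V : ℝ, Tendsto (fun m : ℕ => ordMinZero w (φ.act (t ^ m) x) / (φ.toRingHom (t ^ m)).degree)
      atTop (𝓝 V) ∧ |V - ordMinZero w x| ≤ C := by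
  obtain ⟨C, hC0, hC⟩ := exists_abs_ordMinZero_eval_sub_le w (L := L)
    (φ.toRingHom_ne_zero_of_rk_pos ht)
  have hN := φ.two_le_degree ht
  set N : ℝ := ((φ.toRingHom t).degree : ℝ)
  refine ⟨C, fun x => ?_⟩
  set c : ℕ → ℝ := fun m => ordMinZero w (φ.act (t ^ m) x) / (φ.toRingHom (t ^ m)).degree with hc
  have hstep : ∀ m, dist (c m) (c (m + 1)) ≤ C / 2 / 2 ^ m := by
    intro m
    have h1 := hC (φ.act (t ^ m) x)
    have h2 : (φ.toRingHom t).eval (φ.act (t ^ m) x) = φ.act (t ^ (m + 1)) x := by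
      rw [pow_succ', act_mul]
      rfl
    rw [h2] at h1
    have hNm : 0 < N ^ (m + 1) := by positivity
    have h3 : c m - c (m + 1) = -(ordMinZero w (φ.act (t ^ (m + 1)) x) -
        N * ordMinZero w (φ.act (t ^ m) x)) / N ^ (m + 1) := by
      simp only [hc, φ.degree_pow_cast ht]
      change _ / N ^ m - _ / N ^ (m + 1) = _
      field_simp
      ring
    rw [Real.dist_eq, h3, abs_div, abs_neg, abs_of_pos hNm, div_div, ← pow_succ']
    exact div_le_div₀ hC0 h1 (by positivity) (pow_le_pow_left₀ (by norm_num) hN _)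
  obtain ⟨V, hV⟩ := cauchySeq_tendsto_of_complete (cauchySeq_of_le_geometric_two hstep)
  refine ⟨V, hV, ?_⟩
  have := dist_le_of_le_geometric_two_of_tendsto₀ hstep hV
  have h0 : c 0 = ordMinZero w x := by
    simp only [hc, φ.degree_pow_cast ht, pow_zero, div_one, act_one]
  rwa [h0, dist_comm, Real.dist_eq] at this

theorem tendsto_localV (ht : 0 < φ.rk t) (x : L) :
    Tendsto (fun m : ℕ => ordMinZero w (φ.act (t ^ m) x) / (φ.toRingHom (t ^ m)).degree)
      atTop (𝓝 (φ.localV t w x)) := by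
  obtain ⟨C, hC⟩ := φ.exists_tendsto w ht
  exact tendsto_nhds_limUnder ((hC x).imp fun V hV => hV.1)

theorem exists_abs_localV_sub_le (ht : 0 < φ.rk t) : ∃ C : ℝ, ∀ x : L,
    |φ.localV t w x - ordMinZero w x| ≤ C := by
  obtain ⟨C, hC⟩ := φ.exists_tendsto w ht
  refine ⟨C, fun x => ?_⟩
  obtain ⟨V, hV, h⟩ := hC x
  rwa [tendsto_nhds_unique (φ.tendsto_localV w ht x) hV]

theorem localV_nonpos (ht : 0 < φ.rk t) (x : L) : φ.localV t w x ≤ 0 :=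
  le_of_tendsto' (φ.tendsto_localV w ht x) fun _ =>
    div_nonpos_of_nonpos_of_nonneg (ordMinZero_nonpos w _) (Nat.cast_nonneg _)

/-- `φ_b` commutes with `φ_{t^m}` and multiplies `min(0, w)` by its degree up to a bounded error,
which disappears after division by the degree of `φ_{t^m}`. -/
theorem localV_act (ht : 0 < φ.rk t) {b : A} (hb : φ.toRingHom b ≠ 0) (x : L) :
    φ.localV t w (φ.act b x) = (φ.toRingHom b).degree * φ.localV t w x := by
  obtain ⟨C, hC0, hC⟩ := exists_abs_ordMinZero_eval_sub_le w (L := L) hb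
  have h1 := φ.tendsto_localV w ht (φ.act b x)
  have h2 := (φ.tendsto_localV w ht x).const_mul ((φ.toRingHom b).degree : ℝ)
  refine tendsto_nhds_unique h1 ?_
  have h3 : Tendsto (fun m : ℕ => C / (φ.toRingHom (t ^ m)).degree) atTop (𝓝 0) :=
    tendsto_const_nhds.div_atTop (φ.tendsto_degree_pow ht)
  have h4 := squeeze_zero_norm (a := fun m : ℕ => C / (φ.toRingHom (t ^ m)).degree)
    (f := fun m : ℕ => ordMinZero w (φ.act (t ^ m) (φ.act b x)) / (φ.toRingHom (t ^ m)).degree -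
      (φ.toRingHom b).degree *
        (ordMinZero w (φ.act (t ^ m) x) / (φ.toRingHom (t ^ m)).degree)) (fun m => by
      rw [act_comm, mul_div_assoc', ← sub_div, Real.norm_eq_abs, abs_div, Nat.abs_cast]
      exact div_le_div_of_nonneg_right (hC _) (Nat.cast_nonneg _)) h3
  have h5 := h4.add h2
  rw [zero_add] at h5
  refine h5.congr fun m => by ring

/-- The local functions `V_w` do not depend on the element of `A` that defines them. -/
theorem localV_eq_localV {a : A} (ha : 0 < φ.rk a) (ht : 0 < φ.rk t) (x : L) :
    φ.localV a w x = φ.localV t w x := by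
  obtain ⟨C, hC⟩ := φ.exists_abs_localV_sub_le w ht
  -- The function defined by `t` differs from `min(0, w)` by a bounded amount and is multiplied by
  -- its degree under `φ_{a^m}`. Division by this degree identifies it with the limit along the
  -- powers of `a`.
  refine tendsto_nhds_unique (φ.tendsto_localV w ha x) ?_
  have h3 : Tendsto (fun m : ℕ => C / (φ.toRingHom (a ^ m)).degree) atTop (𝓝 0) :=
    tendsto_const_nhds.div_atTop (φ.tendsto_degree_pow ha)
  have h4 := squeeze_zero_norm (a := fun m : ℕ => C / (φ.toRingHom (a ^ m)).degree)
    (f := fun m : ℕ => ordMinZero w (φ.act (a ^ m) x) / (φ.toRingHom (a ^ m)).degree -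
      φ.localV t w x) (fun m => by
      have hne := φ.toRingHom_pow_ne_zero (φ.toRingHom_ne_zero_of_rk_pos ha) m
      have hpos : (0 : ℝ) < (φ.toRingHom (a ^ m)).degree := by
        rw [φ.degree_pow_cast ha]
        have := φ.two_le_degree ha
        positivity
      have h1 := hC (φ.act (a ^ m) x)
      rw [φ.localV_act w ht hne, abs_sub_comm] at h1
      rw [Real.norm_eq_abs, show ordMinZero w (φ.act (a ^ m) x) / (φ.toRingHom (a ^ m)).degree -
        φ.localV t w x = (ordMinZero w (φ.act (a ^ m) x) - (φ.toRingHom (a ^ m)).degree *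
          φ.localV t w x) / (φ.toRingHom (a ^ m)).degree by field_simp, abs_div, Nat.abs_cast]
      exact div_le_div_of_nonneg_right h1 hpos.le) h3
  have h5 := h4.add_const (φ.localV t w x)
  rw [zero_add] at h5
  exact h5.congr fun m => by ring

end DrinfeldModule

open TwistedPolynomial

/-! ### Pigeonhole for ultrametric discs -/

section Pigeonhole

variable {L : Type*} [Field L] (w : Valuation L ℤᵐ⁰)

/-- By the ultrametric inequality, closeness is an equivalence relation. The hypothesis leaves at
most `n` classes on `I`, so one of them has more than `k` elements. -/
theorem exists_subset_ordGE {I : Finset ℕ} {z : ℕ → L} {ρ : ℝ} {n k : ℕ}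
    (h : ∀ J ⊆ I, J.card = n + 1 → ∃ i ∈ J, ∃ j ∈ J, i ≠ j ∧ OrdGE w ρ (z i - z j))
    (hcard : n * k < I.card) :
    ∃ J ⊆ I, k < J.card ∧ ∀ i ∈ J, ∀ j ∈ J, OrdGE w ρ (z i - z j) := by
  classical
  let S : Setoid ℕ :=
    { r := fun i j => OrdGE w ρ (z i - z j)
      iseqv := ⟨fun i => by rw [sub_self]; exact OrdGE.zero ρ,
        fun {i j} h => by rw [← neg_sub]; exact h.neg,
        fun {i j l} h h' => by rw [← sub_add_sub_cancel]; exact h.add h'⟩ }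
  let f : ℕ → Quotient S := Quotient.mk S
  have hf : ∀ i j, f i = f j → OrdGE w ρ (z i - z j) := fun i j hij => Quotient.exact hij
  have hn : (I.image f).card ≤ n := by
    by_contra! hlt
    obtain ⟨T, hT, hTc⟩ := Finset.exists_subset_card_eq (Nat.succ_le_of_lt hlt)
    obtain ⟨J, hJI, hJinj, hJT⟩ := Finset.exists_subset_injOn_image_eq_of_surjOn (f := f) I T
      (fun x hx => by
        obtain ⟨i, hi, rfl⟩ := Finset.mem_image.1 (hT hx)
        exact ⟨i, hi, rfl⟩)
    obtain ⟨i, hi, j, hj, hij, hr⟩ := h J (Finset.coe_subset.1 hJI) (by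
      rw [← Finset.card_image_of_injOn hJinj, hJT, hTc])
    exact hij (hJinj hi hj (Quotient.sound hr))
  obtain ⟨c, -, hc⟩ := Finset.exists_lt_card_fiber_of_mul_lt_card_of_maps_to
    (s := I) (t := I.image f) (f := f) (n := k) (fun i hi => Finset.mem_image_of_mem f hi)
    (lt_of_le_of_lt (Nat.mul_le_mul_right k hn) hcard)
  refine ⟨I.filter fun i => f i = c, Finset.filter_subset _ _, hc, fun i hi j hj => hf i j ?_⟩
  rw [(Finset.mem_filter.1 hi).2, (Finset.mem_filter.1 hj).2]

end Pigeonhole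

/-! ### Twisted polynomials as ordinary additive polynomials -/

section ToPolynomial

open Polynomial

variable {Fq : Type*} [Field Fq] [Fintype Fq] {K : Type*} [Field K] [Algebra Fq K]
  (L : Type*) [Field L] [Algebra K L]

/-- The additive polynomial `∑ aᵢ X ^ (q ^ i)`. -/
def TwistedPolynomial.toPolynomial (f : TwistedPolynomial Fq K) : L[X] :=
  ∑ i ∈ f.support, C (algebraMap K L (f.coeff i)) * X ^ (Fintype.card Fq ^ i)

theorem eval_toPolynomial (f : TwistedPolynomial Fq K) (x : L) :
    (f.toPolynomial L).eval x = TwistedPolynomial.eval f x := by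
  simp [TwistedPolynomial.toPolynomial, TwistedPolynomial.eval, eval_finsetSum]

theorem natDegree_toPolynomial_le (f : TwistedPolynomial Fq K) :
    (f.toPolynomial L).natDegree ≤ f.degree := by
  refine natDegree_sum_le_of_forall_le _ _ fun i hi => ?_
  exact (natDegree_C_mul_X_pow_le _ _).trans
    (Nat.pow_le_pow_right Fintype.card_pos (le_tauDegree hi))

theorem coeff_toPolynomial (f : TwistedPolynomial Fq K) (i : ℕ) :
    (f.toPolynomial L).coeff (Fintype.card Fq ^ i) = algebraMap K L (f.coeff i) := by
  classical
  rw [TwistedPolynomial.toPolynomial, finsetSum_coeff]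
  simp only [coeff_C_mul_X_pow]
  by_cases hi : i ∈ f.support
  · rw [Finset.sum_eq_single i]
    · simp
    · intro j _ hj
      rw [if_neg]
      exact fun h => hj (Nat.pow_right_injective Fintype.one_lt_card h).symm
    · exact fun h => absurd hi h
  · rw [Finset.sum_eq_zero]
    · rw [mem_support, not_not] at hi
      rw [hi, map_zero]
    · intro j hj
      rw [if_neg]
      intro h
      exact hi ((Nat.pow_right_injective Fintype.one_lt_card h) ▸ hj)

end ToPolynomial

/-! ### The monic conjugate at a place: shift and defect -/

namespace DrinfeldModule

variable {Fq : Type*} [Field Fq] [Fintype Fq] {A : Type*} [CommRing A] [Algebra Fq A]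
  {K : Type*} [Field K] [Algebra Fq K] (φ : DrinfeldModule Fq A K)
  {L : Type*} [Field L] [Algebra K L] (t : A) (w : Valuation L ℤᵐ⁰)

/-- The value of `γ⁻¹`, where `γ⁻¹ φ_t γ` is monic. -/
def shift : ℝ :=
  ord w (algebraMap K L ((φ.toRingHom t).coeff (φ.rk t))) / ((φ.toRingHom t).degree - 1)

/-- The value of the coefficient of `τ ^ i` in the monic conjugate `γ⁻¹ φ_t γ`. -/
def slope (i : ℕ) : ℝ :=
  ord w (algebraMap K L ((φ.toRingHom t).coeff i)) -
    φ.shift t w * ((Fintype.card Fq : ℝ) ^ i - 1)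

/-- The maximal pole order at `w` of the coefficients of the monic conjugate of `φ_t`. -/
def defect : ℝ :=
  ((φ.toRingHom t).support.sup fun i => Real.toNNReal (-φ.slope t w i) : NNReal)

theorem defect_nonneg : 0 ≤ φ.defect t w := NNReal.coe_nonneg _

variable {t}

theorem neg_slope_le_defect {i : ℕ} (hi : i ∈ (φ.toRingHom t).support) :
    -φ.slope t w i ≤ φ.defect t w :=
  (Real.le_coe_toNNReal _).trans (NNReal.coe_le_coe.2
    (Finset.le_sup (f := fun i => Real.toNNReal (-φ.slope t w i)) hi))

theorem exists_neg_slope_eq_defect (h : 0 < φ.defect t w) :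
    ∃ i ∈ (φ.toRingHom t).support, -φ.slope t w i = φ.defect t w := by
  have hne : (φ.toRingHom t).support.Nonempty := by
    by_contra hne
    rw [Finset.not_nonempty_iff_eq_empty] at hne
    rw [defect, hne] at h
    simp at h
  obtain ⟨i, hi, h'⟩ := Finset.exists_mem_eq_sup _ hne fun i => Real.toNNReal (-φ.slope t w i)
  refine ⟨i, hi, ?_⟩
  rw [defect, h'] at h ⊢
  rw [Real.coe_toNNReal']
  rw [Real.coe_toNNReal'] at h
  exact (max_eq_left (by
    by_contra hlt
    rw [max_eq_right (not_le.1 hlt).le] at h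
    exact lt_irrefl _ h)).symm

variable (ht : 0 < φ.rk t)
include ht

theorem degree_sub_one_pos : (0 : ℝ) < (φ.toRingHom t).degree - 1 := by
  linarith [φ.two_le_degree ht]

theorem ord_leadingCoeff :
    (ord w (algebraMap K L ((φ.toRingHom t).coeff (φ.rk t))) : ℝ) =
      φ.shift t w * ((φ.toRingHom t).degree - 1) := by
  rw [shift, div_mul_cancel₀ _ (φ.degree_sub_one_pos ht).ne']

theorem ord_leadingCoeff_pow (m : ℕ) :
    (ord w (algebraMap K L ((φ.toRingHom (t ^ m)).coeff (φ.rk (t ^ m)))) : ℝ) =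
      φ.shift t w * (((φ.toRingHom t).degree : ℝ) ^ m - 1) := by
  have hne := φ.toRingHom_ne_zero_of_rk_pos ht
  have h1 := congrArg (fun c => (ord w (algebraMap K L c) : ℝ)) (φ.leadingCoeff_pow hne m)
  have hd : 1 ≤ (φ.toRingHom t).degree := pow_pos Fintype.card_pos _
  simp only [map_pow, ord_pow] at h1
  rw [← map_pow φ.toRingHom] at h1
  push_cast [Nat.cast_sub hd, Nat.cast_sub (Nat.one_le_pow m _ hd)] at h1
  rw [φ.ord_leadingCoeff w ht] at h1
  have h2 := φ.degree_sub_one_pos ht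
  have h3 : ((φ.toRingHom t).degree - 1 : ℝ) *
    (ord w (algebraMap K L ((φ.toRingHom (t ^ m)).coeff (φ.rk (t ^ m)))) -
      φ.shift t w * (((φ.toRingHom t).degree : ℝ) ^ m - 1)) = 0 := by
    linear_combination h1
  exact sub_eq_zero.1 ((mul_eq_zero.1 h3).resolve_left h2.ne')

/-- Up to the common summand `-s`, the term of index `i` has value `slope i + q ^ i (w(x) + s)`.
Every slope is at least `-m` and the top one is `0`, so below `-m` the top term is the strict
minimum. -/
theorem act_of_lt {x : L} (hx : x ≠ 0) (h : ord w x + φ.shift t w < -φ.defect t w) :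
    φ.act t x ≠ 0 ∧ (ord w (φ.act t x) + φ.shift t w : ℝ) =
      (φ.toRingHom t).degree * (ord w x + φ.shift t w) := by
  have hf := φ.toRingHom_ne_zero_of_rk_pos ht
  have hm := φ.defect_nonneg t w
  have hN : ((φ.toRingHom t).degree : ℝ) = (Fintype.card Fq : ℝ) ^ φ.rk t := by
    rw [degree]; push_cast; rfl
  have hlead := φ.ord_leadingCoeff w ht
  have hdom := ord_sum_eq_of_dominant (w := w) (s := (φ.toRingHom t).support)
    (f := fun i => algebraMap K L ((φ.toRingHom t).coeff i) * x ^ (Fintype.card Fq ^ i))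
    (tauDegree_mem_support hf)
    (mul_ne_zero ((map_ne_zero _).2 (coeff_tauDegree_ne_zero hf)) (pow_ne_zero _ hx))
    (fun j hj hjne _ => by
      rw [← Int.cast_lt (R := ℝ), ord_monomial_term w (tauDegree_mem_support hf) hx,
        ord_monomial_term w hj hx]
      have h1 := φ.neg_slope_le_defect w hj
      have h3 := card_pow_sub_ge (Fq := Fq) (lt_of_le_of_ne (le_tauDegree hj) hjne)
      change (ord w (algebraMap K L ((φ.toRingHom t).coeff (φ.rk t))) : ℝ) + _ < _
      rw [slope] at h1
      rw [hlead, hN]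
      change (1 : ℝ) ≤ (Fintype.card Fq : ℝ) ^ φ.rk t - _ at h3
      change _ + (Fintype.card Fq : ℝ) ^ φ.rk t * _ < _
      nlinarith)
  refine ⟨hdom.1, ?_⟩
  have h2 : (ord w (φ.act t x) : ℝ) = _ := congrArg (Int.cast : ℤ → ℝ) hdom.2
  rw [h2, ord_monomial_term w (tauDegree_mem_support hf) hx]
  change (ord w (algebraMap K L ((φ.toRingHom t).coeff (φ.rk t))) : ℝ) +
    (Fintype.card Fq : ℝ) ^ φ.rk t * _ + _ = _
  rw [hlead, hN]
  ring

/-- The condition persists under `φ_t`, so `w(φ_{t^k}(x)) + s = N ^ k (w(x) + s)` for all `k`; the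
constant `s` vanishes in the limit. -/
theorem localV_of_lt {x : L} (hx : x ≠ 0) (h : ord w x + φ.shift t w < -φ.defect t w) :
    φ.localV t w x = ord w x + φ.shift t w := by
  have hm := φ.defect_nonneg t w
  have hN := φ.two_le_degree ht
  have hk : ∀ k : ℕ, φ.act (t ^ k) x ≠ 0 ∧ (ord w (φ.act (t ^ k) x) + φ.shift t w : ℝ) =
      ((φ.toRingHom t).degree : ℝ) ^ k * (ord w x + φ.shift t w) := by
    intro k
    induction k with
    | zero => simp [act_one, hx]
    | succ k ih =>
      have h1 : (1 : ℝ) ≤ ((φ.toRingHom t).degree : ℝ) ^ k := one_le_pow₀ (by linarith)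
      have h2 := φ.act_of_lt w ht ih.1 (by rw [ih.2]; nlinarith)
      rw [pow_succ', act_mul]
      refine ⟨h2.1, ?_⟩
      rw [h2.2, ih.2, pow_succ']
      ring
  refine tendsto_nhds_unique (φ.tendsto_localV w ht x) ?_
  have h3 : Tendsto (fun m : ℕ => φ.shift t w / ((φ.toRingHom (t ^ m)).degree : ℝ)) atTop (𝓝 0) :=
    tendsto_const_nhds.div_atTop (φ.tendsto_degree_pow ht)
  have h4 := (tendsto_const_nhds (x := (0 : ℝ))).min (h3.const_sub (ord w x + φ.shift t w))
  rw [sub_zero, min_eq_right (by linarith)] at h4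
  refine h4.congr fun m => ?_
  have hpos : (0 : ℝ) < ((φ.toRingHom t).degree : ℝ) ^ m := by positivity
  rw [ordMinZero_eq, φ.degree_pow_cast ht, eq_sub_iff_add_eq.2 (hk m).2,
    ← min_div_div_right hpos.le, zero_div, sub_div, mul_div_cancel_left₀ _ hpos.ne']

theorem neg_localV_ge {x : L} (hx : x ≠ 0) :
    -(ord w x + φ.shift t w) - φ.defect t w ≤ -φ.localV t w x := by
  have hm := φ.defect_nonneg t w
  rcases lt_or_ge (ord w x + φ.shift t w) (-φ.defect t w) with h | h
  · rw [φ.localV_of_lt w ht hx h]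
    linarith
  · linarith [φ.localV_nonpos w ht x]

end DrinfeldModule

/-! ### Local lower bounds from close iterates -/

namespace DrinfeldModule

open TwistedPolynomial

variable {Fq : Type*} [Field Fq] [Fintype Fq] {A : Type*} [CommRing A] [Algebra Fq A]
  {K : Type*} [Field K] [Algebra Fq K] (φ : DrinfeldModule Fq A K)
  {L : Type*} [Field L] [Algebra K L] {t : A} (w : Valuation L ℤᵐ⁰)

/-- Among many points with bounded images under `φ_{t^3}`, two are close to each other. -/
theorem exists_ordGE_of_act_cube (ht : 0 < φ.rk t) (hm : 0 < φ.defect t w) {J : Finset ℕ}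
    {y : ℕ → L} (hJ : J.card = (φ.toRingHom t).degree ^ 3 + 1) (hinj : Set.InjOn y J)
    (h0 : ∀ i ∈ J, OrdGE w (-φ.defect t w - φ.shift t w) (y i))
    (h3 : ∀ i ∈ J, OrdGE w (-φ.defect t w - φ.shift t w) (φ.act (t ^ 3) (y i))) :
    ∃ i ∈ J, ∃ j ∈ J, i ≠ j ∧
      OrdGE w (-(2 * φ.defect t w / ((φ.toRingHom t).degree : ℝ) ^ 3) - φ.shift t w)
        (y i - y j) := by
  by_contra! hcon
  have hN := φ.two_le_degree ht
  have hne := φ.toRingHom_ne_zero_of_rk_pos ht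
  set N : ℝ := ((φ.toRingHom t).degree : ℝ) with hNdef
  have hN3 : 0 < N ^ 3 := by positivity
  set m := φ.defect t w
  set s := φ.shift t w
  have hρ : ∀ i ∈ J, ∀ j ∈ J, i ≠ j → (ord w (y i - y j) : ℝ) ≤ -(2 * m / N ^ 3) - s :=
    fun i hi j hj hij => by
      have := hcon i hi j hj hij
      rw [OrdGE, not_or, not_le] at this
      exact this.2.le
  have hdeg := φ.degree_pow hne 3
  -- Interpolate `φ_{t^3}` at `N ^ 3 + 1` separated points. The bound for the coefficient of `X ^ (N
  -- ^ 3)` does not involve the sizes of the points and equals `-m - s + 2 m + N ^ 3 s = m + s (N ^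
  -- 3 - 1)`. The true value is `s (N ^ 3 - 1)`, a contradiction as `m > 0`.
  have key := ordGE_coeff_of_separated (w := w) (N := (φ.toRingHom t).degree ^ 3)
    (f := (φ.toRingHom (t ^ 3)).toPolynomial L) hJ
    (by rw [← hdeg]; exact natDegree_toPolynomial_le L _) hinj
    hρ (c := -m - s) (fun i hi => by rw [eval_toPolynomial]; exact h3 i hi) h0
    (Fintype.card Fq ^ φ.rk (t ^ 3))
  rw [coeff_toPolynomial] at key
  have hlead := key.of_ne ((map_ne_zero _).2
    (coeff_tauDegree_ne_zero (φ.toRingHom_pow_ne_zero hne 3)))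
  rw [show Fintype.card Fq ^ φ.rk (t ^ 3) = (φ.toRingHom t).degree ^ 3 from hdeg] at hlead
  change _ ≤ (ord w (algebraMap K L ((φ.toRingHom (t ^ 3)).coeff (φ.rk (t ^ 3)))) : ℝ) at hlead
  rw [φ.ord_leadingCoeff_pow w ht] at hlead
  push_cast at hlead
  change -m - s + (N ^ 3 - N ^ 3) * _ - N ^ 3 * _ ≤ s * (N ^ 3 - 1) at hlead
  have h4 : N ^ 3 * (-(2 * m / N ^ 3) - s) = -(2 * m) - N ^ 3 * s := by
    field_simp
  rw [h4] at hlead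
  linarith

/-- Among many close points with close images under `φ_t`, two are very close to each other. -/
theorem exists_ordGE_of_act (ht : 0 < φ.rk t) (hm : 0 < φ.defect t w) {J : Finset ℕ}
    {y : ℕ → L} (hJ : J.card = (φ.toRingHom t).degree + 1) (hinj : Set.InjOn y J)
    (h0 : ∀ i ∈ J, ∀ j ∈ J,
      OrdGE w (-(2 * φ.defect t w / ((φ.toRingHom t).degree : ℝ) ^ 3) - φ.shift t w) (y i - y j))
    (h1 : ∀ i ∈ J, ∀ j ∈ J,
      OrdGE w (-(2 * φ.defect t w / ((φ.toRingHom t).degree : ℝ) ^ 3) - φ.shift t w)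
        (φ.act t (y i) - φ.act t (y j))) :
    ∃ i ∈ J, ∃ j ∈ J, i ≠ j ∧
      OrdGE w (φ.defect t w / (4 * (φ.toRingHom t).degree) - φ.shift t w) (y i - y j) := by
  by_contra! hcon
  have hN := φ.two_le_degree ht
  set N : ℝ := ((φ.toRingHom t).degree : ℝ) with hNdef
  have hN0 : 0 < N := by linarith
  obtain ⟨k, hk, hslope⟩ := φ.exists_neg_slope_eq_defect w hm
  set m := φ.defect t w with hmdef
  rw [slope] at hslope
  set s := φ.shift t w
  have hρ : ∀ i ∈ J, ∀ j ∈ J, i ≠ j → (ord w (y i - y j) : ℝ) ≤ m / (4 * N) - s :=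
    fun i hi j hj hij => by
      have := hcon i hi j hj hij
      rw [OrdGE, not_or, not_le] at this
      exact this.2.le
  obtain ⟨i0, hi0⟩ : J.Nonempty := Finset.card_pos.1 (by omega)
  -- Translate one point to `0`, so that points and images have value at least `-2 m / N ^ 3 - s`,
  -- and interpolate a coefficient whose normalized value is exactly `-m`. The quantity `2 m / N ^
  -- 3` enters at most `N` times, which costs at most `m / 2` because `N ≥ 2`, and the separation
  -- costs `m / 4`. The total is less than `m`.
  have key := (ordGE_coeff_of_separated (w := w) (N := (φ.toRingHom t).degree)
    (f := (φ.toRingHom t).toPolynomial L) (y := fun i => y i - y i0) hJ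
    (natDegree_toPolynomial_le L _) (fun i hi j hj h => hinj hi hj (sub_left_injective h))
    (ρ := m / (4 * N) - s) (fun i hi j hj hij => by
      rw [sub_sub_sub_cancel_right]; exact hρ i hi j hj hij)
    (fun i hi => by
      rw [eval_toPolynomial, TwistedPolynomial.eval_sub]; exact h1 i hi i0 hi0)
    (fun i hi => h0 i hi i0 hi0) (Fintype.card Fq ^ k))
  rw [coeff_toPolynomial] at key
  have hcoeff := key.of_ne ((map_ne_zero _).2 (mem_support.1 hk))
  push_cast at hcoeff
  rw [← hNdef] at hcoeff
  set Q : ℝ := (Fintype.card Fq : ℝ) ^ k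
  have hQ : 1 ≤ Q := one_le_pow₀ (by exact_mod_cast Fintype.card_pos)
  have h4 : N * (m / (4 * N) - s) = m / 4 - N * s := by
    field_simp
  have h5 : (1 + N - Q) * (2 * m / N ^ 3) ≤ m / 2 := by
    have h6 : 2 * m / N ^ 3 * N ^ 3 = 2 * m := div_mul_cancel₀ _ (by positivity)
    have h7 : 0 < 2 * m / N ^ 3 := by positivity
    have h8 : N * (2 * m / N ^ 3) ≤ m / 2 := by
      rw [mul_div_assoc', div_le_div_iff₀ (by positivity) (by norm_num)]
      nlinarith [mul_pos hN0 hm, mul_pos (mul_pos hN0 hm) hN0]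
    nlinarith
  rw [h4] at hcoeff
  nlinarith

/-- Three pigeonholes with `N ^ 3`, `N ^ 3` and `N` classes: the first makes the iterates close, the
second their images under `φ_t`, and together these are the hypotheses of `exists_ordGE_of_act` for
the third. The second one applies `φ_{t^3}` to `φ_{t^(i+1)}(x)`, whence the window of length `4`. -/
theorem exists_subset_ordGE_act (ht : 0 < φ.rk t) (hm : 0 < φ.defect t w) {x : L}
    (hinj : Function.Injective fun i : ℕ => φ.act (t ^ i) x) {I : Finset ℕ}
    (hb : ∀ i ∈ I, ∀ j ≤ 4, OrdGE w (-φ.defect t w - φ.shift t w) (φ.act (t ^ (i + j)) x)) {k : ℕ}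
    (hcard : (φ.toRingHom t).degree ^ 7 * k < I.card) :
    ∃ J ⊆ I, k < J.card ∧ ∀ i ∈ J, ∀ j ∈ J,
      OrdGE w (φ.defect t w / (4 * (φ.toRingHom t).degree) - φ.shift t w)
        (φ.act (t ^ i) x - φ.act (t ^ j) x) := by
  set N := (φ.toRingHom t).degree
  have hact : ∀ i j, φ.act (t ^ j) (φ.act (t ^ i) x) = φ.act (t ^ (i + j)) x := fun i j => by
    rw [← act_mul, ← pow_add, add_comm]
  have hact1 : ∀ i, φ.act t (φ.act (t ^ i) x) = φ.act (t ^ (i + 1)) x := fun i => by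
    rw [← act_mul, ← pow_succ']
  obtain ⟨I1, hI1, hc1, hr1⟩ := exists_subset_ordGE w (I := I) (z := fun i => φ.act (t ^ i) x)
    (n := N ^ 3) (k := N ^ 3 * (N * k))
    (fun J hJ hJc => φ.exists_ordGE_of_act_cube w ht hm hJc hinj.injOn
      (fun i hi => hb i (hJ hi) 0 (by omega))
      (fun i hi => by rw [hact]; exact hb i (hJ hi) 3 (by omega)))
    (by convert hcard using 1; ring)
  obtain ⟨I2, hI2, hc2, hr2⟩ := exists_subset_ordGE w (I := I1)
    (z := fun i => φ.act (t ^ (i + 1)) x) (n := N ^ 3) (k := N * k)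
    (fun J hJ hJc => φ.exists_ordGE_of_act_cube w ht hm hJc
      (fun i _ j _ hij => Nat.succ_injective (hinj hij))
      (fun i hi => hb i (hI1 (hJ hi)) 1 (by omega))
      (fun i hi => by rw [hact]; exact hb i (hI1 (hJ hi)) 4 (by omega))) hc1
  obtain ⟨I3, hI3, hc3, hr3⟩ := exists_subset_ordGE w (I := I2)
    (z := fun i => φ.act (t ^ i) x) (n := N) (k := k)
    (fun J hJ hJc => φ.exists_ordGE_of_act w ht hm hJc hinj.injOn
      (fun i hi j hj => hr1 i (hI2 (hJ hi)) j (hI2 (hJ hj)))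
      (fun i hi j hj => by rw [hact1, hact1]; exact hr2 i (hJ hi) j (hJ hj))) hc2
  exact ⟨I3, hI3.trans (hI2.trans hI1), hc3, hr3⟩

/-- For a nontorsion point, some multiple of bounded degree is close to zero at all places of bad
reduction at which no multiple of bounded degree has a large pole. -/
theorem exists_pair_ordGE_act (ht : 0 < φ.rk t) {x : L}
    (hinj : Function.Injective fun i : ℕ => φ.act (t ^ i) x) (T : Finset (Valuation L ℤᵐ⁰))
    (hT : ∀ w ∈ T, 0 < φ.defect t w) {D : ℕ} (hD : ((φ.toRingHom t).degree ^ 7) ^ T.card ≤ D)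
    (hb : ∀ w ∈ T, ∀ i ≤ D + 4, OrdGE w (-φ.defect t w - φ.shift t w) (φ.act (t ^ i) x)) :
    ∃ i j, j < i ∧ i ≤ D ∧ ∀ w ∈ T,
      OrdGE w (φ.defect t w / (4 * (φ.toRingHom t).degree) - φ.shift t w)
        (φ.act (t ^ i) x - φ.act (t ^ j) x) := by
  classical
  -- Each place divides the number of available exponents by at most `N ^ 7`. For `k = 1` the
  -- interval `[0, D]` leaves two exponents that are close at all places of `T`.
  have key : ∀ T' ⊆ T, ∀ k, ∀ I ⊆ Finset.range (D + 1),
      ((φ.toRingHom t).degree ^ 7) ^ T'.card * k < I.card →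
      ∃ J ⊆ I, k < J.card ∧ ∀ w ∈ T', ∀ i ∈ J, ∀ j ∈ J,
        OrdGE w (φ.defect t w / (4 * (φ.toRingHom t).degree) - φ.shift t w)
        (φ.act (t ^ i) x - φ.act (t ^ j) x) := by
    intro T'
    induction T' using Finset.induction_on with
    | empty => exact fun _ k I _ h => ⟨I, subset_rfl, by simpa using h, by simp⟩
    | insert w T' hw ih =>
      intro hT' k I hI hc
      rw [Finset.card_insert_of_notMem hw, pow_succ', mul_assoc] at hc
      have hwT := hT' (Finset.mem_insert_self w T')
      obtain ⟨I1, hI1, hc1, hr1⟩ := φ.exists_subset_ordGE_act w ht (hT w hwT) hinj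
        (fun i hi j hj => hb w hwT (i + j) (by
          have := Finset.mem_range.1 (hI hi)
          omega)) hc
      obtain ⟨J, hJ, hcJ, hrJ⟩ := ih ((Finset.subset_insert _ _).trans hT') k I1 (hI1.trans hI) hc1
      refine ⟨J, hJ.trans hI1, hcJ, fun v hv i hi j hj => ?_⟩
      rcases Finset.mem_insert.1 hv with rfl | hv
      · exact hr1 i (hJ hi) j (hJ hj)
      · exact hrJ v hv i hi j hj
  obtain ⟨J, hJ, hcJ, hr⟩ := key T subset_rfl 1 (Finset.range (D + 1)) subset_rfl (by
    rw [mul_one, Finset.card_range]; omega)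
  obtain ⟨i, hi, j, hj, hij⟩ := Finset.one_lt_card.1 hcJ
  have hi' := Finset.mem_range.1 (hJ hi)
  have hj' := Finset.mem_range.1 (hJ hj)
  rcases lt_or_gt_of_ne hij with h | h
  · exact ⟨j, i, h, by omega, fun w hw => hr w hw j hj i hi⟩
  · exact ⟨i, j, h, by omega, fun w hw => hr w hw i hi j hj⟩

theorem tauDegree_pow_sub_pow (ht : 0 < φ.rk t) {i j : ℕ} (h : j < i) :
    φ.toRingHom (t ^ i - t ^ j) ≠ 0 ∧
      (φ.toRingHom (t ^ i - t ^ j)).degree = (φ.toRingHom t).degree ^ i := by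
  have hne := φ.toRingHom_ne_zero_of_rk_pos ht
  have hlt : φ.rk (t ^ j) < φ.rk (t ^ i) := by
    rw [φ.rk_pow hne, φ.rk_pow hne]
    exact Nat.mul_lt_mul_of_pos_right h ht
  have hsub : ∀ l, (φ.toRingHom (t ^ i - t ^ j)).coeff l =
      (φ.toRingHom (t ^ i)).coeff l - (φ.toRingHom (t ^ j)).coeff l := fun l => by
    rw [eq_sub_iff_add_eq, ← coeff_add, ← map_add, sub_add_cancel]
  have hlead : (φ.toRingHom (t ^ i - t ^ j)).coeff (φ.rk (t ^ i)) ≠ 0 := by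
    rw [hsub, coeff_eq_zero_of_lt (f := φ.toRingHom (t ^ j)) hlt, sub_zero]
    exact coeff_tauDegree_ne_zero (φ.toRingHom_pow_ne_zero hne i)
  refine ⟨fun h0 => hlead (by rw [h0, coeff_zero']), ?_⟩
  rw [← φ.degree_pow hne, degree, degree]
  congr 1
  refine tauDegree_eq_of hlead fun l hl => ?_
  rw [hsub, coeff_eq_zero_of_lt (f := φ.toRingHom (t ^ j)) (hlt.trans hl),
    coeff_eq_zero_of_lt hl, sub_zero]

/-- The local lower bounds, for the values of the local heights at a nontorsion point and the
valuations of a nonzero multiple of this point. -/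
theorem exists_ne_zero_forall_localV_le (ht : 0 < φ.rk t) {x : L} (hx : ¬ φ.IsTorsion x)
    (S : ℕ) (B : Finset (Valuation L ℤᵐ⁰)) (hB : ∀ w ∈ B, 0 < φ.defect t w) (hS : B.card ≤ S)
    {D : ℕ} (hD : ((φ.toRingHom t).degree ^ 7) ^ S = D) :
    ∃ y : L, y ≠ 0 ∧ ∀ w : Valuation L ℤᵐ⁰, (0 < φ.defect t w → w ∈ B) →
      -(ord w y + φ.shift t w) + φ.defect t w / (4 * (φ.toRingHom t).degree) ≤
        (1 + 2 * ((φ.toRingHom t).degree : ℝ) ^ (D + 4)) * ((φ.toRingHom t).degree : ℝ) ^ D *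
          -φ.localV t w x := by
  classical
  have hne := φ.toRingHom_ne_zero_of_rk_pos ht
  have hact : ∀ i j, j < i → φ.act (t ^ i) x - φ.act (t ^ j) x ≠ 0 := fun i j hij h0 => by
    rw [← act_sub_left] at h0
    refine hx ⟨_, fun h1 => (φ.tauDegree_pow_sub_pow ht hij).1 ?_, h0⟩
    rw [h1, map_zero]
  have hinj : Function.Injective fun i : ℕ => φ.act (t ^ i) x := by
    intro i j hij
    by_contra hne'
    rcases lt_or_gt_of_ne hne' with h | h
    · exact hact j i h (sub_eq_zero.2 hij.symm)
    · exact hact i j h (sub_eq_zero.2 hij)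
  -- These are the places at which all iterates up to `D + 4` stay in the disc, so that the
  -- pigeonhole applies. At the other places of `B` an escaping iterate makes the local height of
  -- `x` itself large.
  let T := B.filter fun w => ∀ i ≤ D + 4,
    OrdGE w (-φ.defect t w - φ.shift t w) (φ.act (t ^ i) x)
  have hdeg1 : 1 ≤ (φ.toRingHom t).degree ^ 7 := Nat.one_le_pow _ _ (pow_pos Fintype.card_pos _)
  obtain ⟨i, j, hij, hiD, hT⟩ := φ.exists_pair_ordGE_act ht hinj T
    (fun w hw => hB w (Finset.mem_filter.1 hw).1) (D := D)
    (hD ▸ Nat.pow_le_pow_right hdeg1 ((Finset.card_filter_le _ _).trans hS))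
    (fun w hw => (Finset.mem_filter.1 hw).2)
  refine ⟨_, hact i j hij, fun w hwB => ?_⟩
  set y := φ.act (t ^ i) x - φ.act (t ^ j) x with hy
  have hy0 : y ≠ 0 := hact i j hij
  have hN := φ.two_le_degree ht
  have hVy := φ.localV_act w ht (φ.tauDegree_pow_sub_pow ht hij).1 x
  rw [act_sub_left, ← hy, (φ.tauDegree_pow_sub_pow ht hij).2, Nat.cast_pow] at hVy
  have hVx := φ.localV_nonpos w ht x
  have hge := φ.neg_localV_ge w ht hy0
  have hm := φ.defect_nonneg t w
  set N : ℝ := ((φ.toRingHom t).degree : ℝ)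
  set V := φ.localV t w x
  set m := φ.defect t w
  set s := φ.shift t w
  have hN1 : (1 : ℝ) ≤ N := by linarith
  have hNi : N ^ i ≤ N ^ D := pow_le_pow_right₀ hN1 hiD
  have hND : 1 ≤ N ^ D := one_le_pow₀ hN1
  have hND4 : 0 < N ^ (D + 4) := by positivity
  have hmN : m / (4 * N) ≤ m := div_le_self hm (by linarith)
  have hbound : (N ^ i + 2 * N ^ (D + 4)) * -V ≤
      (1 + 2 * N ^ (D + 4)) * N ^ D * -V := by
    refine mul_le_mul_of_nonneg_right ?_ (by linarith)
    nlinarith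
  have h1 : N ^ i * -V ≤ (1 + 2 * N ^ (D + 4)) * N ^ D * -V :=
    le_trans (by nlinarith) hbound
  rw [hVy] at hge
  rcases hm.eq_or_lt with hm0 | hmpos
  · rw [← hm0] at hge ⊢
    rw [zero_div]
    linarith
  by_cases htype : w ∈ T
  · have := (hT w htype).of_ne hy0
    have h2 : 0 ≤ N ^ i * -V := mul_nonneg (by positivity) (by linarith)
    linarith
  -- The escaping iterate gives `m ≤ N ^ (D + 4) · (-V)`. Two such terms absorb the loss `m` in
  -- `neg_localV_ge` and the additional `m / (4 N) ≤ m`; this is the source of the factor `1 + 2 N ^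
  -- (D + 4)`.
  · have hex : ∃ l ≤ D + 4, ¬ OrdGE w (-m - s) (φ.act (t ^ l) x) := by
      by_contra! hall
      exact htype (Finset.mem_filter.2 ⟨hwB hmpos, hall⟩)
    obtain ⟨l, hl, hlt⟩ := hex
    rw [OrdGE, not_or, not_le] at hlt
    have hVl := φ.localV_act w ht (φ.toRingHom_pow_ne_zero hne l) x
    rw [φ.localV_of_lt w ht hlt.1 (by linarith [hlt.2]), φ.degree_pow_cast ht] at hVl
    change _ = N ^ l * V at hVl
    change _ + s = _ at hVl
    have h3 : N ^ l ≤ N ^ (D + 4) := pow_le_pow_right₀ hN1 hl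
    have h4 : m ≤ N ^ (D + 4) * -V := by
      have : N ^ l * -V ≤ N ^ (D + 4) * -V := mul_le_mul_of_nonneg_right h3 (by linarith)
      linarith [hlt.2]
    linarith

end DrinfeldModule

/-! ### Finite integral closures in inseparable extensions -/

section FrobeniusFinite

theorem finite_of_comp_finite_of_injective {R S B : Type*} [CommRing R] [CommRing S] [CommRing B]
    [IsNoetherianRing R] {i : R →+* S} {g : S →+* B} (hg : Function.Injective g)
    (h : (g.comp i).Finite) : i.Finite := by
  let _ := i.toAlgebra
  let _ := (g.comp i).toAlgebra
  have _ : Module.Finite R B := h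
  exact Module.Finite.of_injective
    ({ g with map_smul' := fun r s => g.map_mul (i r) s } : S →ₗ[R] B) hg

theorem iterateFrobenius_finite {R : Type*} [CommRing R] (p : ℕ) [ExpChar R p]
    (h : (frobenius R p).Finite) (m : ℕ) : (iterateFrobenius R p m).Finite := by
  induction m with
  | zero =>
    have : iterateFrobenius R p 0 = RingHom.id R := by ext; simp
    rw [this]
    exact RingHom.Finite.id R
  | succ m ih =>
    have : iterateFrobenius R p (m + 1) = (iterateFrobenius R p m).comp (frobenius R p) := by
      ext x
      simp [iterateFrobenius_def, frobenius_def, ← pow_mul, pow_succ']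
    rw [this]
    exact ih.comp h

/-- The integral closure of a normal ring that is finite over its subring of `p`-th powers in a
finite extension of its quotient field is finite. -/
theorem finite_integralClosure_of_frobenius_finite {R k L : Type*} [CommRing R] [IsDomain R]
    [IsNoetherianRing R] [IsIntegrallyClosed R] [Field k] [Algebra R k] [IsFractionRing R k]
    [Field L] [Algebra k L] [Algebra R L] [IsScalarTower R k L] [FiniteDimensional k L]
    (p : ℕ) [ExpChar R p] [ExpChar k p] (h : (frobenius R p).Finite) :
    Module.Finite R (integralClosure R L) := by
  have _ : ExpChar L p := expChar_of_injective_algebraMap (algebraMap k L).injective p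
  -- Over the separable closure `M` of `k` in `L` finiteness is classical. A power of Frobenius
  -- embeds the integral closure in `L` into the one in `M`, and on `R` this embedding is an iterate
  -- of the Frobenius of `R`, which is finite.
  let M := separableClosure k L
  have _ : ExpChar M p := expChar_of_injective_algebraMap (algebraMap k M).injective p
  have hfin : Module.Finite R (integralClosure R M) := IsIntegralClosure.finite R k M _
  let m := IsPurelyInseparable.exponent M L
  have hm : ∀ x : L, x ^ p ^ m ∈ M := fun x => by
    obtain ⟨y, hy⟩ := IsPurelyInseparable.exponent_def' M p x
    exact hy ▸ y.2
  have _ : IsScalarTower R M L := IsScalarTower.of_algebraMap_eq fun r => by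
    rw [IsScalarTower.algebraMap_apply R k L, IsScalarTower.algebraMap_apply R k M]
    rfl
  let g₁ : integralClosure R L →+* M :=
    ((iterateFrobenius L p m).comp (integralClosure R L).val.toRingHom).codRestrict M
      (fun x => hm x)
  let g : integralClosure R L →+* integralClosure R M :=
    g₁.codRestrict (integralClosure R M) (fun x => by
      have h1 : IsIntegral R ((x : L) ^ p ^ m) := x.2.pow _
      exact (isIntegral_algebraMap_iff (algebraMap M L).injective).1 h1)
  have hg : Function.Injective g := fun x y hxy => by
    have h1 : (x : L) ^ p ^ m = (y : L) ^ p ^ m := 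
      congrArg (fun z : integralClosure R M => ((z : M) : L)) hxy
    exact Subtype.ext (iterateFrobenius_inj L p m h1)
  have hcomp : g.comp (algebraMap R (integralClosure R L)) =
      (algebraMap R (integralClosure R M)).comp (iterateFrobenius R p m) := by
    ext r
    change (algebraMap R L r) ^ p ^ m = algebraMap R L (iterateFrobenius R p m r)
    rw [iterateFrobenius_def, map_pow]
  refine RingHom.finite_algebraMap.1 (finite_of_comp_finite_of_injective hg ?_)
  rw [hcomp]
  exact (RingHom.finite_algebraMap.2 hfin).comp (iterateFrobenius_finite p h m)

end FrobeniusFinite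

/-! ### Finite extensions of a discrete valuation ring -/

section SemilocalExtension

open IsDedekindDomain

/-- In Smith normal form the quotient is a product of modules `R ⧸ (dᵢ)`, and the product of the
`dᵢ` is associated to the norm of `a`. -/
theorem length_quotient_span_singleton {R S : Type*} [CommRing R] [IsDomain R]
    [IsPrincipalIdealRing R] [CommRing S] [IsDomain S] [Algebra R S] [Module.Free R S]
    [Module.Finite R S] {a : S} (ha : a ≠ 0) :
    Module.length R (S ⧸ Ideal.span {a}) = Ring.ord R (Algebra.norm R a) := by
  let B := Module.Free.chooseBasis R S
  have hI : Ideal.span {a} ≠ ⊥ := Ideal.span_singleton_eq_bot.not.2 ha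
  have h0 := Ideal.smithCoeffs_ne_zero B _ hI
  rw [((Ideal.span {a}).quotientEquivPiSpan B hI).length_eq, Module.length_pi_of_fintype,
    Ring.ord_eq_of_associated (associated_norm_prod_smith B ha)]
  change ∑ i, Ring.ord R ((Ideal.span {a}).smithCoeffs B hI i) = _
  induction (Finset.univ : Finset (Module.Free.ChooseBasisIndex R S)) using Finset.induction_on with
  | empty => simp
  | insert i s hi ih =>
    rw [Finset.sum_insert hi, Finset.prod_insert hi, ih, Ring.ord_mul' R]
    exact mem_nonZeroDivisors_of_ne_zero (h0 i)

variable {R k : Type*} [CommRing R] [IsDomain R] [IsDiscreteValuationRing R] [Field k]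
  [Algebra R k] [IsFractionRing R k] {v : Valuation k ℤᵐ⁰}

omit [IsDomain R] [IsDiscreteValuationRing R] [IsFractionRing R k] in
theorem ord_algebraMap_nonneg (hvR : v.Integers R) (d : R) : 0 ≤ ord v (algebraMap R k d) := by
  exact (ord_nonneg_iff _).2 (hvR.map_le_one d)

omit [IsDomain R] [IsDiscreteValuationRing R] [IsFractionRing R k] in
theorem ord_algebraMap_of_isUnit (hvR : v.Integers R) {d : R} (hd : IsUnit d) :
    ord v (algebraMap R k d) = 0 := by
  simp [ord, hvR.isUnit_iff_valuation_eq_one.1 hd]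

theorem ord_algebraMap_of_irreducible (hv : Function.Surjective v) (hvR : v.Integers R) {ϖ : R}
    (hϖ : Irreducible ϖ) : ord v (algebraMap R k ϖ) = 1 := by
  obtain ⟨z, hz⟩ := hv (WithZero.exp (-1))
  obtain ⟨d, rfl⟩ := hvR.exists_of_le_one (r := z) (by rw [hz]; decide)
  have hd : d ≠ 0 := by rintro rfl; rw [map_zero, map_zero] at hz; exact WithZero.exp_ne_zero hz.symm
  have h1 : ord v (algebraMap R k d) = 1 := by simp [ord, hz]
  obtain ⟨n, u, rfl⟩ := IsDiscreteValuationRing.eq_unit_mul_pow_irreducible hd hϖ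
  have h0 : algebraMap R k ϖ ≠ 0 := by simpa using hϖ.ne_zero
  have hu : algebraMap R k u ≠ 0 := by simp
  rw [map_mul, map_pow, ord_mul _ hu (pow_ne_zero _ h0), ord_algebraMap_of_isUnit hvR u.isUnit,
    ord_pow, zero_add] at h1
  have := ord_algebraMap_nonneg hvR ϖ
  rw [mul_comm] at h1
  exact Int.eq_one_of_mul_eq_one_right this h1

theorem coe_ringOrd (hv : Function.Surjective v) (hvR : v.Integers R) {d : R} (hd : d ≠ 0) :
    ((Ring.ord R d).toNat : ℤ) = ord v (algebraMap R k d) := by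
  obtain ⟨ϖ, hϖ⟩ := IsDiscreteValuationRing.exists_irreducible R
  obtain ⟨n, u, rfl⟩ := IsDiscreteValuationRing.eq_unit_mul_pow_irreducible hd hϖ
  have h0 : algebraMap R k ϖ ≠ 0 := by simpa using hϖ.ne_zero
  have hu : algebraMap R k u ≠ 0 := by simp
  rw [map_mul, map_pow, ord_mul _ hu (pow_ne_zero _ h0), ord_algebraMap_of_isUnit hvR u.isUnit,
    ord_pow, ord_algebraMap_of_irreducible hv hvR hϖ, Ring.ord_mul_of_isUnit_left u.isUnit,
    Ring.ord_pow (mem_nonZeroDivisors_of_ne_zero hϖ.ne_zero), Ring.ord_of_irreducible hϖ]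
  simp

variable {S L : Type*} [CommRing S] [IsDedekindDomain S] [Algebra R S] [Module.Finite R S]
  [Module.IsTorsionFree R S] [Field L] [Algebra S L] [IsFractionRing S L] [Algebra k L]
  [Algebra R L] [IsScalarTower R k L] [IsScalarTower R S L]

omit [Module.IsTorsionFree R S] in
theorem valuation_algebraMap_lt_one (P : HeightOneSpectrum S) {ϖ : R} (hϖ : Irreducible ϖ) :
    P.valuation L (algebraMap R L ϖ) < 1 := by
  rw [IsScalarTower.algebraMap_apply R S L, P.valuation_lt_one_iff_mem]
  have h1 : P.asIdeal.comap (algebraMap R S) ≠ ⊥ := fun h =>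
    P.ne_bot (Ideal.eq_bot_of_comap_eq_bot h)
  have h2 : (P.asIdeal.comap (algebraMap R S)).IsPrime := inferInstance
  have h3 := IsLocalRing.eq_maximalIdeal (h2.isMaximal h1)
  have h4 : ϖ ∈ P.asIdeal.comap (algebraMap R S) := by
    rw [h3]; exact hϖ.not_isUnit
  exact h4

/-- The ramification index is the value of a uniformizer of `R`. It is positive because every
nonzero prime of `S` contracts to the maximal ideal of `R`. -/
theorem exists_ord_valuation_eq (hv : Function.Surjective v) (hvR : v.Integers R)
    (P : HeightOneSpectrum S) :
    ∃ e : ℕ, 0 < e ∧ ∀ z : k, ord (P.valuation L) (algebraMap k L z) = e * ord v z := by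
  obtain ⟨ϖ, hϖ⟩ := IsDiscreteValuationRing.exists_irreducible R
  have h0 : algebraMap R k ϖ ≠ 0 := by simpa using hϖ.ne_zero
  have hL : ∀ r : R, algebraMap k L (algebraMap R k r) = algebraMap R L r := fun r =>
    (IsScalarTower.algebraMap_apply R k L r).symm
  have hpos : 0 < ord (P.valuation L) (algebraMap R L ϖ) := by
    rw [ord_pos_iff]
    · exact valuation_algebraMap_lt_one (L := L) P hϖ
    · rw [← hL]; simpa using h0
  obtain ⟨e, he⟩ := Int.eq_ofNat_of_zero_le hpos.le
  refine ⟨e, by omega, fun z => ?_⟩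
  have key : ∀ r : R, r ≠ 0 → ord (P.valuation L) (algebraMap k L (algebraMap R k r)) =
      e * ord v (algebraMap R k r) := by
    intro r hr
    obtain ⟨n, u, rfl⟩ := IsDiscreteValuationRing.eq_unit_mul_pow_irreducible hr hϖ
    have hu : algebraMap R k u ≠ 0 := by simp
    have hu' : ord (P.valuation L) (algebraMap R L u) = 0 := by
      rw [IsScalarTower.algebraMap_apply R S L]
      have h1 : ∀ x : Rˣ, 0 ≤ ord (P.valuation L) (algebraMap S L (algebraMap R S x)) :=
        fun x => (ord_nonneg_iff _).2 (P.valuation_le_one _)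
      have h2 := h1 u
      have h3 := h1 u⁻¹
      have h4 : algebraMap S L (algebraMap R S ((u⁻¹ : Rˣ) : R)) =
          (algebraMap S L (algebraMap R S u))⁻¹ := by
        refine eq_inv_of_mul_eq_one_left ?_
        rw [← map_mul, ← map_mul]; simp
      rw [h4, ord_inv] at h3
      omega
    rw [map_mul, map_pow, map_mul, map_pow, ord_mul _ (by simp) (pow_ne_zero _ (by simpa using h0)),
      ord_mul _ hu (pow_ne_zero _ h0), ord_pow, ord_pow, hL, hL, hu', he,
      ord_algebraMap_of_isUnit hvR u.isUnit, ord_algebraMap_of_irreducible hv hvR hϖ]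
    ring
  obtain ⟨a, b, hb, rfl⟩ := IsFractionRing.div_surjective (A := R) z
  have hb0 : b ≠ 0 := nonZeroDivisors.ne_zero hb
  by_cases ha : a = 0
  · simp [ha, ord_zero]
  have h1 : algebraMap R k a ≠ 0 := by simpa using ha
  have h2 : algebraMap R k b ≠ 0 := by simpa using hb0
  rw [map_div₀, ord_div _ (by simpa using h1) (by simpa using h2), key a ha, key b hb0,
    ord_div _ h1 h2]
  ring

theorem valuation_algebraMap_le_one_iff (hv : Function.Surjective v) (hvR : v.Integers R)
    (P : HeightOneSpectrum S) (z : k) :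
    P.valuation L (algebraMap k L z) ≤ 1 ↔ v z ≤ 1 := by
  obtain ⟨e, he, h⟩ := exists_ord_valuation_eq (L := L) hv hvR P
  rw [← ord_nonneg_iff, ← ord_nonneg_iff, h]
  exact mul_nonneg_iff_of_pos_left (by exact_mod_cast he)

/-- By approximation, `S ⧸ P` is the whole residue field at `P`. Since `R` maps onto the residue
field of the restriction to `k`, length over `R` is dimension over that field. -/
theorem coe_residueDegree_valuation (hv : Function.Surjective v) (hvR : v.Integers R)
    (P : HeightOneSpectrum S) :
    residueDegree (algebraMap k L).fieldRange (P.valuation L) =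
      (Module.length R (S ⧸ P.asIdeal)).toNat := by
  let w := P.valuation L
  let O := w.valuationSubring
  let κ := IsLocalRing.ResidueField O
  let κ₀ := residueSubfield (algebraMap k L).fieldRange w
  let j : S →+* O := (algebraMap S L).codRestrict O.toSubring fun s => P.valuation_le_one s
  let g : S →+* κ := (IsLocalRing.residue O).comp j
  have hker : RingHom.ker g = P.asIdeal := by
    ext s
    rw [RingHom.mem_ker, ← P.valuation_lt_one_iff_mem (K := L)]
    exact (IsLocalRing.residue_eq_zero_iff (j s)).trans
      (Valuation.mem_maximalIdeal_iff (v := w) (a := j s))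
  have hsurj : Function.Surjective g := by
    intro y
    obtain ⟨y, rfl⟩ := IsLocalRing.residue_surjective y
    obtain ⟨s, hs⟩ := P.exists_valuation_sub_lt_of_integer (K := L) (x := y) y.2 1
    refine ⟨s, ?_⟩
    change IsLocalRing.residue O (j s) = _
    rw [← sub_eq_zero, ← map_sub, IsLocalRing.residue_eq_zero_iff]
    exact (Valuation.mem_maximalIdeal_iff (v := w)).2 hs
  let _ : Algebra R κ := (g.comp (algebraMap R S)).toAlgebra
  have hjR : ∀ r, ((j (algebraMap R S r) : O) : L) = algebraMap k L (algebraMap R k r) := fun r => by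
    rw [← IsScalarTower.algebraMap_apply R k L, IsScalarTower.algebraMap_apply R S L]
    rfl
  let h : R →+* κ₀ := (g.comp (algebraMap R S)).codRestrict κ₀ fun r =>
    ⟨j (algebraMap R S r), ⟨algebraMap R k r, (hjR r).symm⟩, rfl⟩
  let _ : Algebra R κ₀ := h.toAlgebra
  have _ : IsScalarTower R κ₀ κ := IsScalarTower.of_algebraMap_eq fun r => rfl
  have hh : Function.Surjective (algebraMap R κ₀) := by
    rintro ⟨_, ⟨y, ⟨z, hz⟩, rfl⟩⟩
    have h1 : P.valuation L (algebraMap k L z) ≤ 1 := hz ▸ y.2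
    obtain ⟨r, rfl⟩ := hvR.exists_of_le_one
      ((valuation_algebraMap_le_one_iff (L := L) hv hvR P z).1 h1)
    refine ⟨r, Subtype.ext (congrArg (IsLocalRing.residue O) (Subtype.ext ?_))⟩
    exact (hjR r).trans hz
  let e : (S ⧸ P.asIdeal) ≃ₗ[R] κ :=
    { (Ideal.quotEquivOfEq hker.symm).trans (RingHom.quotientKerEquivOfSurjective hsurj) with
      map_smul' := fun r x => by
        obtain ⟨x, rfl⟩ := Ideal.Quotient.mk_surjective x
        change g (r • x) = g (algebraMap R S r) * g x
        rw [Algebra.smul_def, map_mul] }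
  rw [e.length_eq, Module.length_eq_of_surjective hh, Module.length_eq_rank,
    Cardinal.toNat_toENat]
  rfl

end SemilocalExtension

/-! ### Norms and the valuations above a discrete valuation -/

section SemilocalNorm

open IsDedekindDomain

variable {R k S L : Type*} [CommRing R] [IsDomain R] [IsDiscreteValuationRing R] [Field k]
  [Algebra R k] [IsFractionRing R k] {v : Valuation k ℤᵐ⁰} [CommRing S] [IsDedekindDomain S]
  [Algebra R S] [Module.Finite R S]
  [Module.IsTorsionFree R S] [Field L] [Algebra S L] [IsFractionRing S L] [Algebra k L]
  [Algebra R L] [IsScalarTower R k L] [IsScalarTower R S L]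

theorem ord_valuation_of_span_eq {P : HeightOneSpectrum S} {a : S} (ha : P.asIdeal = Ideal.span {a}) :
    ord (P.valuation L) (algebraMap S L a) = 1 := by
  have h0 : a ≠ 0 := by rintro rfl; exact P.ne_bot (by simpa using ha)
  rw [ord, P.valuation_of_algebraMap, P.intValuation_singleton h0 ha]
  simp

theorem ord_valuation_of_isUnit (P : HeightOneSpectrum S) {a : S} (ha : IsUnit a) :
    ord (P.valuation L) (algebraMap S L a) = 0 := by
  have h0 : algebraMap S L a ≠ 0 := by simpa using ha.ne_zero
  rw [ord_eq_zero_iff _ h0, P.valuation_eq_one_iff_notMem]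
  exact fun h => P.isPrime.ne_top (Ideal.eq_top_of_isUnit_mem _ h ha)

/-- Both sides are additive in `a` and vanish on units. For a prime element `π` only the ideal `(π)`
contributes, and its residue degree is the length of `S ⧸ (π)`, that is, the order of the norm of
`π`. -/
theorem sum_residueDegree_mul_ord_algebraMap [IsPrincipalIdealRing S]
    [Fintype (HeightOneSpectrum S)] (hv : Function.Surjective v) (hvR : v.Integers R) {a : S}
    (ha : a ≠ 0) :
    ∑ P : HeightOneSpectrum S, (residueDegree (algebraMap k L).fieldRange (P.valuation L) : ℤ) *
      ord (P.valuation L) (algebraMap S L a) = ord v (algebraMap R k (Algebra.norm R a)) := by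
  induction a using UniqueFactorizationMonoid.induction_on_prime with
  | h₁ => exact absurd rfl ha
  | h₂ a h =>
    rw [ord_algebraMap_of_isUnit hvR (h.map (Algebra.norm R))]
    exact Finset.sum_eq_zero fun P _ => by rw [ord_valuation_of_isUnit P h, mul_zero]
  | h₃ a π ha' hπ ih =>
    have h1 : algebraMap S L a ≠ 0 := by simpa using ha'
    have h2 : algebraMap S L π ≠ 0 := by simpa using hπ.ne_zero
    have h3 : Algebra.norm R a ≠ 0 := Algebra.norm_ne_zero_iff.2 ha'
    have h4 : Algebra.norm R π ≠ 0 := Algebra.norm_ne_zero_iff.2 hπ.ne_zero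
    let P₀ : HeightOneSpectrum S := ⟨Ideal.span {π}, (Ideal.span_singleton_prime hπ.ne_zero).2 hπ,
      Ideal.span_singleton_eq_bot.not.2 hπ.ne_zero⟩
    have h5 : ∑ P : HeightOneSpectrum S,
        (residueDegree (algebraMap k L).fieldRange (P.valuation L) : ℤ) *
          ord (P.valuation L) (algebraMap S L π) = ord v (algebraMap R k (Algebra.norm R π)) := by
      rw [Finset.sum_eq_single P₀]
      · rw [ord_valuation_of_span_eq (P := P₀) rfl, mul_one, coe_residueDegree_valuation hv hvR,
          length_quotient_span_singleton hπ.ne_zero, coe_ringOrd hv hvR h4]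
      · intro P _ hP
        rw [(ord_eq_zero_iff _ h2).2, mul_zero]
        rw [P.valuation_eq_one_iff_notMem]
        intro h
        refine hP (HeightOneSpectrum.ext (P₀.isMaximal.eq_of_le P.isPrime.ne_top ?_).symm)
        exact (Ideal.span_singleton_le_iff_mem _).2 h
      · simp
    rw [map_mul, map_mul, map_mul, ord_mul _ (by simpa using h4) (by simpa using h3), ← ih ha',
      ← h5, ← Finset.sum_add_distrib]
    exact Finset.sum_congr rfl fun P _ => by rw [ord_mul _ h2 h1, mul_add]

/-- The valuation of a norm is the sum of the valuations above it, weighted by the residue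
degrees. -/
theorem sum_residueDegree_mul_ord [IsPrincipalIdealRing S] [IsIntegralClosure S R L]
    [FiniteDimensional k L]
    [Fintype (HeightOneSpectrum S)] (hv : Function.Surjective v) (hvR : v.Integers R) {y : L}
    (hy : y ≠ 0) :
    ∑ P : HeightOneSpectrum S, (residueDegree (algebraMap k L).fieldRange (P.valuation L) : ℤ) *
      ord (P.valuation L) y = ord v (Algebra.norm k y) := by
  have hloc : IsLocalization (Algebra.algebraMapSubmonoid S (nonZeroDivisors R)) L :=
    IsIntegralClosure.isLocalization R k L S
  have hnorm : ∀ a : S, Algebra.norm k (algebraMap S L a) = algebraMap R k (Algebra.norm R a) :=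
    fun a => Algebra.norm_localization R (nonZeroDivisors R) a
  obtain ⟨a, b, hb, rfl⟩ := IsFractionRing.div_surjective (A := S) y
  have hb0 : b ≠ 0 := nonZeroDivisors.ne_zero hb
  have ha0 : a ≠ 0 := by rintro rfl; simp at hy
  have h1 : algebraMap S L a ≠ 0 := by simpa using ha0
  have h2 : algebraMap S L b ≠ 0 := by simpa using hb0
  have h3 : algebraMap R k (Algebra.norm R a) ≠ 0 := by
    simpa using Algebra.norm_ne_zero_iff (R := R).2 ha0
  have h4 : algebraMap R k (Algebra.norm R b) ≠ 0 := by
    simpa using Algebra.norm_ne_zero_iff (R := R).2 hb0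
  have h5 : Algebra.norm k (algebraMap S L a / algebraMap S L b) =
      algebraMap R k (Algebra.norm R a) / algebraMap R k (Algebra.norm R b) :=
    eq_div_of_mul_eq h4 (by rw [← hnorm, ← map_mul, div_mul_cancel₀ _ h2, hnorm])
  rw [h5, ord_div _ h3 h4, ← sum_residueDegree_mul_ord_algebraMap (L := L) hv hvR ha0,
    ← sum_residueDegree_mul_ord_algebraMap (L := L) hv hvR hb0, ← Finset.sum_sub_distrib]
  exact Finset.sum_congr rfl fun P _ => by rw [ord_div _ h1 h2, mul_sub]

/-- The point is finiteness, since `finrank` is `0` by default in the infinite case: the length of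
`S ⧸ P` is the order of the norm of a generator of `P`. -/
theorem residueDegree_valuation_pos [IsPrincipalIdealRing S]
    (hv : Function.Surjective v) (hvR : v.Integers R) (P : HeightOneSpectrum S) :
    0 < residueDegree (algebraMap k L).fieldRange (P.valuation L) := by
  obtain ⟨π, hπ⟩ := (IsPrincipalIdealRing.principal P.asIdeal).principal
  have h0 : π ≠ 0 := by rintro rfl; exact P.ne_bot (by simpa using hπ)
  have h1 : Module.length R (S ⧸ P.asIdeal) = Ring.ord R (Algebra.norm R π) := by
    rw [← length_quotient_span_singleton h0, hπ, Ideal.submodule_span_eq]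
  rw [coe_residueDegree_valuation hv hvR, pos_iff_ne_zero, ne_eq, ENat.toNat_eq_zero, not_or]
  refine ⟨?_, ?_⟩
  · have := Ideal.Quotient.nontrivial_iff.2 P.isPrime.ne_top
    exact Module.length_pos.ne'
  · rw [h1]
    exact Ring.ord_ne_top (mem_nonZeroDivisors_of_ne_zero (Algebra.norm_ne_zero_iff.2 h0))

/-- `P` is the centre of `w` on `S`, where `w < 1`. Elements of `P`-adic order zero are quotients of
elements outside `P`, hence units for `w`. So `ord w` is a multiple of the `P`-adic order, and
surjectivity makes the factor `1`. -/
theorem exists_eq_valuation [IsPrincipalIdealRing S] {w : Valuation L ℤᵐ⁰}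
    (hw : Function.Surjective w) (hwS : ∀ s : S, w (algebraMap S L s) ≤ 1) :
    ∃ P : HeightOneSpectrum S, w = P.valuation L := by
  let I : Ideal S :=
    { carrier := {s | w (algebraMap S L s) < 1}
      add_mem' := fun {a b} ha hb => by
        simp only [Set.mem_ofPred_eq, map_add] at *
        exact w.map_add_lt ha hb
      zero_mem' := by simp
      smul_mem' := fun c x hx => by
        simp only [Set.mem_ofPred_eq, smul_eq_mul, map_mul] at *
        exact mul_lt_one_of_nonneg_of_lt_one_right (hwS c) zero_le hx }
  have hI : ∀ s, s ∈ I ↔ w (algebraMap S L s) < 1 := fun _ => Iff.rfl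
  have h1 : ∀ s, s ∉ I → w (algebraMap S L s) = 1 := fun s hs =>
    le_antisymm (hwS s) (not_lt.1 hs)
  have hIp : I.IsPrime := by
    refine ⟨fun h => ?_, fun {a b} hab => ?_⟩
    · have : (1 : S) ∈ I := h ▸ Submodule.mem_top
      simp [hI] at this
    · by_contra! h
      rw [hI, map_mul, map_mul, h1 a h.1, h1 b h.2] at hab
      simp at hab
  obtain ⟨z, hz⟩ := hw (WithZero.exp 1)
  have hI0 : I ≠ ⊥ := by
    intro h
    obtain ⟨a, b, hb, rfl⟩ := IsFractionRing.div_surjective (A := S) z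
    have hb0 : b ≠ 0 := nonZeroDivisors.ne_zero hb
    have h2 : w (algebraMap S L b) = 1 := h1 b (by rw [h]; simpa using hb0)
    rw [map_div₀, h2, div_one] at hz
    have := hwS a
    rw [hz] at this
    exact absurd this (by decide)
  let P : HeightOneSpectrum S := ⟨I, hIp, hI0⟩
  obtain ⟨π, hπ⟩ := (IsPrincipalIdealRing.principal I).principal
  have hP : P.asIdeal = Ideal.span {π} := by rw [← Ideal.submodule_span_eq]; exact hπ
  have hπ0 : π ≠ 0 := by rintro rfl; exact hI0 (by simpa using hπ)
  have hπL : algebraMap S L π ≠ 0 := by simpa using hπ0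
  have hPπ : ord (P.valuation L) (algebraMap S L π) = 1 := ord_valuation_of_span_eq hP
  have key : ∀ y : L, y ≠ 0 → ord w y = ord (P.valuation L) y * ord w (algebraMap S L π) := by
    intro y hy
    let n := ord (P.valuation L) y
    have hy0 : y * (algebraMap S L π) ^ (-n) ≠ 0 := mul_ne_zero hy (zpow_ne_zero _ hπL)
    have hzp : ∀ (u : Valuation L ℤᵐ⁰) (m : ℤ), ord u ((algebraMap S L π) ^ m) =
        m * ord u (algebraMap S L π) := by
      intro u m
      cases m with
      | ofNat m => simp [ord_pow]
      | negSucc m => rw [zpow_negSucc, ord_inv, ord_pow, Int.negSucc_eq]; push_cast; ring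
    have h2 : ord (P.valuation L) (y * (algebraMap S L π) ^ (-n)) = 0 := by
      rw [ord_mul _ hy (zpow_ne_zero _ hπL), hzp, hPπ]; simp [n]
    obtain ⟨a, ⟨b, hb⟩, hab⟩ :=
      P.exists_primeCompl_mul_eq_of_integer _ ((ord_nonneg_iff _).1 h2.ge)
    have hb' : P.valuation L (algebraMap S L b) = 1 := P.valuation_eq_one_iff_notMem.2 hb
    have ha' : P.valuation L (algebraMap S L a) = 1 := by
      rw [← hab, map_mul, hb', (ord_eq_zero_iff _ hy0).1 h2, one_mul]
    have h3 := congrArg w hab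
    rw [map_mul, h1 b hb, h1 a (P.valuation_eq_one_iff_notMem.1 ha'), mul_one] at h3
    have h4 := (ord_eq_zero_iff _ hy0).2 h3
    rw [ord_mul _ hy (zpow_ne_zero _ hπL), hzp] at h4
    linarith
  have hπ1 : ord w (algebraMap S L π) = 1 := by
    have hz0 : z ≠ 0 := by rintro rfl; rw [map_zero] at hz; exact WithZero.exp_ne_zero hz.symm
    have h2 := key z⁻¹ (inv_ne_zero hz0)
    rw [ord_inv, show ord w z = -1 by simp [ord, hz]] at h2
    have h3 : 0 < ord w (algebraMap S L π) :=
      (ord_pos_iff _ hπL).2 ((hI π).1 (hπ ▸ Submodule.mem_span_singleton_self π))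
    exact Int.eq_one_of_mul_eq_one_left h3.le (by simpa using h2.symm)
  refine ⟨P, Valuation.ext fun y => ?_⟩
  by_cases hy : y = 0
  · simp [hy]
  have h2 := key y hy
  rw [hπ1, mul_one] at h2
  have h3 : ∀ u : Valuation L ℤᵐ⁰, u y = WithZero.exp (-ord u y) := fun u => by
    rw [ord, neg_neg, WithZero.exp_log ((Valuation.ne_zero_iff _).2 hy)]
  rw [h3, h3 (P.valuation L), h2]

theorem finite_setOf_isPrime (R S : Type*) [CommRing R] [IsDomain R] [IsDiscreteValuationRing R]
    [CommRing S] [IsDomain S] [Algebra R S] [Module.Finite R S] :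
    {I : Ideal S | I.IsPrime}.Finite := by
  have h1 := Algebra.QuasiFinite.finite_primesOver (S := S) (IsLocalRing.maximalIdeal R)
  refine (h1.union (Set.finite_singleton ⊥)).subset fun I hI => ?_
  by_cases h : I = ⊥
  · exact Or.inr h
  refine Or.inl ⟨hI, ⟨?_⟩⟩
  have hIp : I.IsPrime := hI
  have h2 : (I.comap (algebraMap R S)).IsPrime := inferInstance
  have h3 : I.comap (algebraMap R S) ≠ ⊥ := fun h' => h (Ideal.eq_bot_of_comap_eq_bot h')
  exact (IsLocalRing.eq_maximalIdeal (h2.isMaximal h3)).symm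

end SemilocalNorm

/-! ### Places above a base valuation -/

section PlacesOver

open IsDedekindDomain

variable {k : Type*} [Field k] (v : Valuation k ℤᵐ⁰)

/-- The normalized discrete valuations of `L` above the discrete valuation `v` of `k`. -/
def placesOver (L : Type*) [Field L] [Algebra k L] : Set (Valuation L ℤᵐ⁰) :=
  {w | Function.Surjective w ∧ ∃ e : ℕ, 0 < e ∧ ∀ z : k, ord w (algebraMap k L z) = e * ord v z}

variable {v}

theorem isDiscreteValuationRing_valuationSubring (hv : Function.Surjective v) :
    IsDiscreteValuationRing v.valuationSubring := by
  have _ : Nontrivial (MonoidWithZeroHom.ofClass v).valueGroup := by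
    obtain ⟨z, hz⟩ := hv (WithZero.exp 1)
    refine ⟨⟨⟨Units.mk0 (WithZero.exp 1) WithZero.exp_ne_zero,
      MonoidWithZeroHom.mem_valueGroup _ ⟨z, hz⟩⟩, 1, fun h => ?_⟩⟩
    have h1 : (WithZero.exp 1 : ℤᵐ⁰) = 1 := congrArg Units.val (congrArg Subtype.val h)
    exact absurd h1 (by decide)
  infer_instance

variable (v) in
theorem integers_valuationSubring : v.Integers v.valuationSubring :=
  Valuation.integer.integers v

theorem isDedekindDomain_integralClosure {R L : Type*} (k : Type*) [CommRing R] [IsDomain R]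
    [IsDiscreteValuationRing R] [Field k] [Algebra R k] [IsFractionRing R k] [Field L] [Algebra k L]
    [Algebra R L] [IsScalarTower R k L] [FiniteDimensional k L]
    [Module.Finite R (integralClosure R L)] : IsDedekindDomain (integralClosure R L) := by
  have h1 : IsNoetherianRing (integralClosure R L) := IsNoetherianRing.of_finite R _
  have h2 : IsIntegrallyClosed (integralClosure R L) :=
    integralClosure.isIntegrallyClosedOfFiniteExtension k
  have h3 : Ring.DimensionLEOne (integralClosure R L) := Ring.DimensionLEOne.integralClosure R L
  exact { toIsDomain := inferInstance, toIsDedekindRing := { } }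

variable {L : Type*} [Field L] [Algebra k L]

theorem le_one_of_mem_placesOver {w : Valuation L ℤᵐ⁰} (hw : w ∈ placesOver v L) {z : k}
    (hz : v z ≤ 1) : w (algebraMap k L z) ≤ 1 := by
  obtain ⟨-, e, -, h⟩ := hw
  rw [← ord_nonneg_iff, h]
  exact mul_nonneg (by positivity) ((ord_nonneg_iff _).2 hz)

theorem le_one_of_isIntegral {w : Valuation L ℤᵐ⁰} (hw : w ∈ placesOver v L) {s : L}
    (hs : IsIntegral v.valuationSubring s) : w s ≤ 1 := by
  let g : v.valuationSubring →+* w.valuationSubring :=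
    ((algebraMap k L).comp v.valuationSubring.subtype).codRestrict w.valuationSubring.toSubring
      fun z => le_one_of_mem_placesOver hw z.2
  exact (integers_valuationSubring w).mem_of_integral
    (hs.map_of_comp_eq g (RingHom.id L) rfl)

variable [FiniteDimensional k L]

/-- The normalized valuations above `v` are those defined by the maximal ideals of the integral
closure of the valuation ring of `v`. -/
theorem placesOver_eq_range (hv : Function.Surjective v)
    [Module.Finite v.valuationSubring (integralClosure v.valuationSubring L)]
    [IsDedekindDomain (integralClosure v.valuationSubring L)]
    [IsPrincipalIdealRing (integralClosure v.valuationSubring L)]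
    [IsFractionRing (integralClosure v.valuationSubring L) L] :
    placesOver v L = Set.range fun P : HeightOneSpectrum (integralClosure v.valuationSubring L) =>
      P.valuation L := by
  have _ := isDiscreteValuationRing_valuationSubring hv
  ext w
  constructor
  · rintro ⟨hw, e, he, h⟩
    obtain ⟨P, rfl⟩ := exists_eq_valuation (S := integralClosure v.valuationSubring L) hw
      fun s => le_one_of_isIntegral ⟨hw, e, he, h⟩ (s := (s : L)) s.2
    exact ⟨P, rfl⟩
  · rintro ⟨P, rfl⟩
    exact ⟨P.valuation_surjective L, exists_ord_valuation_eq hv (integers_valuationSubring v) P⟩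

theorem valuation_injective {S L : Type*} [CommRing S] [IsDedekindDomain S] [Field L] [Algebra S L]
    [IsFractionRing S L] :
    Function.Injective fun P : HeightOneSpectrum S => P.valuation L := fun P Q h =>
  HeightOneSpectrum.eq_of_valuation_isEquiv_valuation (by
    have h' : P.valuation L = Q.valuation L := h
    rw [h'])

theorem isPrincipalIdealRing_integralClosure (R L : Type*) [CommRing R] [IsDomain R]
    [IsDiscreteValuationRing R] [Field L]
    [Algebra R L]
    [Module.Finite R (integralClosure R L)] [IsDedekindDomain (integralClosure R L)] :
    IsPrincipalIdealRing (integralClosure R L) :=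
  IsPrincipalIdealRing.of_finite_primes (finite_setOf_isPrime R _)

theorem finite_heightOneSpectrum (R S : Type*) [CommRing R] [IsDomain R]
    [IsDiscreteValuationRing R] [CommRing S] [IsDomain S] [Algebra R S] [Module.Finite R S] :
    Finite (HeightOneSpectrum S) := by
  have _ : Finite {I : Ideal S | I.IsPrime} := (finite_setOf_isPrime R S)
  exact Finite.of_injective (fun P : HeightOneSpectrum S =>
    (⟨P.asIdeal, P.isPrime⟩ : {I : Ideal S | I.IsPrime})) fun P Q h =>
      HeightOneSpectrum.ext (congrArg Subtype.val h)

variable [Module.Finite v.valuationSubring (integralClosure v.valuationSubring L)]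

theorem exists_dedekind_setup (hv : Function.Surjective v) :
    IsDiscreteValuationRing v.valuationSubring ∧
    IsDedekindDomain (integralClosure v.valuationSubring L) ∧
    IsPrincipalIdealRing (integralClosure v.valuationSubring L) ∧
    IsFractionRing (integralClosure v.valuationSubring L) L ∧
    Module.IsTorsionFree v.valuationSubring (integralClosure v.valuationSubring L) := by
  have h1 := isDiscreteValuationRing_valuationSubring hv
  have h2 : IsDedekindDomain (integralClosure v.valuationSubring L) :=
    isDedekindDomain_integralClosure k
  exact ⟨h1, h2, isPrincipalIdealRing_integralClosure _ _,
    integralClosure.isFractionRing_of_finite_extension k L, inferInstance⟩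

theorem finite_placesOver (hv : Function.Surjective v) : (placesOver v L).Finite := by
  obtain ⟨_, _, _, _, _⟩ := exists_dedekind_setup (L := L) hv
  have _ := finite_heightOneSpectrum v.valuationSubring (integralClosure v.valuationSubring L)
  rw [placesOver_eq_range hv]
  exact Set.finite_range _

/-- The valuation of a norm is the sum of the valuations above it, weighted by the residue
degrees. -/
theorem sum_placesOver (hv : Function.Surjective v) (h : (placesOver v L).Finite) {y : L}
    (hy : y ≠ 0) :
    ∑ w ∈ h.toFinset, (residueDegree (algebraMap k L).fieldRange w : ℤ) * ord w y =
      ord v (Algebra.norm k y) := by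
  obtain ⟨_, _, _, _, _⟩ := exists_dedekind_setup (L := L) hv
  have _ := finite_heightOneSpectrum v.valuationSubring (integralClosure v.valuationSubring L)
  have _ := Fintype.ofFinite (HeightOneSpectrum (integralClosure v.valuationSubring L))
  rw [← sum_residueDegree_mul_ord (S := integralClosure v.valuationSubring L) hv
    (integers_valuationSubring v) hy]
  classical
  have h1 : h.toFinset = Finset.univ.image fun P :
      HeightOneSpectrum (integralClosure v.valuationSubring L) => P.valuation L := by
    ext w
    rw [Set.Finite.mem_toFinset, placesOver_eq_range hv]
    simp
  rw [h1, Finset.sum_image valuation_injective.injOn]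

theorem residueDegree_pos (hv : Function.Surjective v) {w : Valuation L ℤᵐ⁰}
    (hw : w ∈ placesOver v L) : 0 < residueDegree (algebraMap k L).fieldRange w := by
  obtain ⟨_, _, _, _, _⟩ := exists_dedekind_setup (L := L) hv
  rw [placesOver_eq_range hv] at hw
  obtain ⟨P, rfl⟩ := hw
  exact residueDegree_valuation_pos hv (integers_valuationSubring v) P

theorem isIntegral_of_forall_placesOver (hv : Function.Surjective v) {y : L}
    (h : ∀ w ∈ placesOver v L, w y ≤ 1) : IsIntegral v.valuationSubring y := by
  obtain ⟨_, _, _, _, _⟩ := exists_dedekind_setup (L := L) hv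
  rw [placesOver_eq_range hv] at h
  obtain ⟨s, rfl⟩ := HeightOneSpectrum.mem_integers_of_valuation_le_one
    (R := integralClosure v.valuationSubring L) L y (fun P => h _ ⟨P, rfl⟩)
  exact s.2

section Tower

variable {K : Type*} [Field K] [Algebra k K] [FiniteDimensional k K] [Algebra K L]
  [IsScalarTower k K L]
  [Module.Finite v.valuationSubring (integralClosure v.valuationSubring K)]

/-- Every integral element of `L` has a positive power coming from an integral element of `K`. Hence
a prime ideal upstairs is determined by its contraction. -/
theorem ncard_placesOver_le [IsPurelyInseparable K L] (hv : Function.Surjective v) :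
    (placesOver v L).ncard ≤ (placesOver v K).ncard := by
  obtain ⟨_, _, _, _, _⟩ := exists_dedekind_setup (L := L) hv
  obtain ⟨_, _, _, _, _⟩ := exists_dedekind_setup (L := K) hv
  have _ := finite_heightOneSpectrum v.valuationSubring (integralClosure v.valuationSubring K)
  have htow : IsScalarTower v.valuationSubring K L := IsScalarTower.of_algebraMap_eq fun r =>
    IsScalarTower.algebraMap_apply k K L (r : k)
  let i : integralClosure v.valuationSubring K →+* integralClosure v.valuationSubring L :=
    ((algebraMap K L).comp (integralClosure v.valuationSubring K).val.toRingHom).codRestrict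
      (integralClosure v.valuationSubring L).toSubring fun s =>
        s.2.map (IsScalarTower.toAlgHom v.valuationSubring K L)
  obtain ⟨q, _⟩ := ExpChar.exists K
  have key : ∀ s : integralClosure v.valuationSubring L, ∃ m : ℕ, m ≠ 0 ∧ ∃ t, i t = s ^ m := by
    intro s
    obtain ⟨m, t, ht⟩ := IsPurelyInseparable.pow_mem K q (s : L)
    have ht' : IsIntegral v.valuationSubring (algebraMap K L t) := by rw [ht]; exact s.2.pow _
    exact ⟨q ^ m, pow_ne_zero _ (expChar_ne_zero K q),
      ⟨t, (isIntegral_algebraMap_iff (algebraMap K L).injective).1 ht'⟩, Subtype.ext ht⟩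
  let c : HeightOneSpectrum (integralClosure v.valuationSubring L) →
      HeightOneSpectrum (integralClosure v.valuationSubring K) := fun P =>
    { asIdeal := P.asIdeal.comap i
      isPrime := inferInstance
      ne_bot := fun h => P.ne_bot (by
        refine (Submodule.eq_bot_iff _).2 fun s hs => ?_
        obtain ⟨m, hm, t, ht⟩ := key s
        have h1 : t ∈ P.asIdeal.comap i := by
          rw [Ideal.mem_comap, ht]; exact P.asIdeal.pow_mem_of_mem hs m (Nat.pos_of_ne_zero hm)
        rw [h, Ideal.mem_bot] at h1
        rw [h1, map_zero] at ht
        exact (pow_eq_zero_iff hm).1 ht.symm) }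
  have hc : Function.Injective c := by
    have hle : ∀ P Q, c P = c Q → P.asIdeal ≤ Q.asIdeal := by
      intro P Q h s hs
      obtain ⟨m, hm, t, ht⟩ := key s
      have h1 : t ∈ (c P).asIdeal := by
        change i t ∈ P.asIdeal
        rw [ht]; exact P.asIdeal.pow_mem_of_mem hs m (Nat.pos_of_ne_zero hm)
      rw [h] at h1
      have h2 : i t ∈ Q.asIdeal := h1
      rw [ht] at h2
      exact Q.isPrime.mem_of_pow_mem _ h2
    exact fun P Q h => HeightOneSpectrum.ext (le_antisymm (hle P Q h) (hle Q P h.symm))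
  rw [placesOver_eq_range hv, placesOver_eq_range hv, ← Nat.card_coe_set_eq,
    ← Nat.card_coe_set_eq, Nat.card_range_of_injective valuation_injective,
    Nat.card_range_of_injective valuation_injective]
  exact Nat.card_le_card_of_injective c hc

omit [FiniteDimensional k L] [FiniteDimensional k K]
  [Module.Finite v.valuationSubring (integralClosure v.valuationSubring L)]
  [Module.Finite v.valuationSubring (integralClosure v.valuationSubring K)] in
/-- If `a` and `b` are coprime, then the denominator `b` of `a / b` has the polar divisor of
`a / b` as its divisor. -/
theorem max_zero_neg_ord_div {a b r s : integralClosure v.valuationSubring K}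
    (hrs : r * a + s * b = 1) (ha : (a : K) ≠ 0) (hb : (b : K) ≠ 0) {w : Valuation L ℤᵐ⁰}
    (hw : w ∈ placesOver v L) :
    max 0 (-ord w (algebraMap K L (a / b))) = ord w (algebraMap K L b) := by
  have htow : IsScalarTower v.valuationSubring K L := IsScalarTower.of_algebraMap_eq fun r =>
    IsScalarTower.algebraMap_apply k K L (r : k)
  have hint : ∀ z : integralClosure v.valuationSubring K, w (algebraMap K L z) ≤ 1 := fun z =>
    le_one_of_isIntegral hw (z.2.map (IsScalarTower.toAlgHom v.valuationSubring K L))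
  have ha1 : algebraMap K L a ≠ 0 := by simpa using ha
  have hb1 : algebraMap K L b ≠ 0 := by simpa using hb
  have h1 := (ord_nonneg_iff w).2 (hint a)
  have h2 := (ord_nonneg_iff w).2 (hint b)
  have h3 : ord w (algebraMap K L a) = 0 ∨ ord w (algebraMap K L b) = 0 := by
    by_contra! h
    have h4 := (ord_pos_iff w ha1).1 (lt_of_le_of_ne h1 h.1.symm)
    have h5 := (ord_pos_iff w hb1).1 (lt_of_le_of_ne h2 h.2.symm)
    have h6 := congrArg (fun z : integralClosure v.valuationSubring K =>
      w (algebraMap K L (z : K))) hrs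
    simp only [Subalgebra.coe_add, Subalgebra.coe_mul, map_add, Subalgebra.coe_one,
      map_one] at h6
    refine (w.map_add_lt ?_ ?_).ne h6
    · rw [map_mul, map_mul]
      exact mul_lt_one_of_nonneg_of_lt_one_right (hint r) zero_le h4
    · rw [map_mul, map_mul]
      exact mul_lt_one_of_nonneg_of_lt_one_right (hint s) zero_le h5
  rw [map_div₀, ord_div _ ha1 hb1]
  omega

/-- Write `g = a / b` with coprime `a` and `b` in the integral closure, a principal ideal domain.
The poles of `g` above `v` form the divisor of `b`, whose degree in `L` is the value of the norm of
`b`. This is `[L : K]` times the value of the norm from `K` to `k`, a positive integer because `g`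
is not integral. -/
theorem finrank_le_sum_placesOver [FiniteDimensional K L] (hv : Function.Surjective v)
    (h : (placesOver v L).Finite) {g : K} (hg : ¬ IsIntegral v.valuationSubring g) :
    (Module.finrank K L : ℤ) ≤ ∑ w ∈ h.toFinset,
      (residueDegree (algebraMap k L).fieldRange w : ℤ) * max 0 (-ord w (algebraMap K L g)) := by
  obtain ⟨_, _, _, _, _⟩ := exists_dedekind_setup (L := K) hv
  have htow : IsScalarTower v.valuationSubring K L := IsScalarTower.of_algebraMap_eq fun r =>
    IsScalarTower.algebraMap_apply k K L (r : k)
  obtain ⟨a, b, hab, rfl⟩ :=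
    IsFractionRing.exists_reduced_fraction (A := integralClosure v.valuationSubring K) g
  obtain ⟨r, s, hrs⟩ := hab.isCoprime
  have hb0 : ((b : integralClosure v.valuationSubring K) : K) ≠ 0 := fun h =>
    nonZeroDivisors.ne_zero b.2 (Subtype.ext h)
  have hg0 : IsLocalization.mk' K a b = (a : K) / (b : integralClosure v.valuationSubring K) :=
    IsFractionRing.mk'_eq_div _
  rw [hg0] at hg ⊢
  have ha0 : (a : K) ≠ 0 := fun h => hg (by rw [h, zero_div]; exact isIntegral_zero)
  have key := fun w hw => max_zero_neg_ord_div (L := L) hrs ha0 hb0 (w := w) hw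
  have keyK := fun w hw => max_zero_neg_ord_div (L := K) hrs ha0 hb0 (w := w) hw
  have hK := finite_placesOver (L := K) hv
  have hpos : 0 < ord v (Algebra.norm k ((b : integralClosure v.valuationSubring K) : K)) := by
    rw [← sum_placesOver hv hK hb0]
    have h0 : ∀ w ∈ hK.toFinset, 0 ≤ (residueDegree (algebraMap k K).fieldRange w : ℤ) *
        ord w ((b : integralClosure v.valuationSubring K) : K) := fun w hw =>
      mul_nonneg (by positivity) ((ord_nonneg_iff w).2
        (le_one_of_isIntegral ((Set.Finite.mem_toFinset hK).1 hw) b.1.2))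
    obtain ⟨w, hw, hwg⟩ : ∃ w ∈ placesOver v K,
        ¬ w ((a : K) / (b : integralClosure v.valuationSubring K)) ≤ 1 := by
      by_contra! h
      exact hg (isIntegral_of_forall_placesOver hv h)
    refine Finset.sum_pos' h0 ⟨w, (Set.Finite.mem_toFinset hK).2 hw, ?_⟩
    have h1 := keyK w hw
    rw [← ord_nonneg_iff, not_le] at hwg
    have h2 := residueDegree_pos hv hw
    rw [Algebra.algebraMap_self_apply, Algebra.algebraMap_self_apply] at h1
    exact mul_pos (by exact_mod_cast h2) (by omega)
  have hbL : algebraMap K L (b : integralClosure v.valuationSubring K) ≠ 0 := by simp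
  rw [Finset.sum_congr rfl fun w hw => congrArg _ (key w ((Set.Finite.mem_toFinset h).1 hw)),
    sum_placesOver hv h hbL, ← Algebra.norm_norm (S := K), Algebra.norm_algebraMap, map_pow,
    ord_pow]
  nlinarith [Module.finrank_pos (R := K) (M := L)]

end Tower

end PlacesOver

/-! ### Valuations defined by order functions -/

section OrderFunction

variable {A : Type*} [CommRing A] [IsDomain A]

/-- The nonzero elements of a domain are valued in `ℤ` by `o`. -/
structure IsOrderFunction (o : A → ℤ) : Prop where
  map_mul : ∀ a b, a ≠ 0 → b ≠ 0 → o (a * b) = o a + o b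
  map_add : ∀ a b, a ≠ 0 → b ≠ 0 → a + b ≠ 0 → min (o a) (o b) ≤ o (a + b)

namespace IsOrderFunction

variable {o : A → ℤ} (ho : IsOrderFunction o)
include ho

theorem map_one : o 1 = 0 := by
  have := ho.map_mul 1 1 one_ne_zero one_ne_zero
  rw [mul_one] at this
  omega

open Classical in
/-- The valuation of a domain defined by an order function. -/
def ringValuation : Valuation A ℤᵐ⁰ where
  toFun a := if a = 0 then 0 else WithZero.exp (-o a)
  map_zero' := by simp
  map_one' := by simp [ho.map_one]
  map_mul' a b := by
    by_cases ha : a = 0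
    · simp [ha]
    by_cases hb : b = 0
    · simp [hb]
    simp only [mul_eq_zero, ha, hb, or_self, if_false]
    rw [ho.map_mul a b ha hb, neg_add, WithZero.exp_add]
  map_add_le_max' a b := by
    by_cases ha : a = 0
    · simp [ha]
    by_cases hb : b = 0
    · simp [hb]
    by_cases hab : a + b = 0
    · simp [hab]
    simp only [ha, hb, hab, if_false]
    have := ho.map_add a b ha hb hab
    rw [le_max_iff, WithZero.exp_le_exp, WithZero.exp_le_exp]
    omega

theorem ringValuation_of_ne_zero {a : A} (ha : a ≠ 0) :
    ho.ringValuation a = WithZero.exp (-o a) := by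
  simp [ringValuation, ha]

variable (k : Type*) [Field k] [Algebra A k] [IsFractionRing A k]

/-- The valuation of the quotient field defined by an order function. -/
def valuation : Valuation k ℤᵐ⁰ :=
  ho.ringValuation.extendToLocalization (S := nonZeroDivisors A) (fun a ha => by
    change ho.ringValuation a ≠ 0
    rw [ho.ringValuation_of_ne_zero (nonZeroDivisors.ne_zero ha)]
    exact WithZero.exp_ne_zero) k

theorem ord_valuation_algebraMap {a : A} (ha : a ≠ 0) :
    ord (ho.valuation k) (algebraMap A k a) = o a := by
  rw [ord, valuation, Valuation.extendToLocalization_apply_map_apply,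
    ho.ringValuation_of_ne_zero ha]
  simp

theorem ord_valuation_div {a b : A} (ha : a ≠ 0) (hb : b ≠ 0) :
    ord (ho.valuation k) (algebraMap A k a / algebraMap A k b) = o a - o b := by
  rw [ord_div _ (by simpa using ha) (by simpa using hb), ho.ord_valuation_algebraMap k ha,
    ho.ord_valuation_algebraMap k hb]

end IsOrderFunction

theorem surjective_of_ord_eq_one {k : Type*} [Field k] {v : Valuation k ℤᵐ⁰} {z : k}
    (hz : ord v z = 1) : Function.Surjective v := by
  have hz0 : z ≠ 0 := by rintro rfl; simp [ord_zero] at hz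
  intro y
  by_cases hy : y = 0
  · exact ⟨0, by simp [hy]⟩
  refine ⟨z ^ (-WithZero.log y), ?_⟩
  have h1 : v z = WithZero.exp (-1) := by
    rw [ord] at hz
    rw [← WithZero.exp_log ((Valuation.ne_zero_iff v).2 hz0)]
    congr 1
    omega
  rw [map_zpow₀, h1, ← WithZero.exp_zsmul]
  simp [WithZero.exp_log hy]

end OrderFunction

/-! ### The valuations `v_P` and `v_∞` and their Frobenius -/

section Base

open MvPolynomial

variable {F : Type*} [Field F] {n : ℕ}

theorem isOrderFunction_ordPrime {P : MvPolynomial (Fin n) F} (hP : Irreducible P) :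
    IsOrderFunction (ordPrime P) where
  map_mul a b ha hb := by
    rw [ordPrime, ordPrime, ordPrime, multiplicity_mul hP.prime
      (FiniteMultiplicity.of_not_isUnit hP.not_isUnit (mul_ne_zero ha hb))]
    push_cast
    rfl
  map_add a b ha hb hab := by
    have h1 := FiniteMultiplicity.of_not_isUnit hP.not_isUnit ha
    have h2 := FiniteMultiplicity.of_not_isUnit hP.not_isUnit hb
    have h3 := FiniteMultiplicity.of_not_isUnit hP.not_isUnit hab
    have h4 := min_le_emultiplicity_add (p := P) (a := a) (b := b)
    rw [h1.emultiplicity_eq_multiplicity, h2.emultiplicity_eq_multiplicity,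
      h3.emultiplicity_eq_multiplicity] at h4
    simp only [ordPrime]
    rw [min_le_iff] at h4 ⊢
    exact_mod_cast h4

theorem isOrderFunction_ordInfty : IsOrderFunction (ordInfty (F := F) (n := n)) where
  map_mul a b ha hb := by
    rw [ordInfty, ordInfty, ordInfty, totalDegree_mul_of_isDomain ha hb]
    push_cast
    ring
  map_add a b _ _ _ := by
    have := totalDegree_add a b
    simp only [ordInfty]
    omega

theorem ordPrime_self (P : MvPolynomial (Fin n) F) : ordPrime P P = 1 := by
  rw [ordPrime, multiplicity_self]
  rfl

theorem ordPrime_eq_zero {P Q : MvPolynomial (Fin n) F} (h : ¬ P ∣ Q) : ordPrime P Q = 0 := by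
  rw [ordPrime, multiplicity_eq_zero.2 h]
  rfl

theorem ordPrime_nonneg (P Q : MvPolynomial (Fin n) F) : 0 ≤ ordPrime P Q := by
  rw [ordPrime]; positivity

theorem totalDegree_pos_of_irreducible {P : MvPolynomial (Fin n) F} (hP : Irreducible P) :
    0 < P.totalDegree := by
  rw [pos_iff_ne_zero]
  intro h
  rw [totalDegree_eq_zero_iff_eq_C] at h
  refine hP.not_isUnit ?_
  rw [h]
  exact (isUnit_iff_ne_zero.2 fun h0 => hP.ne_zero (by rw [h, h0, C_0])).map C

/-- Every polynomial over a perfect field is a combination of the monomials of exponents less than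
`p` whose coefficients are `p`-th powers. -/
theorem exists_eq_sum_pow_mul_monomial (p : ℕ) [Fact p.Prime] [CharP F p]
    (hF : Function.Surjective (frobenius F p)) (a : MvPolynomial (Fin n) F) :
    ∃ c : (Fin n → Fin p) → MvPolynomial (Fin n) F,
      a = ∑ I, c I ^ p * monomial (Finsupp.equivFunOnFinite.symm fun i => (I i : ℕ)) 1 ∧
      ∀ I, c I ≠ 0 → p * (c I).totalDegree + ∑ i, (I i : ℕ) ≤ a.totalDegree := by
  classical
  -- As `p`-th powers are additive, the polynomials with such a decomposition and degree bound form
  -- an additive submonoid, and it suffices to treat the monomials of `a`.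
  let M : AddSubmonoid (MvPolynomial (Fin n) F) :=
    { carrier := {y | ∃ c : (Fin n → Fin p) → MvPolynomial (Fin n) F,
        y = ∑ I, c I ^ p * monomial (Finsupp.equivFunOnFinite.symm fun i => (I i : ℕ)) 1 ∧
        ∀ I, c I ≠ 0 → p * (c I).totalDegree + ∑ i, (I i : ℕ) ≤ a.totalDegree}
      zero_mem' := ⟨0, by simp [(Fact.out : p.Prime).ne_zero], by simp⟩
      add_mem' := by
        rintro _ _ ⟨c, rfl, hc⟩ ⟨d, rfl, hd⟩
        refine ⟨c + d, ?_, fun I hI => ?_⟩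
        · rw [← Finset.sum_add_distrib]
          refine Finset.sum_congr rfl fun I _ => ?_
          rw [Pi.add_apply, add_pow_char, add_mul]
        · by_cases h1 : c I = 0
          · rw [Pi.add_apply, h1, zero_add] at hI ⊢
            exact hd I hI
          by_cases h2 : d I = 0
          · rw [Pi.add_apply, h2, add_zero] at hI ⊢
            exact hc I hI
          have h3 := hc I h1
          have h4 := hd I h2
          have h5 := totalDegree_add (c I) (d I)
          rw [Pi.add_apply]
          rcases le_max_iff.1 h5 with h | h
          · have := Nat.mul_le_mul_left p h
            omega
          · have := Nat.mul_le_mul_left p h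
            omega }
  have hp := (Fact.out : p.Prime).pos
  suffices h : ∑ s ∈ a.support, monomial s (a.coeff s) ∈ M by
    rwa [support_sum_monomial_coeff] at h
  refine sum_mem fun s hs => ?_
  obtain ⟨r, hr⟩ := hF (a.coeff s)
  rw [frobenius_def] at hr
  -- Division of the exponents by `p` with remainder splits the monomial; the coefficient is a
  -- `p`-th power because `F` is perfect.
  let I₀ : Fin n → Fin p := fun i => ⟨s i % p, Nat.mod_lt _ hp⟩
  let J : Fin n →₀ ℕ := Finsupp.equivFunOnFinite.symm fun i => s i / p
  have hs' : s = p • J + Finsupp.equivFunOnFinite.symm fun i => (I₀ i : ℕ) := by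
    ext i
    simp [J, I₀, Nat.div_add_mod]
  refine ⟨Pi.single I₀ (monomial J r), ?_, fun I hI => ?_⟩
  · rw [Finset.sum_eq_single I₀]
    · rw [Pi.single_eq_same, monomial_pow, monomial_mul, mul_one, hr, ← hs']
    · intro I _ hI
      rw [Pi.single_eq_of_ne hI, zero_pow hp.ne', zero_mul]
    · simp
  · have hI₀ : I = I₀ := by
      by_contra h
      exact hI (Pi.single_eq_of_ne h _)
    subst hI₀
    rw [Pi.single_eq_same]
    have h1 := totalDegree_monomial_le (σ := Fin n) J r
    have h2 := le_totalDegree hs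
    have h3 : (s.sum fun _ e => e) = ∑ i, s i := Finsupp.sum_fintype _ _ (by simp)
    have h4 : (J.sum fun _ => id) = ∑ i, s i / p := by
      rw [Finsupp.sum_fintype _ _ (by simp)]; rfl
    have h5 : ∑ i, s i = p * ∑ i, s i / p + ∑ i, s i % p := by
      rw [Finset.mul_sum, ← Finset.sum_add_distrib]
      exact Finset.sum_congr rfl fun i _ => (Nat.div_add_mod _ _).symm
    have h6 := Nat.mul_le_mul_left p h1
    have h7 : ∑ i, ((I₀ i : Fin p) : ℕ) = ∑ i, s i % p := rfl
    rw [h3, h5] at h2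
    rw [h4] at h6
    omega

theorem ringHom_finite_of_forall_exists_sum {R S ι : Type*} [CommRing R] [CommRing S] [Fintype ι]
    (f : R →+* S) (m : ι → S) (h : ∀ s, ∃ c : ι → R, s = ∑ i, f (c i) * m i) : f.Finite := by
  classical
  let _ := f.toAlgebra
  refine ⟨⟨Finset.univ.image m, eq_top_iff.2 fun s _ => ?_⟩⟩
  obtain ⟨c, rfl⟩ := h s
  exact sum_mem fun i _ => Submodule.smul_mem _ (c i) (Submodule.subset_span (by simp))

theorem frobenius_finite_of_forall_exists_sum {k ι : Type*} [Field k] [Fintype ι] (p : ℕ)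
    [ExpChar k p] {v : Valuation k ℤᵐ⁰} [ExpChar v.valuationSubring p] (m : ι → k)
    (hm : ∀ i, v (m i) ≤ 1)
    (h : ∀ z, v z ≤ 1 → ∃ c : ι → k, (∀ i, v (c i) ≤ 1) ∧ z = ∑ i, c i ^ p * m i) :
    (frobenius v.valuationSubring p).Finite := by
  refine ringHom_finite_of_forall_exists_sum _ (fun i => ⟨m i, hm i⟩) fun z => ?_
  obtain ⟨c, hc, hz⟩ := h z z.2
  refine ⟨fun i => ⟨c i, hc i⟩, Subtype.ext ?_⟩
  rw [hz, AddSubmonoidClass.coe_finsetSum]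
  rfl

variable (k : Type*) [Field k] [Algebra (MvPolynomial (Fin n) F) k]
  [IsFractionRing (MvPolynomial (Fin n) F) k]

/-- Write an integral element as `a / b = a b ^ (p - 1) / b ^ p` with `P ∤ b` and decompose the
numerator. The coefficients acquire only the denominator `b`, a unit at `P`. -/
theorem frobenius_finite_ordPrime (p : ℕ) [Fact p.Prime] [CharP F p] [ExpChar k p]
    (hF : Function.Surjective (frobenius F p)) {P : MvPolynomial (Fin n) F} (hP : Irreducible P)
    [ExpChar ((isOrderFunction_ordPrime hP).valuation k).valuationSubring p] :
    (frobenius ((isOrderFunction_ordPrime hP).valuation k).valuationSubring p).Finite := by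
  have hord := fun {a b} => (isOrderFunction_ordPrime hP).ord_valuation_div k (a := a) (b := b)
  have hord' := fun {a} => (isOrderFunction_ordPrime hP).ord_valuation_algebraMap k (a := a)
  set v := (isOrderFunction_ordPrime hP).valuation k
  have hint : ∀ a : MvPolynomial (Fin n) F, v (algebraMap _ k a) ≤ 1 := by
    intro a
    by_cases ha : a = 0
    · simp [ha]
    rw [← ord_nonneg_iff, hord' ha]
    exact ordPrime_nonneg P a
  refine frobenius_finite_of_forall_exists_sum p (fun I : Fin n → Fin p => algebraMap _ k
    (monomial (Finsupp.equivFunOnFinite.symm fun i => (I i : ℕ)) 1)) (fun I => hint _) ?_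
  intro z hz
  obtain ⟨a, b, hb, hPb, rfl⟩ : ∃ a b : MvPolynomial (Fin n) F, b ≠ 0 ∧ ¬ P ∣ b ∧
      algebraMap _ k a / algebraMap _ k b = z := by
    obtain ⟨a, b, hb, rfl⟩ := IsFractionRing.div_surjective (A := MvPolynomial (Fin n) F) z
    have hb0 : b ≠ 0 := nonZeroDivisors.ne_zero hb
    by_cases ha : a = 0
    · exact ⟨0, 1, one_ne_zero, hP.not_dvd_one, by simp [ha]⟩
    rw [← ord_nonneg_iff, hord ha hb0, ordPrime, ordPrime, sub_nonneg, Nat.cast_le] at hz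
    obtain ⟨b', hb', hPb'⟩ := (FiniteMultiplicity.of_not_isUnit hP.not_isUnit
      hb0).exists_eq_pow_mul_and_not_dvd
    obtain ⟨a', ha'⟩ := (pow_dvd_pow P hz).trans (pow_multiplicity_dvd P a)
    have hP0 : algebraMap _ k (P ^ multiplicity P b) ≠ 0 := by
      simpa using pow_ne_zero (multiplicity P b) hP.ne_zero
    refine ⟨a', b', ?_, hPb', ?_⟩
    · rintro rfl; exact hPb' (dvd_zero P)
    · conv_rhs => rw [hb', ha', map_mul, map_mul, mul_div_mul_left _ _ hP0]
  obtain ⟨c, hc, -⟩ := exists_eq_sum_pow_mul_monomial p hF (a * b ^ (p - 1))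
  have hb1 : algebraMap _ k b ≠ 0 := by simpa using hb
  refine ⟨fun I => algebraMap _ k (c I) / algebraMap _ k b, fun I => ?_, ?_⟩
  · have h1 : v (algebraMap _ k b) = 1 := by
      rw [← ord_eq_zero_iff _ hb1, hord' hb, ordPrime_eq_zero hPb]
    rw [map_div₀, h1, div_one]
    exact hint _
  · have h1 := congrArg (algebraMap _ k) hc
    have hp := (Fact.out : p.Prime).pos
    rw [map_mul, map_pow, map_sum] at h1
    have h2 : algebraMap _ k a / algebraMap _ k b =
        algebraMap _ k a * algebraMap _ k b ^ (p - 1) / algebraMap _ k b ^ p := by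
      rw [div_eq_div_iff hb1 (pow_ne_zero _ hb1), mul_assoc, ← pow_succ, Nat.sub_add_cancel hp]
    rw [h2, h1, Finset.sum_div]
    refine Finset.sum_congr rfl fun I _ => ?_
    rw [map_mul, map_pow, div_pow]
    ring

/-- The same decomposition applies, but the monomials have poles at infinity. Division by `X₀ ^ (p
e)`, with `e` the ceiling of the degree over `p`, makes them integral. The compensating factor `X₀ ^
e` keeps the coefficients integral thanks to the degree bound in `exists_eq_sum_pow_mul_monomial`.
-/
theorem frobenius_finite_ordInfty [NeZero n] (p : ℕ) [Fact p.Prime] [CharP F p] [ExpChar k p]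
    (hF : Function.Surjective (frobenius F p))
    [ExpChar ((isOrderFunction_ordInfty (F := F) (n := n)).valuation k).valuationSubring p] :
    (frobenius ((isOrderFunction_ordInfty (F := F) (n := n)).valuation k).valuationSubring
      p).Finite := by
  have hord := fun {a b} =>
    (isOrderFunction_ordInfty (F := F) (n := n)).ord_valuation_div k (a := a) (b := b)
  set v := (isOrderFunction_ordInfty (F := F) (n := n)).valuation k
  have hp := (Fact.out : p.Prime).pos
  let e : (Fin n → Fin p) → ℕ := fun I => (∑ i, (I i : ℕ) + (p - 1)) / p
  have he1 : ∀ I, ∑ i, ((I i : Fin p) : ℕ) ≤ p * e I := fun I => by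
    have := Nat.div_add_mod (∑ i, ((I i : Fin p) : ℕ) + (p - 1)) p
    have := Nat.mod_lt (∑ i, ((I i : Fin p) : ℕ) + (p - 1)) hp
    simp only [e]
    omega
  have he2 : ∀ I (s t : ℕ), p * s + ∑ i, ((I i : Fin p) : ℕ) ≤ p * t → s + e I ≤ t := by
    intro I s t h
    have h1 : e I ≤ t - s := by
      rw [Nat.div_le_iff_le_mul_add_pred hp, Nat.mul_sub]
      omega
    have h2 : s ≤ t := Nat.le_of_mul_le_mul_left (by omega) hp
    omega
  have hX : (X (0 : Fin n) : MvPolynomial (Fin n) F) ≠ 0 := X_ne_zero _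
  have hX1 : algebraMap _ k (X (0 : Fin n) : MvPolynomial (Fin n) F) ≠ 0 := by simp
  have hXd : ∀ m : ℕ, ((X (0 : Fin n) : MvPolynomial (Fin n) F) ^ m).totalDegree = m :=
    fun m => totalDegree_X_pow _ _
  refine frobenius_finite_of_forall_exists_sum p (fun I : Fin n → Fin p => algebraMap _ k
    (monomial (Finsupp.equivFunOnFinite.symm fun i => (I i : ℕ)) (1 : F)) /
      algebraMap (MvPolynomial (Fin n) F) k (X 0 ^ (p * e I))) (fun I => ?_) ?_
  · rw [← ord_nonneg_iff, hord (by simp) (pow_ne_zero _ hX), ordInfty, ordInfty, hXd,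
      totalDegree_monomial _ one_ne_zero, Finsupp.sum_fintype _ _ (by simp)]
    have := he1 I
    simp only [Finsupp.equivFunOnFinite_symm_apply_apply]
    omega
  intro z hz
  obtain ⟨a, b, hb, rfl⟩ := IsFractionRing.div_surjective (A := MvPolynomial (Fin n) F) z
  have hb0 : b ≠ 0 := nonZeroDivisors.ne_zero hb
  by_cases ha : a = 0
  · exact ⟨0, by simp, by simp [ha, hp.ne']⟩
  rw [← ord_nonneg_iff, hord ha hb0, ordInfty, ordInfty] at hz
  obtain ⟨c, hc, hcd⟩ := exists_eq_sum_pow_mul_monomial p hF (a * b ^ (p - 1))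
  have hb1 : algebraMap _ k b ≠ 0 := by simpa using hb0
  have hdeg : (a * b ^ (p - 1)).totalDegree ≤ p * b.totalDegree := by
    refine (totalDegree_mul _ _).trans ?_
    have h1 := totalDegree_pow b (p - 1)
    have h2 : p * b.totalDegree = b.totalDegree + (p - 1) * b.totalDegree := by
      obtain ⟨q, rfl⟩ := Nat.exists_eq_succ_of_ne_zero hp.ne'
      rw [Nat.succ_sub_one, Nat.succ_mul]
      ring
    omega
  refine ⟨fun I => algebraMap _ k (c I * X 0 ^ e I) / algebraMap _ k b, fun I => ?_, ?_⟩
  · by_cases h0 : c I = 0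
    · simp [h0]
    rw [← ord_nonneg_iff, hord (mul_ne_zero h0 (pow_ne_zero _ hX)) hb0, ordInfty, ordInfty,
      totalDegree_mul_of_isDomain h0 (pow_ne_zero _ hX), hXd]
    have := he2 I _ _ ((hcd I h0).trans hdeg)
    omega
  · have h1 := congrArg (algebraMap _ k) hc
    rw [map_mul, map_pow, map_sum] at h1
    have h2 : algebraMap _ k a / algebraMap _ k b =
        algebraMap _ k a * algebraMap _ k b ^ (p - 1) / algebraMap _ k b ^ p := by
      rw [div_eq_div_iff hb1 (pow_ne_zero _ hb1), mul_assoc, ← pow_succ, Nat.sub_add_cancel hp]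
    rw [h2, h1, Finset.sum_div]
    refine Finset.sum_congr rfl fun I _ => ?_
    rw [map_mul, map_pow, div_pow, map_mul, map_pow, map_pow, mul_pow, ← pow_mul, mul_comm (e I)]
    field_simp

end Base

/-! ### The product formula on the rational function field -/

section BaseSystem

open MvPolynomial

variable (F : Type*) [Field F] (n : ℕ)

/-- The base valuations of `F(x₁, …, xₙ)`: one for each class of irreducible polynomials up to
constants, and `none` for the valuation `v_∞`. -/
abbrev BaseIndex : Type _ :=
  Option {P : MvPolynomial (Fin n) F // Irreducible P ∧ Quot.out (Associates.mk P) = P}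

variable {F n}

/-- The order function of a base valuation. -/
def baseOrd : BaseIndex F n → MvPolynomial (Fin n) F → ℤ
  | none => ordInfty
  | some P => ordPrime P.1

/-- The degree of a base valuation. -/
def baseDeg : BaseIndex F n → ℕ
  | none => 1
  | some P => P.1.totalDegree

theorem isOrderFunction_baseOrd : ∀ i : BaseIndex F n, IsOrderFunction (baseOrd i)
  | none => isOrderFunction_ordInfty
  | some P => isOrderFunction_ordPrime P.2.1

theorem baseDeg_pos : ∀ i : BaseIndex F n, 0 < baseDeg i
  | none => Nat.one_pos
  | some P => totalDegree_pos_of_irreducible P.2.1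

theorem exists_baseIndex {P : MvPolynomial (Fin n) F} (hP : Irreducible P) :
    ∃ Q : {Q : MvPolynomial (Fin n) F // Irreducible Q ∧ Quot.out (Associates.mk Q) = Q},
      Associated P Q.1 := by
  have h : Associated (Quot.out (Associates.mk P)) P :=
    Associates.mk_eq_mk_iff_associated.1 (Quot.out_eq (Associates.mk P))
  refine ⟨⟨Quot.out (Associates.mk P), h.symm.irreducible hP, ?_⟩, h.symm⟩
  rw [Associates.mk_eq_mk_iff_associated.2 h]

theorem eq_of_dvd {P Q : {Q : MvPolynomial (Fin n) F // Irreducible Q ∧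
    Quot.out (Associates.mk Q) = Q}} (h : P.1 ∣ Q.1) : P = Q := by
  have h1 : Associated P.1 Q.1 := P.2.1.associated_of_dvd Q.2.1 h
  rw [Subtype.ext_iff, ← P.2.2, ← Q.2.2, Associates.mk_eq_mk_iff_associated.2 h1]

theorem totalDegree_eq_zero_of_isUnit {u : MvPolynomial (Fin n) F} (hu : IsUnit u) :
    u.totalDegree = 0 := by
  obtain ⟨u, rfl⟩ := hu
  have h := totalDegree_mul_of_isDomain u.ne_zero (u⁻¹).ne_zero
  rw [← Units.val_mul, mul_inv_cancel, Units.val_one, totalDegree_one] at h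
  omega

theorem totalDegree_eq_of_associated {P Q : MvPolynomial (Fin n) F} (hP : P ≠ 0)
    (h : Associated P Q) : P.totalDegree = Q.totalDegree := by
  obtain ⟨u, rfl⟩ := h
  rw [totalDegree_mul_of_isDomain hP u.ne_zero, totalDegree_eq_zero_of_isUnit u.isUnit, add_zero]

theorem ordPrime_eq_of_associated {P Q : MvPolynomial (Fin n) F} (h : Associated P Q) :
    ordPrime P = ordPrime Q := by
  ext a
  rw [ordPrime, ordPrime, multiplicity_eq_of_associated_left h]

theorem baseOrd_of_isUnit {u : MvPolynomial (Fin n) F} (hu : IsUnit u) :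
    ∀ i : BaseIndex F n, baseOrd i u = 0
  | none => by rw [baseOrd, ordInfty, totalDegree_eq_zero_of_isUnit hu]; rfl
  | some P => ordPrime_eq_zero fun h => P.2.1.not_isUnit (isUnit_of_dvd_unit h hu)

/-- By multiplicativity it suffices to consider units, with all orders zero, and primes. A prime has
order `1` at its own class, of weight its degree, and minus its degree at infinity. -/
theorem finite_support_and_sum_baseOrd {a : MvPolynomial (Fin n) F} (ha : a ≠ 0) :
    (Function.support fun i : BaseIndex F n => (baseDeg i : ℤ) * baseOrd i a).Finite ∧
      ∑ᶠ i : BaseIndex F n, (baseDeg i : ℤ) * baseOrd i a = 0 := by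
  induction a using UniqueFactorizationMonoid.induction_on_prime with
  | h₁ => exact absurd rfl ha
  | h₂ u hu => simp [baseOrd_of_isUnit hu]
  | h₃ a π ha' hπ ih =>
    obtain ⟨h1, h2⟩ := ih ha'
    obtain ⟨P, hP⟩ := exists_baseIndex hπ.irreducible
    have h0 : ∀ i : BaseIndex F n, i ∉ ({none, some P} : Set (BaseIndex F n)) →
        (baseDeg i : ℤ) * baseOrd i π = 0 := by
      rintro (_ | Q) hQ
      · simp at hQ
      · have : baseOrd (some Q) π = 0 := ordPrime_eq_zero fun h => hQ (by
          rw [eq_of_dvd (h.trans hP.dvd)]; simp)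
        rw [this, mul_zero]
    have h3 : Function.support (fun i : BaseIndex F n => (baseDeg i : ℤ) * baseOrd i π) ⊆
        ({none, some P} : Set (BaseIndex F n)) := fun i hi => by
      by_contra h
      exact hi (h0 i h)
    have h4 := (Set.toFinite ({none, some P} : Set (BaseIndex F n))).subset h3
    have h5 : ∑ᶠ i : BaseIndex F n, (baseDeg i : ℤ) * baseOrd i π = 0 := by
      classical
      rw [finsum_eq_sum_of_support_subset (s := {none, some P}) _ (by simpa using h3),
        Finset.sum_pair (by simp)]
      simp only [baseDeg, baseOrd]
      rw [ordInfty, totalDegree_eq_of_associated hπ.ne_zero hP, ← ordPrime_eq_of_associated hP,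
        ordPrime_self]
      push_cast
      ring
    have h6 : (fun i : BaseIndex F n => (baseDeg i : ℤ) * baseOrd i (π * a)) =
        fun i => (baseDeg i : ℤ) * baseOrd i π + (baseDeg i : ℤ) * baseOrd i a := by
      ext i
      rw [(isOrderFunction_baseOrd i).map_mul _ _ hπ.ne_zero ha', mul_add]
    rw [h6]
    refine ⟨(h4.union h1).subset (Function.support_add _ _), ?_⟩
    rw [finsum_add_distrib h4 h1, h5, h2, add_zero]

variable (k : Type*) [Field k] [Algebra (MvPolynomial (Fin n) F) k]
  [IsFractionRing (MvPolynomial (Fin n) F) k]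

/-- The base valuations of `F(x₁, …, xₙ)`. -/
def baseVal (i : BaseIndex F n) : Valuation k ℤᵐ⁰ := (isOrderFunction_baseOrd i).valuation k

theorem ord_baseVal_algebraMap (i : BaseIndex F n) {a : MvPolynomial (Fin n) F} (ha : a ≠ 0) :
    ord (baseVal k i) (algebraMap _ k a) = baseOrd i a :=
  (isOrderFunction_baseOrd i).ord_valuation_algebraMap k ha

theorem ord_baseVal_div (i : BaseIndex F n) {a b : MvPolynomial (Fin n) F} (ha : a ≠ 0)
    (hb : b ≠ 0) :
    ord (baseVal k i) (algebraMap _ k a / algebraMap _ k b) = baseOrd i a - baseOrd i b :=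
  (isOrderFunction_baseOrd i).ord_valuation_div k ha hb

theorem surjective_baseVal [NeZero n] : ∀ i : BaseIndex F n, Function.Surjective (baseVal k i)
  | none => surjective_of_ord_eq_one (z := algebraMap (MvPolynomial (Fin n) F) k 1 /
      algebraMap (MvPolynomial (Fin n) F) k (X 0)) (by
      rw [ord_baseVal_div k none one_ne_zero (X_ne_zero _), baseOrd, ordInfty, ordInfty]
      simp)
  | some P => surjective_of_ord_eq_one (z := algebraMap _ k P.1) (by
      rw [ord_baseVal_algebraMap k (some P) P.2.1.ne_zero]
      exact ordPrime_self P.1)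

theorem baseVal_injective : Function.Injective (baseVal (F := F) (n := n) k) := by
  have h1 : ∀ (P : {P : MvPolynomial (Fin n) F // Irreducible P ∧ Quot.out (Associates.mk P) = P})
      (j : BaseIndex F n), baseVal k (some P) = baseVal k j → some P = j := by
    intro P j h
    have h2 := ord_baseVal_algebraMap k (some P) P.2.1.ne_zero
    rw [h, ord_baseVal_algebraMap k j P.2.1.ne_zero] at h2
    have h3 : baseOrd (some P) P.1 = 1 := ordPrime_self P.1
    rw [h3] at h2
    match j with
    | none =>
      simp only [baseOrd, ordInfty] at h2
      omega
    | some Q =>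
      refine congrArg some (eq_of_dvd ?_).symm
      by_contra h4
      have h5 : baseOrd (some Q) P.1 = 0 := ordPrime_eq_zero h4
      omega
  intro i j h
  match i, j with
  | some P, j => exact h1 P j h
  | none, some Q => exact (h1 Q none h.symm).symm
  | none, none => rfl

theorem finite_support_baseVal (z : k) :
    {i : BaseIndex F n | ord (baseVal k i) z ≠ 0}.Finite := by
  obtain ⟨a, b, hb, rfl⟩ := IsFractionRing.div_surjective (A := MvPolynomial (Fin n) F) z
  have hb0 : b ≠ 0 := nonZeroDivisors.ne_zero hb
  by_cases ha : a = 0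
  · simp [ha, ord_zero]
  refine ((finite_support_and_sum_baseOrd ha).1.union
    (finite_support_and_sum_baseOrd hb0).1).subset fun i hi => ?_
  by_contra h
  have h0 := (baseDeg_pos i).ne'
  simp only [Set.mem_union, Function.mem_support, ne_eq, mul_eq_zero, Nat.cast_eq_zero, h0,
    false_or, not_or, not_not] at h
  rw [Set.mem_ofPred_eq, ord_baseVal_div k i ha hb0, h.1, h.2] at hi
  exact hi (sub_self 0)

/-- The product formula on `F(x₁, …, xₙ)`. -/
theorem finsum_baseDeg_mul_ord (z : k) :
    ∑ᶠ i : BaseIndex F n, (baseDeg i : ℤ) * ord (baseVal k i) z = 0 := by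
  obtain ⟨a, b, hb, rfl⟩ := IsFractionRing.div_surjective (A := MvPolynomial (Fin n) F) z
  have hb0 : b ≠ 0 := nonZeroDivisors.ne_zero hb
  by_cases ha : a = 0
  · simp [ha, ord_zero]
  obtain ⟨h1, h2⟩ := finite_support_and_sum_baseOrd ha
  obtain ⟨h3, h4⟩ := finite_support_and_sum_baseOrd hb0
  simp only [ord_baseVal_div k _ ha hb0, mul_sub]
  rw [finsum_sub_distrib h1 h3, h2, h4, sub_zero]

/-- The elements that are integral at all base valuations are constant. -/
theorem exists_algebraMap_C_eq {z : k} (hz : ∀ i : BaseIndex F n, 0 ≤ ord (baseVal k i) z) :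
    ∃ c : F, algebraMap (MvPolynomial (Fin n) F) k (C c) = z := by
  obtain ⟨a, b, hab, rfl⟩ :=
    IsFractionRing.exists_reduced_fraction (A := MvPolynomial (Fin n) F) z
  have hb0 : (b : MvPolynomial (Fin n) F) ≠ 0 := nonZeroDivisors.ne_zero b.2
  by_cases ha : a = 0
  · exact ⟨0, by simp [ha]⟩
  simp only [IsFractionRing.mk'_eq_div, ord_baseVal_div k _ ha hb0] at hz ⊢
  have hbu : IsUnit (b : MvPolynomial (Fin n) F) := by
    by_contra hbu
    obtain ⟨π, hπ, hπb⟩ := WfDvdMonoid.exists_irreducible_factor hbu hb0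
    obtain ⟨P, hP⟩ := exists_baseIndex hπ
    have hPb : P.1 ∣ (b : MvPolynomial (Fin n) F) := hP.symm.dvd.trans hπb
    have hPa : ¬ P.1 ∣ a := fun h => P.2.1.not_isUnit (hab h hPb)
    have h1 := hz (some P)
    have h2 : baseOrd (some P) a = 0 := ordPrime_eq_zero hPa
    have h3 : multiplicity P.1 (b : MvPolynomial (Fin n) F) ≠ 0 := fun h =>
      multiplicity_eq_zero.1 h hPb
    have h4 : baseOrd (some P) (b : MvPolynomial (Fin n) F) =
      (multiplicity P.1 (b : MvPolynomial (Fin n) F) : ℤ) := rfl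
    omega
  obtain ⟨u, hu⟩ := hbu
  have h1 := hz none
  simp only [baseOrd_of_isUnit ⟨u, hu⟩, sub_zero] at h1
  have h2 : (a * ((u⁻¹ : (MvPolynomial (Fin n) F)ˣ) : MvPolynomial (Fin n) F)).totalDegree = 0 := by
    rw [totalDegree_mul_of_isDomain ha (Units.ne_zero _),
      totalDegree_eq_zero_of_isUnit (Units.isUnit _)]
    simp only [baseOrd, ordInfty] at h1
    omega
  refine ⟨_, (congrArg _ (totalDegree_eq_zero_iff_eq_C.1 h2).symm).trans ?_⟩
  rw [eq_div_iff (by simp), ← map_mul, ← hu, mul_assoc, Units.inv_mul, mul_one]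

theorem frobenius_finite_baseVal [NeZero n] (p : ℕ) [Fact p.Prime] [CharP F p] [ExpChar k p]
    (hF : Function.Surjective (frobenius F p)) : ∀ (i : BaseIndex F n)
    [ExpChar (baseVal k i).valuationSubring p], (frobenius (baseVal k i).valuationSubring p).Finite
  | none, h => by
    have _ : ExpChar ((isOrderFunction_ordInfty (F := F) (n := n)).valuation k).valuationSubring p :=
      h
    exact frobenius_finite_ordInfty k p hF
  | some P, h => by
    have _ : ExpChar ((isOrderFunction_ordPrime P.2.1).valuation k).valuationSubring p := h
    exact frobenius_finite_ordPrime k p hF P.2.1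

/-- The integral closures of the valuation rings of the base valuations are finite. -/
theorem finite_integralClosure_baseVal [NeZero n] (p : ℕ) [Fact p.Prime] [CharP F p] [CharP k p]
    (hF : Function.Surjective (frobenius F p)) (i : BaseIndex F n) (L : Type*) [Field L]
    [Algebra k L] [FiniteDimensional k L] :
    Module.Finite (baseVal k i).valuationSubring
      (integralClosure (baseVal k i).valuationSubring L) := by
  have _ := isDiscreteValuationRing_valuationSubring (surjective_baseVal k i)
  have _ : ExpChar k p := ExpChar.prime Fact.out
  have _ : ExpChar (baseVal k i).valuationSubring p :=
    RingHom.expChar (algebraMap (baseVal k i).valuationSubring k)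
      (FaithfulSMul.algebraMap_injective _ _) p
  exact finite_integralClosure_of_frobenius_finite (k := k) p (frobenius_finite_baseVal k p hF i)

end BaseSystem

/-! ### The product formula on finite extensions -/

section GlobalPlaces

open MvPolynomial

variable {F : Type*} [Field F] {n : ℕ} {k : Type*} [Field k] [Algebra (MvPolynomial (Fin n) F) k]
  [IsFractionRing (MvPolynomial (Fin n) F) k] {L : Type*} [Field L] [Algebra k L]

theorem isIntegral_of_coeff_minpoly {v : Valuation k ℤᵐ⁰} {y : L} (hy : IsIntegral k y)
    (h : ∀ j, v ((minpoly k y).coeff j) ≤ 1) : IsIntegral v.valuationSubring y := by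
  have h1 : minpoly k y ∈ Polynomial.lifts (algebraMap v.valuationSubring k) :=
    (Polynomial.lifts_iff_coeff_lifts _).2 fun j => ⟨⟨_, h j⟩, rfl⟩
  obtain ⟨q, hq, -, hqm⟩ := Polynomial.lifts_and_natDegree_eq_and_monic h1 (minpoly.monic hy)
  refine ⟨q, hqm, ?_⟩
  have h2 := minpoly.aeval k y
  rw [← hq, Polynomial.aeval_map_algebraMap] at h2
  exact h2

variable (F n k) in
/-- The base valuations at which `y` is not a unit. -/
def nonunitIndices (y : L) : Set (BaseIndex F n) :=
  {i | ¬ (IsIntegral (baseVal k i).valuationSubring y ∧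
    IsIntegral (baseVal k i).valuationSubring y⁻¹)}

theorem finite_setOf_not_isIntegral [FiniteDimensional k L] (y : L) :
    {i : BaseIndex F n | ¬ IsIntegral (baseVal k i).valuationSubring y}.Finite := by
  refine ((minpoly k y).support.finite_toSet.biUnion fun j _ =>
    finite_support_baseVal (F := F) (n := n) k ((minpoly k y).coeff j)).subset fun i hi => ?_
  by_contra h
  refine hi (isIntegral_of_coeff_minpoly (Algebra.IsIntegral.isIntegral y) fun j => ?_)
  by_cases hj : (minpoly k y).coeff j = 0
  · simp [hj]
  rw [← ord_nonneg_iff]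
  simp only [Set.mem_iUnion, not_exists] at h
  have h1 := h j (Polynomial.mem_support_iff.2 hj)
  rw [Set.mem_ofPred_eq, not_not] at h1
  exact h1.ge

theorem finite_nonunitIndices [FiniteDimensional k L] (y : L) :
    (nonunitIndices F n k y).Finite := by
  refine ((finite_setOf_not_isIntegral (F := F) (n := n) (k := k) y).union
    (finite_setOf_not_isIntegral (F := F) (n := n) (k := k) y⁻¹)).subset ?_
  intro i hi
  by_contra h
  simp only [Set.mem_union, Set.mem_ofPred_eq, not_or, not_not] at h
  exact hi h

theorem ord_eq_zero_of_notMem_nonunitIndices {i : BaseIndex F n} {y : L}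
    (hi : i ∉ nonunitIndices F n k y) {M : Type*} [Field M] [Algebra k M] [Algebra L M]
    [IsScalarTower k L M] {w : Valuation M ℤᵐ⁰} (hw : w ∈ placesOver (baseVal k i) M) :
    ord w (algebraMap L M y) = 0 := by
  rw [nonunitIndices, Set.mem_ofPred_eq, not_not] at hi
  have htow : IsScalarTower (baseVal k i).valuationSubring L M :=
    IsScalarTower.of_algebraMap_eq fun r => IsScalarTower.algebraMap_apply k L M (r : k)
  have h1 := (ord_nonneg_iff w).2 (le_one_of_isIntegral hw
    (hi.1.map (IsScalarTower.toAlgHom (baseVal k i).valuationSubring L M)))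
  have h2 := (ord_nonneg_iff w).2 (le_one_of_isIntegral hw
    (hi.2.map (IsScalarTower.toAlgHom (baseVal k i).valuationSubring L M)))
  rw [IsScalarTower.coe_toAlgHom'] at h1 h2
  rw [map_inv₀, ord_inv] at h2
  omega

/-- Both base valuations take the value `1`, so the two ramification indices divide each other and
can be cancelled. -/
theorem eq_of_mem_placesOver [NeZero n] {i j : BaseIndex F n} {w : Valuation L ℤᵐ⁰}
    (hi : w ∈ placesOver (baseVal k i) L) (hj : w ∈ placesOver (baseVal k j) L) : i = j := by
  obtain ⟨-, e, he, h⟩ := hi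
  obtain ⟨-, e', he', h'⟩ := hj
  have h1 : ∀ z, (e : ℤ) * ord (baseVal k i) z = e' * ord (baseVal k j) z := fun z => by
    rw [← h, ← h']
  have hone : ∀ i : BaseIndex F n, ∃ z, ord (baseVal k i) z = 1 := fun i => by
    obtain ⟨z, hz⟩ := surjective_baseVal k i (WithZero.exp (-1))
    exact ⟨z, by simp [ord, hz]⟩
  obtain ⟨z, hz⟩ := hone i
  obtain ⟨z', hz'⟩ := hone j
  have h2 := h1 z
  have h3 := h1 z'
  rw [hz, mul_one] at h2
  rw [hz', mul_one] at h3
  have h4 : (e : ℤ) = e' :=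
    Int.dvd_antisymm (by positivity) (by positivity) ⟨_, h3.symm⟩ ⟨_, h2⟩
  have he0 : (e : ℤ) ≠ 0 := by exact_mod_cast he.ne'
  refine baseVal_injective k (Valuation.ext fun z => ?_)
  by_cases hz : z = 0
  · simp [hz]
  have h5 := h1 z
  rw [← h4] at h5
  have h6 := mul_left_cancel₀ he0 h5
  have h7 : ∀ u : Valuation k ℤᵐ⁰, u z = WithZero.exp (-ord u z) := fun u => by
    rw [ord, neg_neg, WithZero.exp_log ((Valuation.ne_zero_iff _).2 hz)]
  rw [h7, h7 (baseVal k j), h6]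

/-- An element that is integral at all base valuations is algebraic over the constants. -/
theorem exists_monic_eval₂_eq_zero [NeZero n] [FiniteDimensional k L] {g : L}
    (hg : ∀ i : BaseIndex F n, IsIntegral (baseVal k i).valuationSubring g) :
    ∃ q : Polynomial F, q.Monic ∧ q.eval₂ ((algebraMap k L).comp
      ((algebraMap (MvPolynomial (Fin n) F) k).comp C)) g = 0 := by
  have h1 : minpoly k g ∈ Polynomial.lifts ((algebraMap (MvPolynomial (Fin n) F) k).comp C) := by
    refine (Polynomial.lifts_iff_coeff_lifts _).2 fun j => ?_
    -- Valuation rings are integrally closed, so the minimal polynomial over `k` has coefficients in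
    -- each of them. Elements in all of these rings are constants.
    refine (exists_algebraMap_C_eq k fun i => ?_)
    have _ := isDiscreteValuationRing_valuationSubring (surjective_baseVal k i)
    rw [minpoly.isIntegrallyClosed_eq_field_fractions' k (hg i), Polynomial.coeff_map,
      ord_nonneg_iff]
    exact ((minpoly (baseVal k i).valuationSubring g).coeff j).2
  obtain ⟨q, hq, -, hqm⟩ := Polynomial.lifts_and_natDegree_eq_and_monic h1
    (minpoly.monic (Algebra.IsIntegral.isIntegral g))
  refine ⟨q, hqm, ?_⟩
  have h2 := minpoly.aeval k g
  rw [← hq, Polynomial.aeval_def, Polynomial.eval₂_map] at h2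
  exact h2

variable [NeZero n] [FiniteDimensional k L]

/-- The sum of a function over all places above the base valuations in a finite set of indices. -/
theorem finsum_mem_iUnion_placesOver {f : Valuation L ℤᵐ⁰ → ℝ} {T : Finset (BaseIndex F n)}
    (hfin : ∀ i : BaseIndex F n, (placesOver (baseVal k i) L).Finite)
    (hf : ∀ i ∉ T, ∀ w ∈ placesOver (baseVal k i) L, f w = 0) :
    ∑ᶠ w ∈ ⋃ i : BaseIndex F n, placesOver (baseVal k i) L, f w =
      ∑ i ∈ T, ∑ w ∈ (hfin i).toFinset, f w := by
  have h1 : ∑ᶠ w ∈ ⋃ i : BaseIndex F n, placesOver (baseVal k i) L, f w =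
      ∑ᶠ w ∈ ⋃ i ∈ (T : Set (BaseIndex F n)), placesOver (baseVal k i) L, f w := by
    refine finsum_mem_inter_support_eq f _ _ ?_
    ext w
    simp only [Set.mem_inter_iff, Set.mem_iUnion, Function.mem_support, Finset.mem_coe]
    constructor
    · rintro ⟨⟨i, hi⟩, hw⟩
      exact ⟨⟨i, by_contra fun h => hw (hf i h w hi), hi⟩, hw⟩
    · rintro ⟨⟨i, -, hi⟩, hw⟩
      exact ⟨⟨i, hi⟩, hw⟩
  rw [h1, finsum_mem_biUnion (fun i _ j _ hij => Set.disjoint_left.2 fun w hw hw' =>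
    hij (eq_of_mem_placesOver hw hw')) T.finite_toSet (fun i _ => hfin i),
    finsum_mem_coe_finset]
  exact Finset.sum_congr rfl fun i _ => finsum_mem_eq_finite_toFinset_sum _ (hfin i)

/-- The product formula on a finite extension of `F(x₁, …, xₙ)`. -/
theorem sum_baseDeg_mul_sum_placesOver
    [∀ i : BaseIndex F n, Module.Finite (baseVal k i).valuationSubring
      (integralClosure (baseVal k i).valuationSubring L)]
    (hfin : ∀ i : BaseIndex F n, (placesOver (baseVal k i) L).Finite) {y : L} (hy : y ≠ 0)
    {T : Finset (BaseIndex F n)} (hT : nonunitIndices F n k y ⊆ T) :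
    ∑ i ∈ T, (baseDeg i : ℤ) * ∑ w ∈ (hfin i).toFinset,
      (residueDegree (algebraMap k L).fieldRange w : ℤ) * ord w y = 0 := by
  -- Apply the product formula of `k` to the norm; `sum_placesOver` distributes its values over the
  -- places of `L`.
  have h1 := finsum_baseDeg_mul_ord (F := F) (n := n) k (Algebra.norm k y)
  rw [finsum_eq_sum_of_support_subset (s := T)] at h1
  · rw [← h1]
    exact Finset.sum_congr rfl fun i _ => by
      rw [sum_placesOver (surjective_baseVal k i) (hfin i) hy]
  · intro i hi
    by_contra h
    refine hi ?_
    change (baseDeg i : ℤ) * ord (baseVal k i) (Algebra.norm k y) = 0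
    rw [← sum_placesOver (surjective_baseVal k i) (hfin i) hy, Finset.sum_eq_zero, mul_zero]
    intro w hw
    have h2 := ord_eq_zero_of_notMem_nonunitIndices (M := L) (fun h' => h (hT h'))
      ((Set.Finite.mem_toFinset (hfin i)).1 hw)
    rw [Algebra.algebraMap_self_apply] at h2
    rw [h2, mul_zero]

end GlobalPlaces

open TwistedPolynomial

/-! ### The global lower bound -/

namespace DrinfeldModule

section Integrality

variable {Fq : Type*} [Field Fq] [Fintype Fq] {A : Type*} [CommRing A] [Algebra Fq A]
  {K : Type*} [Field K] [Algebra Fq K] (φ : DrinfeldModule Fq A K)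
  {L : Type*} [Field L] [Algebra K L] {t : A} {w : Valuation L ℤᵐ⁰} (ht : 0 < φ.rk t)
include ht

theorem rk_mem_support : φ.rk t ∈ (φ.toRingHom t).support :=
  mem_support.2 (coeff_tauDegree_ne_zero (φ.toRingHom_ne_zero_of_rk_pos ht))

theorem defect_eq_zero
    (h : ∀ j ∈ (φ.toRingHom t).support, ord w (algebraMap K L ((φ.toRingHom t).coeff j)) = 0) :
    φ.defect t w = 0 := by
  by_contra hne
  obtain ⟨j, hj, hj'⟩ :=
    φ.exists_neg_slope_eq_defect w (lt_of_le_of_ne (φ.defect_nonneg t w) (Ne.symm hne))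
  rw [← hj', slope, shift, h j hj, h _ (φ.rk_mem_support ht)] at hne
  simp at hne

theorem localV_eq_zero
    (h : ∀ j ∈ (φ.toRingHom t).support, ord w (algebraMap K L ((φ.toRingHom t).coeff j)) = 0)
    {x : L} (hx : ord w x = 0) : φ.localV t w x = 0 := by
  have h1 : ∀ m : ℕ, w (φ.act (t ^ m) x) ≤ 1 := by
    intro m
    induction m with
    | zero => rw [pow_zero, act_one, ← ord_nonneg_iff, hx]
    | succ m ih =>
      rw [pow_succ', act_mul, act, eval]
      refine w.map_sum_le fun j hj => ?_
      rw [map_mul, map_pow]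
      exact mul_le_one' ((ord_nonneg_iff w).1 (h j hj).ge) (pow_le_one' ih _)
  have h2 := φ.tendsto_localV w ht x
  have h3 : ∀ m : ℕ, ordMinZero w (φ.act (t ^ m) x) = 0 := fun m => by
    rw [ordMinZero, min_eq_left ((ord_nonneg_iff w).2 (h1 m)), Int.cast_zero]
  simp only [h3, zero_div] at h2
  exact tendsto_nhds_unique h2 tendsto_const_nhds

/-- The quotient is the `(N - 1)`-st power of the coefficient of `τ ^ j` in the monic conjugate, so
its value is `(N - 1)` times the slope at `j`. -/
theorem max_zero_neg_ord_le {j : ℕ} (hj : (φ.toRingHom t).coeff j ≠ 0) :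
    ((max 0 (-ord w (algebraMap K L ((φ.toRingHom t).coeff j ^ (Fintype.card Fq ^ φ.rk t - 1) /
      (φ.toRingHom t).coeff (φ.rk t) ^ (Fintype.card Fq ^ j - 1)))) : ℤ) : ℝ) ≤
        ((φ.toRingHom t).degree - 1) * φ.defect t w := by
  have hN := φ.degree_sub_one_pos ht
  have h0 := φ.defect_nonneg t w
  have h1 := φ.neg_slope_le_defect w (mem_support.2 hj)
  have h2 := φ.ord_leadingCoeff w ht
  have hr := mem_support.1 (φ.rk_mem_support ht)
  have h3 : 1 ≤ Fintype.card Fq ^ φ.rk t := Nat.one_le_pow _ _ Fintype.card_pos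
  have h4 : 1 ≤ Fintype.card Fq ^ j := Nat.one_le_pow _ _ Fintype.card_pos
  have h5 : (((φ.toRingHom t).degree : ℕ) : ℝ) = (Fintype.card Fq : ℝ) ^ φ.rk t := by
    rw [degree]; push_cast; rfl
  have h6 : (ord w (algebraMap K L ((φ.toRingHom t).coeff j ^ (Fintype.card Fq ^ φ.rk t - 1) /
      (φ.toRingHom t).coeff (φ.rk t) ^ (Fintype.card Fq ^ j - 1))) : ℝ) =
      ((φ.toRingHom t).degree - 1) * φ.slope t w j := by
    rw [map_div₀, map_pow, map_pow, ord_div _ (pow_ne_zero _ (by simpa using hj))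
      (pow_ne_zero _ (by simpa using hr)), ord_pow, ord_pow, slope]
    push_cast [Nat.cast_sub h3, Nat.cast_sub h4]
    rw [h2, h5]
    ring
  rw [Int.cast_max, Int.cast_zero, Int.cast_neg, h6]
  refine max_le (mul_nonneg hN.le h0) ?_
  nlinarith

end Integrality

section GlobalBound

universe u₁

variable {Fq : Type*} [Field Fq] [Fintype Fq] {A : Type*} [CommRing A] [Algebra Fq A]
  {K : Type u₁} [Field K] [Algebra Fq K] (φ : DrinfeldModule Fq A K)
  {F : Type*} [Field F] {n : ℕ} [NeZero n] {k : Type*} [Field k]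
  [Algebra (MvPolynomial (Fin n) F) k] [IsFractionRing (MvPolynomial (Fin n) F) k]
  [Algebra k K] [FiniteDimensional k K] {t : A}

/-- The lower bound for the local heights, summed over the places above a finite set of base
valuations. -/
theorem finrank_le_mul_sum_localV (ht : 0 < φ.rk t) {j : ℕ}
    (hj : (φ.toRingHom t).coeff j ≠ 0) {i₀ : BaseIndex F n}
    (hi₀ : ¬ IsIntegral (baseVal k i₀).valuationSubring
      ((φ.toRingHom t).coeff j ^ (Fintype.card Fq ^ φ.rk t - 1) /
        (φ.toRingHom t).coeff (φ.rk t) ^ (Fintype.card Fq ^ j - 1)))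
    {L : Type*} [Field L] [Algebra k L] [Algebra K L] [IsScalarTower k K L] [FiniteDimensional K L]
    [FiniteDimensional k L]
    [∀ i : BaseIndex F n, Module.Finite (baseVal k i).valuationSubring
      (integralClosure (baseVal k i).valuationSubring K)]
    [∀ i : BaseIndex F n, Module.Finite (baseVal k i).valuationSubring
      (integralClosure (baseVal k i).valuationSubring L)]
    (hfin : ∀ i : BaseIndex F n, (placesOver (baseVal k i) L).Finite) {x y : L} (hy : y ≠ 0)
    {M : ℝ} {T : Finset (BaseIndex F n)} (hi₀T : i₀ ∈ T) (hyT : nonunitIndices F n k y ⊆ T)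
    (hφT : ∀ l ∈ (φ.toRingHom t).support,
      nonunitIndices F n k ((φ.toRingHom t).coeff l) ⊆ T)
    (h : ∀ i ∈ T, ∀ w ∈ placesOver (baseVal k i) L,
      -(ord w y + φ.shift t w) + φ.defect t w / (4 * (φ.toRingHom t).degree) ≤
        M * -φ.localV t w x) :
    (Module.finrank K L : ℝ) ≤
      4 * (φ.toRingHom t).degree * ((φ.toRingHom t).degree - 1) * M *
        ∑ i ∈ T, ∑ w ∈ (hfin i).toFinset,
          (residueDegree (algebraMap k L).fieldRange w * baseDeg i : ℝ) * -φ.localV t w x := by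
  set N : ℝ := ((φ.toRingHom t).degree : ℝ) with hN
  have hN1 : 0 < N - 1 := φ.degree_sub_one_pos ht
  have hN0 : 0 < N := by linarith
  set c : BaseIndex F n → Valuation L ℤᵐ⁰ → ℝ := fun i w =>
    residueDegree (algebraMap k L).fieldRange w * baseDeg i with hc
  have hc0 : ∀ i w, 0 ≤ c i w := fun i w => by positivity
  have hprod : ∀ z : L, z ≠ 0 → nonunitIndices F n k z ⊆ T →
      ∑ i ∈ T, ∑ w ∈ (hfin i).toFinset, c i w * ord w z = 0 := by
    intro z hz hzT
    have h1 := congrArg (Int.cast : ℤ → ℝ) (sum_baseDeg_mul_sum_placesOver hfin hz hzT)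
    push_cast at h1
    rw [← h1]
    refine Finset.sum_congr rfl fun i _ => ?_
    rw [Finset.mul_sum]
    exact Finset.sum_congr rfl fun w _ => by simp only [hc]; ring
  have hr := mem_support.1 (φ.rk_mem_support ht)
  -- `(N - 1)` times the shift is the value of the leading coefficient, to which the product formula
  -- applies.
  have hshift : ∑ i ∈ T, ∑ w ∈ (hfin i).toFinset, c i w * φ.shift t w = 0 := by
    have h1 : ∑ i ∈ T, ∑ w ∈ (hfin i).toFinset,
        c i w * ord w (algebraMap K L ((φ.toRingHom t).coeff (φ.rk t))) = 0 := by
      refine hprod _ (by simpa using hr) ?_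
      intro i hi
      refine hφT _ (φ.rk_mem_support ht) fun h' => hi ?_
      have htow : IsScalarTower (baseVal k i).valuationSubring K L :=
        IsScalarTower.of_algebraMap_eq fun r => IsScalarTower.algebraMap_apply k K L (r : k)
      refine ⟨h'.1.map (IsScalarTower.toAlgHom (baseVal k i).valuationSubring K L), ?_⟩
      rw [← map_inv₀]
      exact h'.2.map (IsScalarTower.toAlgHom (baseVal k i).valuationSubring K L)
    simp only [φ.ord_leadingCoeff _ ht, ← mul_assoc, ← Finset.sum_mul] at h1
    exact (mul_eq_zero.1 h1).resolve_right hN1.ne'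
  -- The poles of the invariant above `i₀` alone account for `[L : K]`; the base degree is at least
  -- `1` and the other places contribute non-negative terms.
  have hdef : (Module.finrank K L : ℝ) ≤
      (N - 1) * ∑ i ∈ T, ∑ w ∈ (hfin i).toFinset, c i w * φ.defect t w := by
    have h1 : (Module.finrank K L : ℝ) ≤ ∑ w ∈ (hfin i₀).toFinset,
        (residueDegree (algebraMap k L).fieldRange w : ℝ) * ((N - 1) * φ.defect t w) := by
      have h2 := Int.cast_le (R := ℝ).2
        (finrank_le_sum_placesOver (L := L) (surjective_baseVal k i₀) (hfin i₀) hi₀)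
      rw [Int.cast_natCast, Int.cast_sum] at h2
      refine h2.trans (Finset.sum_le_sum fun w _ => ?_)
      rw [Int.cast_mul, Int.cast_natCast]
      exact mul_le_mul_of_nonneg_left (φ.max_zero_neg_ord_le ht hj) (Nat.cast_nonneg _)
    have h3 : ∑ w ∈ (hfin i₀).toFinset,
        (residueDegree (algebraMap k L).fieldRange w : ℝ) * ((N - 1) * φ.defect t w) ≤
        (N - 1) * ∑ w ∈ (hfin i₀).toFinset, c i₀ w * φ.defect t w := by
      rw [Finset.mul_sum]
      refine Finset.sum_le_sum fun w _ => ?_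
      have h4 : (1 : ℝ) ≤ baseDeg i₀ := by exact_mod_cast baseDeg_pos i₀
      have h5 : 0 ≤ (residueDegree (algebraMap k L).fieldRange w : ℝ) *
        ((N - 1) * φ.defect t w) :=
        mul_nonneg (Nat.cast_nonneg _) (mul_nonneg hN1.le (φ.defect_nonneg t w))
      simp only [hc]
      nlinarith
    refine (h1.trans h3).trans (mul_le_mul_of_nonneg_left ?_ hN1.le)
    exact Finset.single_le_sum (f := fun i => ∑ w ∈ (hfin i).toFinset, c i w * φ.defect t w)
      (fun i _ => Finset.sum_nonneg fun w _ => mul_nonneg (hc0 i w) (φ.defect_nonneg t w)) hi₀T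
  have hsum : ∑ i ∈ T, ∑ w ∈ (hfin i).toFinset,
      c i w * (-(ord w y + φ.shift t w) + φ.defect t w / (4 * N)) ≤
      ∑ i ∈ T, ∑ w ∈ (hfin i).toFinset, c i w * (M * -φ.localV t w x) :=
    Finset.sum_le_sum fun i hi => Finset.sum_le_sum fun w hw =>
      mul_le_mul_of_nonneg_left (h i hi w ((Set.Finite.mem_toFinset (hfin i)).1 hw)) (hc0 i w)
  have h1 : ∀ i w, c i w * (-(ord w y + φ.shift t w) + φ.defect t w / (4 * N)) =
      c i w * φ.defect t w * (1 / (4 * N)) - c i w * ord w y - c i w * φ.shift t w := by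
    intro i w; ring
  have h2 : ∀ i w, c i w * (M * -φ.localV t w x) = M * (c i w * -φ.localV t w x) := by
    intro i w; ring
  simp only [h1, h2, Finset.sum_sub_distrib, ← Finset.mul_sum, ← Finset.sum_mul] at hsum
  rw [hprod y hy hyT, hshift, sub_zero, sub_zero, mul_one_div, div_le_iff₀ (by positivity)] at hsum
  have h3 := mul_le_mul_of_nonneg_left hsum hN1.le
  refine hdef.trans (h3.trans (le_of_eq ?_))
  ring

/-- A positive lower bound for the sums of the local heights of nontorsion points over all places
above the base valuations, in all purely inseparable extensions. -/
theorem exists_pos_le_finsum (p : ℕ) [Fact p.Prime] [CharP F p] [CharP k p]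
    (hF : Function.Surjective (frobenius F p)) (ht : 0 < φ.rk t) {j : ℕ}
    (hj : (φ.toRingHom t).coeff j ≠ 0) {i₀ : BaseIndex F n}
    (hi₀ : ¬ IsIntegral (baseVal k i₀).valuationSubring
      ((φ.toRingHom t).coeff j ^ (Fintype.card Fq ^ φ.rk t - 1) /
        (φ.toRingHom t).coeff (φ.rk t) ^ (Fintype.card Fq ^ j - 1))) :
    ∃ C : ℝ, 0 < C ∧ ∀ (L : Type u₁) [Field L] [Algebra k L] [Algebra K L] [IsScalarTower k K L]
      [FiniteDimensional K L] [IsPurelyInseparable K L] (d : Valuation L ℤᵐ⁰ → ℝ),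
      (∀ i : BaseIndex F n, ∀ w ∈ placesOver (baseVal k i) L,
        d w = residueDegree (algebraMap k L).fieldRange w * baseDeg i / Module.finrank k L) →
      ∀ x : L, ¬ φ.IsTorsion x →
        C ≤ ∑ᶠ w ∈ ⋃ i : BaseIndex F n, placesOver (baseVal k i) L, d w * -φ.localV t w x := by
  classical
  have hintK := fun i => finite_integralClosure_baseVal (F := F) (n := n) k p hF i K
  set N := (φ.toRingHom t).degree with hN
  have hN1 : (0 : ℝ) < N - 1 := φ.degree_sub_one_pos ht
  have hN0 : (0 : ℝ) < N := by linarith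
  have hI : (⋃ l ∈ (φ.toRingHom t).support,
      nonunitIndices F n k ((φ.toRingHom t).coeff l)).Finite :=
    (φ.toRingHom t).support.finite_toSet.biUnion fun l _ => finite_nonunitIndices _
  let I := hI.toFinset
  have hmemI : ∀ i ∉ I, ∀ l ∈ (φ.toRingHom t).support,
      i ∉ nonunitIndices F n k ((φ.toRingHom t).coeff l) := fun i hi l hl h =>
    hi (hI.mem_toFinset.2 (Set.mem_biUnion hl h))
  -- `S` counts places of `K`, so that `S`, `D` and `M` are chosen before `L`.
  let S := ∑ i ∈ I, (placesOver (baseVal k i) K).ncard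
  obtain ⟨D, hD⟩ : ∃ D, (N ^ 7) ^ S = D := ⟨_, rfl⟩
  let M : ℝ := (1 + 2 * (N : ℝ) ^ (D + 4)) * (N : ℝ) ^ D
  have hM : 0 < M := by positivity
  have hkK : (0 : ℝ) < Module.finrank k K := by exact_mod_cast Module.finrank_pos
  refine ⟨1 / (4 * N * (N - 1) * M * Module.finrank k K), by positivity, ?_⟩
  intro L _ _ _ _ _ _ d hd x hx
  have hkL : FiniteDimensional k L := FiniteDimensional.trans k K L
  have hintL := fun i => finite_integralClosure_baseVal (F := F) (n := n) k p hF i L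
  have hfin : ∀ i : BaseIndex F n, (placesOver (baseVal k i) L).Finite := fun i =>
    finite_placesOver (surjective_baseVal k i)
  let B := (I.biUnion fun i => (hfin i).toFinset).filter fun w => 0 < φ.defect t w
  have hBS : B.card ≤ S := by
    refine (Finset.card_filter_le _ _).trans (Finset.card_biUnion_le.trans
      (Finset.sum_le_sum fun i _ => ?_))
    rw [← Set.ncard_eq_toFinset_card _ (hfin i)]
    exact ncard_placesOver_le (surjective_baseVal k i)
  obtain ⟨y, hy, hyw⟩ := φ.exists_ne_zero_forall_localV_le ht hx S B
    (fun w hw => (Finset.mem_filter.1 hw).2) hBS hD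
  have hx' := finite_nonunitIndices (F := F) (n := n) (k := k) x
  have hy' := finite_nonunitIndices (F := F) (n := n) (k := k) y
  -- Outside `T` the point `x` and the nonzero coefficients of `φ_t` are units, so the local heights
  -- vanish; `y` is included for the product formula and `i₀` for the poles of the invariant.
  let T := I ∪ hx'.toFinset ∪ hy'.toFinset ∪ {i₀}
  have hT : ∀ i ∉ T, i ∉ I ∧ i ∉ nonunitIndices F n k x := fun i hi => by
    simp only [T, Finset.mem_union, not_or, Set.Finite.mem_toFinset] at hi
    exact ⟨hi.1.1.1, hi.1.1.2⟩
  have hunit : ∀ i ∉ I, ∀ w ∈ placesOver (baseVal k i) L, ∀ l ∈ (φ.toRingHom t).support,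
      ord w (algebraMap K L ((φ.toRingHom t).coeff l)) = 0 := fun i hi w hw l hl =>
    ord_eq_zero_of_notMem_nonunitIndices (hmemI i hi l hl) hw
  rw [finsum_mem_iUnion_placesOver (T := T) hfin]
  · have key := φ.finrank_le_mul_sum_localV (L := L) ht hj hi₀ hfin (x := x) hy (M := M) (T := T)
      (by simp [T]) (fun i hi => by simp [T, hi])
      (fun l hl i hi => by
        have h1 : i ∈ I := hI.mem_toFinset.2 (Set.mem_biUnion hl hi)
        simp [T, h1])
      (fun i _ w hw => hyw w fun hdef => by
        refine Finset.mem_filter.2 ⟨Finset.mem_biUnion.2 ⟨i, ?_, (hfin i).mem_toFinset.2 hw⟩, hdef⟩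
        by_contra hi
        exact hdef.ne' (φ.defect_eq_zero ht (hunit i hi w hw)))
    have hKL : (0 : ℝ) < Module.finrank K L := by exact_mod_cast Module.finrank_pos
    have h1 : ∑ i ∈ T, ∑ w ∈ (hfin i).toFinset, d w * -φ.localV t w x =
        (∑ i ∈ T, ∑ w ∈ (hfin i).toFinset,
          (residueDegree (algebraMap k L).fieldRange w * baseDeg i : ℝ) * -φ.localV t w x) /
          (Module.finrank k K * Module.finrank K L) := by
      rw [Finset.sum_div]
      refine Finset.sum_congr rfl fun i _ => ?_
      rw [Finset.sum_div]
      refine Finset.sum_congr rfl fun w hw => ?_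
      rw [hd i w ((hfin i).mem_toFinset.1 hw), ← Module.finrank_mul_finrank k K L]
      push_cast
      ring
    -- The factor `[L : K]` of `[L : k]` cancels against the lower bound in `key`, which leaves a
    -- constant that depends only on `[K : k]`.
    rw [h1, le_div_iff₀ (by positivity), one_div, inv_mul_le_iff₀ (by positivity)]
    nlinarith [mul_le_mul_of_nonneg_left key hkK.le]
  · intro i hi w hw
    have h1 := ord_eq_zero_of_notMem_nonunitIndices (M := L) (hT i hi).2 hw
    rw [Algebra.algebraMap_self_apply] at h1
    rw [φ.localV_eq_zero ht (hunit i (hT i hi).1 w hw) h1, neg_zero, mul_zero]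

end GlobalBound

end DrinfeldModule

/-! ### Identification with the places and degrees of the height -/

section Identification

open MvPolynomial

variable {F K : Type*} [Field F] [Field K] [Algebra F K] {n : ℕ} {b : Fin n → K}

/-- The polynomial ring acts on the rational function field generated by algebraically independent
elements. -/
@[reducible]
def algebraAdjoin (hb : AlgebraicIndependent F b) :
    Algebra (MvPolynomial (Fin n) F) (IntermediateField.adjoin F (Set.range b)) :=
  (hb.aevalEquivField.toRingHom.comp
    (algebraMap (MvPolynomial (Fin n) F) (FractionRing (MvPolynomial (Fin n) F)))).toAlgebra

theorem coe_algebraMap_algebraAdjoin (hb : AlgebraicIndependent F b) (Q : MvPolynomial (Fin n) F) :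
    letI := algebraAdjoin hb
    ((algebraMap (MvPolynomial (Fin n) F) (IntermediateField.adjoin F (Set.range b)) Q : _) : K) =
      aeval b Q :=
  hb.aevalEquivField_algebraMap_apply_coe Q

theorem isFractionRing_algebraAdjoin (hb : AlgebraicIndependent F b) :
    letI := algebraAdjoin hb
    IsFractionRing (MvPolynomial (Fin n) F) (IntermediateField.adjoin F (Set.range b)) := by
  let _ := algebraAdjoin hb
  exact IsLocalization.isLocalization_of_algEquiv (nonZeroDivisors (MvPolynomial (Fin n) F))
    (AlgEquiv.ofRingEquiv (f := hb.aevalEquivField.toRingEquiv) fun Q => rfl :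
      FractionRing (MvPolynomial (Fin n) F) ≃ₐ[MvPolynomial (Fin n) F]
        IntermediateField.adjoin F (Set.range b))

variable {L : Type*} [Field L] [Algebra K L]

theorem baseField_eq_fieldRange :
    baseField F b L = (algebraMap (IntermediateField.adjoin F (Set.range b)) L).fieldRange := by
  ext y
  constructor
  · rintro ⟨z, hz, rfl⟩
    exact ⟨⟨z, hz⟩, rfl⟩
  · rintro ⟨z, rfl⟩
    exact ⟨z, z.2, rfl⟩

theorem finrank_fieldRange_algebraMap (k L : Type*) [Field k] [Field L] [Algebra k L] :
    Module.finrank (algebraMap k L).fieldRange L = Module.finrank k L :=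
  (Algebra.finrank_eq_of_equiv_equiv
    (RingEquiv.ofBijective (algebraMap k L).rangeRestrictField
      (algebraMap k L).rangeRestrictField_bijective) (RingEquiv.refl L) rfl).symm

variable (hb : AlgebraicIndependent F b)

theorem liesOver_baseOrd_iff (i : BaseIndex F n) {w : Valuation L ℤᵐ⁰} :
    letI := algebraAdjoin hb
    letI := isFractionRing_algebraAdjoin hb
    (Function.Surjective w ∧ LiesOver b w (baseOrd i)) ↔
      w ∈ placesOver (baseVal (IntermediateField.adjoin F (Set.range b)) i) L := by
  let _ := algebraAdjoin hb
  have _ := isFractionRing_algebraAdjoin hb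
  have hval : ∀ Q₁ Q₂ : MvPolynomial (Fin n) F,
      algebraMap (IntermediateField.adjoin F (Set.range b)) L
        (algebraMap _ _ Q₁ / algebraMap _ _ Q₂) = algebraMap K L (aeval b Q₁ / aeval b Q₂) := by
    intro Q₁ Q₂
    rw [← coe_algebraMap_algebraAdjoin hb, ← coe_algebraMap_algebraAdjoin hb]
    rfl
  constructor
  · rintro ⟨hw, e, he, h⟩
    refine ⟨hw, e, he, fun z => ?_⟩
    obtain ⟨Q₁, Q₂, hQ₂, rfl⟩ := IsFractionRing.div_surjective (A := MvPolynomial (Fin n) F) z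
    have hQ₂' : Q₂ ≠ 0 := nonZeroDivisors.ne_zero hQ₂
    by_cases hQ₁ : Q₁ = 0
    · simp [hQ₁, ord_zero]
    rw [hval, h Q₁ Q₂ hQ₁ hQ₂', ord_baseVal_div _ i hQ₁ hQ₂']
  · rintro ⟨hw, e, he, h⟩
    refine ⟨hw, e, he, fun Q₁ Q₂ hQ₁ hQ₂ => ?_⟩
    rw [← hval, h, ord_baseVal_div _ i hQ₁ hQ₂]

theorem hasBaseDegree_iff {w : Valuation L ℤᵐ⁰} {d : ℕ} :
    HasBaseDegree F b w d ↔ ∃ i : BaseIndex F n, LiesOver b w (baseOrd i) ∧ d = baseDeg i := by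
  constructor
  · rintro (⟨P, hP, h, rfl⟩ | ⟨h, rfl⟩)
    · obtain ⟨Q, hQ⟩ := exists_baseIndex hP
      exact ⟨some Q, by rw [baseOrd, ← ordPrime_eq_of_associated hQ]; exact h,
        totalDegree_eq_of_associated hP.ne_zero hQ⟩
    · exact ⟨none, h, rfl⟩
  · rintro ⟨i | P, h, rfl⟩
    · exact Or.inr ⟨h, rfl⟩
    · exact Or.inl ⟨P, P.2.1, h, rfl⟩

theorem goodSet_eq_iUnion :
    letI := algebraAdjoin hb
    letI := isFractionRing_algebraAdjoin hb
    goodSet F b L = ⋃ i : BaseIndex F n,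
      placesOver (baseVal (IntermediateField.adjoin F (Set.range b)) i) L := by
  ext w
  simp only [Set.mem_iUnion, ← liesOver_baseOrd_iff hb]
  constructor
  · rintro ⟨hw, d, hd⟩
    obtain ⟨i, hi, -⟩ := hasBaseDegree_iff.1 hd
    exact ⟨i, hw, hi⟩
  · rintro ⟨i, hw, hi⟩
    exact ⟨hw, _, hasBaseDegree_iff.2 ⟨i, hi, rfl⟩⟩

/-- A place lies over only one base valuation, so the infimum that defines `baseDegree` runs over a
singleton. -/
theorem placeDegree_eq [NeZero n] (i : BaseIndex F n) {w : Valuation L ℤᵐ⁰}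
    (hw : letI := algebraAdjoin hb
      letI := isFractionRing_algebraAdjoin hb
      w ∈ placesOver (baseVal (IntermediateField.adjoin F (Set.range b)) i) L) :
    placeDegree F b w =
      residueDegree (algebraMap (IntermediateField.adjoin F (Set.range b)) L).fieldRange w *
        baseDeg i / Module.finrank (IntermediateField.adjoin F (Set.range b)) L := by
  let _ := algebraAdjoin hb
  have _ := isFractionRing_algebraAdjoin hb
  have h1 : {d | HasBaseDegree F b w d} = {baseDeg i} := by
    ext d
    rw [Set.mem_ofPred_eq, hasBaseDegree_iff, Set.mem_singleton_iff]
    constructor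
    · rintro ⟨j, hj, rfl⟩
      rw [eq_of_mem_placesOver hw ((liesOver_baseOrd_iff hb j).1 ⟨hw.1, hj⟩)]
    · rintro rfl
      exact ⟨i, ((liesOver_baseOrd_iff hb i).2 hw).2, rfl⟩
  rw [placeDegree, baseDegree, h1, csInf_singleton, baseField_eq_fieldRange,
    finrank_fieldRange_algebraMap]

end Identification

/-! ### The field of constants -/

section Constants

variable {p : ℕ} [Fact p.Prime] {K : Type*} [Field K] [Algebra (ZMod p) K]

theorem charP_algebraicClosure : CharP (algebraicClosure (ZMod p) K) p :=
  charP_of_injective_algebraMap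
    (algebraMap (ZMod p) (algebraicClosure (ZMod p) K)).injective p

theorem surjective_frobenius_algebraicClosure [CharP (algebraicClosure (ZMod p) K) p] :
    Function.Surjective (frobenius (algebraicClosure (ZMod p) K) p) := by
  have _ : PerfectField (algebraicClosure (ZMod p) K) :=
    Algebra.IsAlgebraic.perfectField (ZMod p)
  have _ := PerfectField.toPerfectRing (K := algebraicClosure (ZMod p) K) p
  exact surjective_frobenius _ p

theorem mem_algebraicClosure_of_isIntegral {g : K}
    (hg : IsIntegral (algebraicClosure (ZMod p) K) g) : g ∈ algebraicClosure (ZMod p) K := by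
  rw [mem_algebraicClosure_iff]
  have _ := algebraicClosure.isAlgebraic (ZMod p) K
  exact (isIntegral_trans (R := ZMod p) g hg).isAlgebraic

/-- Finitely many elements generate `K` over `𝔽_p`, and each of them is algebraic over `F(x₁, …,
xₙ)`. -/
theorem finiteDimensional_adjoin_transcendenceBasis (hK : (⊤ : IntermediateField (ZMod p) K).FG)
    {n : ℕ} {b : Fin n → K} (hb : IsTranscendenceBasis (algebraicClosure (ZMod p) K) b) :
    FiniteDimensional (IntermediateField.adjoin (algebraicClosure (ZMod p) K) (Set.range b)) K := by
  obtain ⟨s, hs⟩ := hK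
  have hb' := hb.isAlgebraic_field
  set k := IntermediateField.adjoin (algebraicClosure (ZMod p) K) (Set.range b)
  have h1 : IntermediateField.adjoin k (s : Set K) = ⊤ := by
    refine eq_top_iff.2 fun y _ => ?_
    have h2 : y ∈ IntermediateField.adjoin (ZMod p) (s : Set K) := hs ▸ IntermediateField.mem_top
    have h3 : IntermediateField.adjoin (ZMod p) (s : Set K) ≤
        (IntermediateField.adjoin k (s : Set K)).restrictScalars (ZMod p) :=
      IntermediateField.adjoin_le_iff.2 (IntermediateField.subset_adjoin k (s : Set K))
    exact h3 h2
  have h2 : FiniteDimensional k (IntermediateField.adjoin k (s : Set K)) :=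
    IntermediateField.finiteDimensional_adjoin fun x _ => Algebra.IsIntegral.isIntegral x
  rw [h1] at h2
  exact Module.Finite.equiv (IntermediateField.topEquiv (F := k) (E := K)).toLinearEquiv

end Constants

/-! ### Compatibility with embeddings and choice of the element of `A` -/

section Torsion

open TwistedPolynomial

variable {Fq : Type*} [Field Fq] [Fintype Fq] {K : Type*} [Field K] [Algebra Fq K]

theorem TwistedPolynomial.eval_algebraMap {L M : Type*} [Field L] [Algebra K L] [Field M]
    [Algebra K M] (f : TwistedPolynomial Fq K) (σ : L →ₐ[K] M) (x : L) :
    f.eval (σ x) = σ (f.eval x) := by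
  simp only [eval, map_sum, map_mul, map_pow, AlgHom.commutes]

end Torsion

/-- This gives `localV_eq_localV` for every non-constant `a`, so that the constant obtained from one
fixed `t` serves for all `a`. -/
theorem DrinfeldModule.rk_pos_of_transcendental {Fq : Type*} [Field Fq] [Fintype Fq] {E : Type*}
    [Field E] [Algebra Fq E] (hE : Algebra.trdeg Fq E = 1) {A : Subalgebra Fq E} {K : Type*}
    [Field K] [Algebra Fq K] (φ : DrinfeldModule Fq A K) {a t : A} (ha : Transcendental Fq (a : E))
    (ht : 0 < φ.rk t) : 0 < φ.rk a := by
  obtain ⟨P, hP, h⟩ := exists_isPrimitive_relation hE ha (t : E)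
  refine φ.rk_pos_of_relation ht hP (Subtype.val_injective ?_)
  change A.val.toRingHom _ = _
  rw [Polynomial.hom_eval₂]
  refine Eq.trans ?_ h
  congr 1
  refine Polynomial.ringHom_ext (fun c => ?_) ?_
  · simp
  · simp

end Drinfeld
end

theorem corollaryT
    (p : ℕ) [Fact p.Prime]
    -- the finite field `Fq`
    (Fq : Type*) [Field Fq] [Fintype Fq]
    -- the function field `E` of the curve and the point at infinity
    (E : Type*) [Field E] [Algebra Fq E]
    (hE : (⊤ : IntermediateField Fq E).FG) (hE' : Algebra.trdeg Fq E = 1)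
    (Vinf : ValuationSubring E) (hVinf : ∀ c : Fq, algebraMap Fq E c ∈ Vinf) (hVinf' : Vinf ≠ ⊤)
    -- the finitely generated field `K` of characteristic `p`, an extension of `Fq`
    (K : Type*) [Field K] [Algebra (ZMod p) K] [Algebra Fq K]
    (hK : (⊤ : IntermediateField (ZMod p) K).FG)
    -- the Drinfeld module
    (φ : Drinfeld.DrinfeldModule Fq (Drinfeld.regularAway Fq Vinf) K)
    (hφ : 0 < φ.modularTrdeg p)
    -- the transcendence basis of `K` over its field of constants that defines the height
    (n : ℕ) (b : Fin n → K) (hb : IsTranscendenceBasis (algebraicClosure (ZMod p) K) b) :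
    ∃ C : ℝ, 0 < C ∧
      -- `a` is the non-constant element used in the definition of the local heights
      ∀ a : Drinfeld.regularAway Fq Vinf, Transcendental Fq (a : E) →
        ∀ x : AlgebraicClosure K, x ∈ perfectClosure K (AlgebraicClosure K) → ¬ φ.IsTorsion x →
          C ≤ φ.height (algebraicClosure (ZMod p) K) b a x := by
  obtain ⟨t, ht⟩ := φ.exists_rk_pos
  obtain ⟨j, hj, hg⟩ := φ.exists_invariant_transcendental p hφ ht
  -- For `n = 0` the field `K` would be algebraic over its constants, hence over `𝔽_p`, against the
  -- transcendence of the invariant.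
  have hn : NeZero n := ⟨by
    rintro rfl
    have h1 := hb.isEmpty_iff_isAlgebraic.1 inferInstance
    exact hg (Drinfeld.mem_algebraicClosure_of_isIntegral (Algebra.IsIntegral.isIntegral _))⟩
  let F := algebraicClosure (ZMod p) K
  let k := IntermediateField.adjoin F (Set.range b)
  let _ : Algebra (MvPolynomial (Fin n) F) k := Drinfeld.algebraAdjoin hb.1
  have hfrac : IsFractionRing (MvPolynomial (Fin n) F) k :=
    Drinfeld.isFractionRing_algebraAdjoin hb.1
  have hfin : FiniteDimensional k K := Drinfeld.finiteDimensional_adjoin_transcendenceBasis hK hb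
  have hF : CharP F p := Drinfeld.charP_algebraicClosure
  have hk : CharP k p := charP_of_injective_algebraMap (algebraMap F k).injective p
  -- An element integral over all base valuation rings is algebraic over the constants, so the
  -- transcendental invariant fails to be integral over one of them.
  obtain ⟨i₀, hi₀⟩ : ∃ i₀ : Drinfeld.BaseIndex F n,
      ¬ IsIntegral (Drinfeld.baseVal k i₀).valuationSubring
        ((φ.toRingHom t).coeff j ^ (Fintype.card Fq ^ φ.rk t - 1) /
          (φ.toRingHom t).coeff (φ.rk t) ^ (Fintype.card Fq ^ j - 1)) := by
    by_contra! h
    obtain ⟨Q, hQ, hQ0⟩ := Drinfeld.exists_monic_eval₂_eq_zero (k := k) h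
    refine hg (Drinfeld.mem_algebraicClosure_of_isIntegral ⟨Q, hQ, ?_⟩)
    rw [← hQ0]
    congr 1
    ext c
    change (c : K) = ((algebraMap (MvPolynomial (Fin n) F) k (MvPolynomial.C c) : k) : K)
    rw [Drinfeld.coe_algebraMap_algebraAdjoin hb.1, MvPolynomial.aeval_C]
    rfl
  obtain ⟨C, hC, hCle⟩ := φ.exists_pos_le_finsum p
    Drinfeld.surjective_frobenius_algebraicClosure ht hj hi₀
  refine ⟨C, hC, fun a ha x hx hxt => ?_⟩
  have hra := φ.rk_pos_of_transcendental hE' ha ht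
  have hpi : IsPurelyInseparable K (IntermediateField.adjoin K {x}) :=
    (le_perfectClosure_iff _ _ _).1 (IntermediateField.adjoin_simple_le_iff.2 hx)
  have hfd : FiniteDimensional K (IntermediateField.adjoin K {x}) :=
    IntermediateField.adjoin.finiteDimensional (Algebra.IsIntegral.isIntegral x)
  -- The height is computed at the generator of `K(x)`; the inclusion of `K(x)` in the algebraic
  -- closure carries torsion to torsion.
  have hgen : ¬ φ.IsTorsion (IntermediateField.AdjoinSimple.gen K x) := by
    rintro ⟨c, hc, h⟩
    refine hxt ⟨c, hc, ?_⟩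
    have h1 := Drinfeld.TwistedPolynomial.eval_algebraMap (φ.toRingHom c)
      (IntermediateField.adjoin K {x}).val (IntermediateField.AdjoinSimple.gen K x)
    rw [Drinfeld.DrinfeldModule.act] at h ⊢
    rw [h, map_zero] at h1
    exact h1
  refine (hCle _ (Drinfeld.placeDegree F b) (fun i w hw => Drinfeld.placeDegree_eq hb.1 i hw) _
    hgen).trans (le_of_eq ?_)
  rw [Drinfeld.DrinfeldModule.height, Drinfeld.DrinfeldModule.heightOn,
    Drinfeld.goodSet_eq_iUnion hb.1]
  refine finsum_mem_congr rfl fun w _ => ?_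
  rw [Drinfeld.DrinfeldModule.localHeight, φ.localV_eq_localV w hra ht]
  ring
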